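/- Let $k$ be a field. All algebras are associative unital $k$-algebras and $\otimes=\otimes_k$. For an algebra $A$ let $A^\circ$ be the opposite algebra and $A^e=A\otimes A^\circ$, so that $A$ is a left $A^e$-module by $(a\otimes b)\cdot x=axb$. Noetherian means left and right noetherian. For a ring $B$ let $\operatorname{injdim}B$ be the injective dimension of $B$ as a left $B$-module. With values in $\{-\infty\}\cup\mathbb{N}\cup\{\infty\}$ (where $\sup\emptyset=-\infty$ and $\infty\pm1=\infty$) define - $\operatorname{htr}A=\operatorname{injdim}A^e$; - $\operatorname{fhtr}A=\sup\{i\ge 0 : \operatorname{Ext}^i_{A^e}(A,A^e)\ne 0\}$; - $\operatorname{thtr}A=\sup\{\operatorname{injdim}(A\otimes U)\}$, where $U$ ranges over all division algebras over $k$ such that $A\otimes U$ is noetherian. An algebra $A$ is *doubly noetherian* if $A^e$ is noetherian. A simple artinian algebra $A$ is *smooth* if the projective dimension of the $A^e$-module $A$ is finite. A doubly noetherian simple artinian algebra $A$ is *weakly uniform* if $\operatorname{fhtr}A=\operatorname{htr}A=\operatorname{thtr}A<\infty$. **Proposition 2.7.** Let $S$ be a doubly noetherian simple artinian $k$-algebra,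 let $\alpha$ be a $k$-algebra automorphism of $S$, and let $Q=S(t;\alpha)$ be the Goldie quotient ring (total ring of fractions) of the skew polynomial ring $S[t;\alpha]$, in which $ta=\alpha(a)t$ for $a\in S$. 1. If $S$ or $Q$ is smooth, then $\operatorname{htr}Q=\operatorname{htr}S+1$. 2. If $S$ is weakly uniform, then $Q$ is weakly uniform and $\operatorname{htr}Q=\operatorname{htr}S+1$. 3. If $\alpha=\mathrm{id}_S$ and $\operatorname{fhtr}Q=\operatorname{htr}Q$, then $\operatorname{fhtr}S=\operatorname{htr}S=\operatorname{htr}Q-1$. -/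

import Mathlib

open CategoryTheory TensorProduct

universe u v

namespace HomTr

noncomputable section

/-! ### Skew polynomial rings and Goldie quotient rings -/

section SkewPolynomialRing

variable {k : Type v} [Field k] {S : Type u} [Ring S] [Algebra k S]

/-- The action of the multiplicative monoid `ℕ` on `S` in which `n` acts as `α ^ n`. -/
abbrev powerAction (α : S ≃ₐ[k] S) : MulSemiringAction (Multiplicative ℕ) S :=
  MulSemiringAction.compHom S (powersHom (S ≃ₐ[k] S) α)

/-- The skew polynomial ring `S[t; α]`: left `S`-linear combinations of the powers of `t`,
multiplied by the rule `t a = α(a) t`. -/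
def SkewPolynomialRing (_α : S ≃ₐ[k] S) : Type u := SkewPolynomial S

namespace SkewPolynomialRing

variable (α : S ≃ₐ[k] S)

instance : Ring (SkewPolynomialRing α) :=
  letI := powerAction α
  inferInstanceAs (Ring (SkewMonoidAlgebra S (Multiplicative ℕ)))

/-- The inclusion of `S` into `S[t; α]` as the constant polynomials. -/
def C : S →+* SkewPolynomialRing α :=
  letI := powerAction α
  SkewPolynomial.CRingHom

/-- The variable `t` of `S[t; α]`. -/
def t : SkewPolynomialRing α := (SkewPolynomial.X : SkewPolynomial S)

theorem t_mul_C (a : S) : t α * C α a = C α (α a) * t α := by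
  let _ := powerAction α
  have key : (SkewPolynomial.monomial 1 1 : SkewPolynomial S) * SkewPolynomial.C a
      = SkewPolynomial.C (α a) * SkewPolynomial.monomial 1 1 := by
    rw [SkewPolynomial.monomial_mul_C, SkewPolynomial.C_mul_monomial,
      SkewPolynomial.φ_iterate_apply, one_mul, mul_one]
    have h : (Multiplicative.ofAdd 1 • a : S) = (α ^ 1) a := rfl
    rw [h, pow_one]
  exact key

theorem C_algebraMap_comm (c : k) (p : SkewPolynomialRing α) :
    C α (algebraMap k S c) * p = p * C α (algebraMap k S c) := by
  let _ := powerAction α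
  have key : ∀ p : SkewPolynomial S,
      SkewPolynomial.C (algebraMap k S c) * p = p * SkewPolynomial.C (algebraMap k S c) := by
    intro p
    induction p using SkewPolynomial.induction with
    | h0 => rw [mul_zero, zero_mul]
    | ha n r q _ _ ih =>
      rw [mul_add, add_mul, ih, SkewPolynomial.C_mul_monomial, SkewPolynomial.monomial_mul_C,
        SkewPolynomial.φ_iterate_apply]
      have h : (Multiplicative.ofAdd n • algebraMap k S c : S) = algebraMap k S c :=
        AlgEquiv.commutes (α ^ n) c
      rw [h, Algebra.commutes]
  exact key p

/-- `S[t; α]` as an algebra over the base field. -/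
instance : Algebra k (SkewPolynomialRing α) :=
  RingHom.toAlgebra' ((C α).comp (algebraMap k S)) (C_algebraMap_comm α)

end SkewPolynomialRing

end SkewPolynomialRing

/-- The ring homomorphism `j : R → Q` exhibits `Q` as the (two-sided) Goldie quotient ring of `R`,
i.e. its total ring of fractions: `j` is injective, every regular element of `R` becomes
invertible in `Q`, and every element of `Q` is both a left fraction `s⁻¹ r` and a right
fraction `r s⁻¹` with `r, s` in `R` and `s` regular. -/
structure IsGoldieQuotientRing {R Q : Type u} [Ring R] [Ring Q] (j : R →+* Q) : Prop where
  injective : Function.Injective j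
  isUnit_map : ∀ s : R, IsRegular s → IsUnit (j s)
  left_fraction : ∀ q : Q, ∃ r s : R, IsRegular s ∧ j s * q = j r
  right_fraction : ∀ q : Q, ∃ r s : R, IsRegular s ∧ q * j s = j r

/-! ### Homological transcendence degree and its modifications -/

/-- Left and right noetherian. -/
def IsNoetherianBothSides (R : Type u) [Ring R] : Prop :=
  IsNoetherianRing R ∧ IsNoetherianRing Rᵐᵒᵖ

/-- The injective dimension of `R` as a left module over itself. -/
def injdim (R : Type u) [Ring R] : WithBot ℕ∞ :=
  injectiveDimension (ModuleCat.of R R)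

section Invariants

variable (k : Type v) [Field k] (A : Type u) [Ring A] [Algebra k A]

/-- The enveloping algebra `A ⊗ A°`. -/
abbrev Env : Type u := A ⊗[k] Aᵐᵒᵖ

/-- `A` as a left module over its enveloping algebra, `(a ⊗ b) • x = a x b`. -/
def bimod : ModuleCat.{u} (Env k A) :=
  letI : Module (Env k A) A := instModuleTensorProductMop k A
  ModuleCat.of (Env k A) A

/-- `A` is doubly noetherian: its enveloping algebra is noetherian. -/
def IsDoublyNoetherian : Prop := IsNoetherianBothSides (Env k A)

/-- `A` is smooth: the projective dimension of `A` as an `A ⊗ A°`-module is finite. -/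
def IsSmooth : Prop := projectiveDimension (bimod k A) < ⊤

/-- The homological transcendence degree. -/
def htr : WithBot ℕ∞ := injdim (Env k A)

/-- The first modification: the supremum of the degrees `i` with `Ext^i(A, A ⊗ A°) ≠ 0`
(over the enveloping algebra); it is `⊥`, that is `-∞`, if there are none. -/
def fhtr : WithBot ℕ∞ :=
  ⨆ (i : ℕ) (_ : Nontrivial (Abelian.Ext (bimod k A) (ModuleCat.of (Env k A) (Env k A)) i)),
    (i : WithBot ℕ∞)

/-- The third modification: the supremum of the injective dimensions of `A ⊗ U`, where `U` ranges
over all division algebras over `k` such that `A ⊗ U` is noetherian. -/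
def thtr : WithBot ℕ∞ :=
  ⨆ (U : Type u) (_ : DivisionRing U) (_ : Algebra k U) (_ : IsNoetherianBothSides (A ⊗[k] U)),
    injdim (A ⊗[k] U)

/-- `A` is a weakly uniform (doubly noetherian, simple artinian) algebra. -/
structure IsWeaklyUniform : Prop where
  isSimpleRing : IsSimpleRing A
  isArtinianRing : IsArtinianRing A
  isDoublyNoetherian : IsDoublyNoetherian k A
  fhtr_eq_htr : fhtr k A = htr k A
  htr_eq_thtr : htr k A = thtr k A
  thtr_lt_top : thtr k A < ⊤

end Invariants

end

end HomTr

/-! Everything rests on one exact sequence. For an algebra U put A = S ⊗ U and B = Q ⊗ U. A B-module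
X embeds in the coinduced module Hom_A(B, X), and φ ↦ t⁻¹φ(t·) − φ is a surjective endomorphism of
the latter with kernel X (`IsSkewExtension.resolution_shortExact`). The kernel is right because a
map commuting with the coefficients and with t commutes with polynomials, hence with fractions.
Surjectivity asks for φ with φ(tb) = t(φ(b) + ψ(b)), and amounts to extending an action of
polynomials on X × Q to fractions. Both points use that denominators can be taken monic, since a
regular polynomial has a monic left multiple by a length count over the semisimple ring S
(`exists_monic_mul`).

As S is semisimple, B is projective over A, so coinduction is exact; it also preserves injectives.
If A is left noetherian, the projective A-module B has injective dimension at most injdim A, whence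
injdim B ≤ injdim A + 1 (`IsSkewFractionRing.injdim_tensor_le`) and thtr Q ≤ thtr S + 1.

Now take U = Q°. Ext over Qᵉ from Q into a coinduced module is Ext over Sᵉ from S
(`extComparison_coindEval_bijective`), and Qᵉ is projective over Sᵉ; the sequence gives fhtr Q ≤
fhtr S + 1. Conversely, if Extⁿ⁺¹(Q, Qᵉ) = 0, the twist minus the identity is onto on the group
corresponding to Extⁿ(S, Qᵉ) over Sᵉ. Expansion in powers of t⁻¹ yields coefficient maps Qᵉ → Sᵉ
indexed by the powers of w = t ⊗ t⁻¹. The twist shifts the index, and every class has finitely many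
nonzero coefficients because S is a finitely generated module over the noetherian ring Sᵉ; so a
class concentrated in degree 0 can be hit only if it is zero (`subsingleton_ext_of_graded`). Hence
fhtr Q = fhtr S + 1 always (`IsSkewFractionRing.fhtr_eq`).

The three statements follow by squeezing with fhtr ≤ htr. For weak uniformity one adds htr ≤ thtr,
from Wedderburn's theorem for Q° and invariance under matrix rings (`htr_le_thtr`). If S is smooth
of projective dimension n, then Extⁿ(S, Sᵉ) ≠ 0, while S ⊗ U has injective dimension at most n for
every semisimple U, because Hom_S(−, X) turns a projective resolution of the bimodule S into an
injective resolution of X. Smoothness descends from Q to S, the constant coefficient making S a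
direct summand of the bimodule Q. When α is the identity, z = t ⊗ 1 − 1 ⊗ t is central and regular
in Qᵉ, and a change of rings in the manner of Rees gives htr S + 1 ≤ htr Q
(`IsSkewFractionRing.htr_add_one_le`). -/

namespace HomTr

/-! ### Polynomials in a skew variable -/

section SkewVariable

variable {k : Type v} [Field k] {S R : Type u} [Ring S] [Algebra k S] [Ring R] [Algebra k R]

/-- The polynomials `∑ ι aᵢ tⁱ` of degree less than `n`. -/
def polyLT (ι : S →ₐ[k] R) (t : R) (n : ℕ) : Submodule k R :=
  Submodule.span k {r | ∃ i < n, ∃ a : S, r = ι a * t ^ i}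

/-- `m` is a polynomial of the form `tⁿ + ∑_{i < n} ι aᵢ tⁱ`. -/
def IsMonicPoly (ι : S →ₐ[k] R) (t : R) (n : ℕ) (m : R) : Prop :=
  m - t ^ n ∈ polyLT ι t n

/-- `t` satisfies `t a = σ(a) t`. -/
structure IsSkewCommuting (σ : S ≃ₐ[k] S) (ι : S →ₐ[k] R) (t : R) : Prop where
  comm : ∀ a, t * ι a = ι (σ a) * t

/-- `t` satisfies `t a = σ(a) t`, and its powers are linearly independent over `S`. -/
structure IsSkewVariable (σ : S ≃ₐ[k] S) (ι : S →ₐ[k] R) (t : R) : Prop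
    extends IsSkewCommuting σ ι t where
  indep : ∀ n a, ι a * t ^ n ∈ polyLT ι t n → a = 0

variable {σ : S ≃ₐ[k] S} {ι : S →ₐ[k] R} {t : R}

theorem mul_pow_mem_polyLT {i n : ℕ} (h : i < n) (a : S) : ι a * t ^ i ∈ polyLT ι t n :=
  Submodule.subset_span ⟨i, h, a, rfl⟩

theorem pow_mem_polyLT {i n : ℕ} (h : i < n) : t ^ i ∈ polyLT ι t n := by
  simpa using mul_pow_mem_polyLT (ι := ι) (t := t) h 1

theorem map_mem_polyLT {n : ℕ} (h : 0 < n) (a : S) : ι a ∈ polyLT ι t n := by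
  simpa using mul_pow_mem_polyLT (ι := ι) (t := t) h a

theorem polyLT_mono {n m : ℕ} (h : n ≤ m) : polyLT ι t n ≤ polyLT ι t m :=
  Submodule.span_mono fun _ ⟨i, hi, a, e⟩ ↦ ⟨i, hi.trans_le h, a, e⟩

theorem polyLT_zero : polyLT ι t 0 = ⊥ := by
  simp [polyLT]

theorem mem_polyLT_succ {n : ℕ} {p : R} :
    p ∈ polyLT ι t (n + 1) ↔ ∃ a, p - ι a * t ^ n ∈ polyLT ι t n := by
  constructor
  · intro hp
    induction hp using Submodule.span_induction with
    | mem x hx =>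
      obtain ⟨i, hi, a, rfl⟩ := hx
      rcases Nat.lt_succ_iff_lt_or_eq.1 hi with h | rfl
      · exact ⟨0, by simpa using mul_pow_mem_polyLT h a⟩
      · exact ⟨a, by simp⟩
    | zero => exact ⟨0, by simp⟩
    | add x y _ _ hx hy =>
      obtain ⟨a, ha⟩ := hx
      obtain ⟨b, hb⟩ := hy
      refine ⟨a + b, ?_⟩
      have := add_mem ha hb
      rwa [show x + y - ι (a + b) * t ^ n = x - ι a * t ^ n + (y - ι b * t ^ n) by
        rw [map_add, add_mul]; abel]
    | smul c x _ hx =>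
      obtain ⟨a, ha⟩ := hx
      refine ⟨c • a, ?_⟩
      have := Submodule.smul_mem _ c ha
      rwa [smul_sub, ← smul_mul_assoc, ← map_smul] at this
  · rintro ⟨a, ha⟩
    have := add_mem (polyLT_mono (Nat.le_succ n) ha)
      (mul_pow_mem_polyLT (ι := ι) (t := t) (Nat.lt_succ_self n) a)
    simpa using this

theorem isMonicPoly_pow (n : ℕ) : IsMonicPoly ι t n (t ^ n) := by
  simp [IsMonicPoly]

theorem isMonicPoly_one : IsMonicPoly ι t 0 1 := by
  simp [IsMonicPoly]

theorem IsMonicPoly.mem {n : ℕ} {m : R} (h : IsMonicPoly ι t n m) : m ∈ polyLT ι t (n + 1) :=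
  mem_polyLT_succ.2 ⟨1, by rw [map_one, one_mul]; exact h⟩

namespace IsSkewCommuting

theorem pow_mul (h : IsSkewCommuting σ ι t) (n : ℕ) (a : S) :
    t ^ n * ι a = ι ((σ ^ n) a) * t ^ n := by
  induction n with
  | zero => simp
  | succ n ih =>
    rw [pow_succ', mul_assoc, ih, ← mul_assoc, h.comm, mul_assoc, pow_succ' σ]
    rfl

theorem mul_pow (h : IsSkewCommuting σ ι t) (n : ℕ) (a : S) :
    ι a * t ^ n = t ^ n * ι ((σ ^ n).symm a) := by
  rw [h.pow_mul, AlgEquiv.apply_symm_apply]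

theorem mul_mem (h : IsSkewCommuting σ ι t) {n m : ℕ} {p q : R} (hp : p ∈ polyLT ι t n)
    (hq : q ∈ polyLT ι t m) : p * q ∈ polyLT ι t (n + m - 1) := by
  suffices polyLT ι t n * polyLT ι t m ≤ polyLT ι t (n + m - 1) from
    this (Submodule.mul_mem_mul hp hq)
  rw [polyLT, polyLT, Submodule.span_mul_span, Submodule.span_le]
  rintro _ ⟨_, ⟨i, hi, a, rfl⟩, _, ⟨j, hj, b, rfl⟩, rfl⟩
  have : ι a * t ^ i * (ι b * t ^ j) = ι (a * (σ ^ i) b) * t ^ (i + j) := by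
    rw [mul_assoc, ← mul_assoc (t ^ i), h.pow_mul, map_mul, pow_add]
    simp only [mul_assoc]
  simp only [this]
  exact mul_pow_mem_polyLT (by omega) _

theorem mul_mem' (h : IsSkewCommuting σ ι t) {n m d : ℕ} {p q : R} (hp : p ∈ polyLT ι t n)
    (hq : q ∈ polyLT ι t m) (hd : n + m ≤ d + 1) : p * q ∈ polyLT ι t d :=
  polyLT_mono (by omega) (h.mul_mem hp hq)

theorem map_mul_mem (h : IsSkewCommuting σ ι t) {n : ℕ} {p : R} (a : S) (hp : p ∈ polyLT ι t n) :
    ι a * p ∈ polyLT ι t n :=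
  h.mul_mem' (map_mem_polyLT one_pos a) hp (by omega)

theorem mul_map_mem (h : IsSkewCommuting σ ι t) {n : ℕ} {p : R} (a : S) (hp : p ∈ polyLT ι t n) :
    p * ι a ∈ polyLT ι t n :=
  h.mul_mem' hp (map_mem_polyLT one_pos a) (by omega)

theorem mem_polyLT_succ_right (h : IsSkewCommuting σ ι t) {n : ℕ} {p : R} :
    p ∈ polyLT ι t (n + 1) ↔ ∃ a, p - t ^ n * ι a ∈ polyLT ι t n := by
  rw [mem_polyLT_succ]
  constructor
  · rintro ⟨a, ha⟩
    exact ⟨_, by rwa [← h.mul_pow]⟩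
  · rintro ⟨a, ha⟩
    exact ⟨_, by rwa [← h.pow_mul]⟩

theorem monic_mul (h : IsSkewCommuting σ ι t) {n n' : ℕ} {m m' : R} (hm : IsMonicPoly ι t n m)
    (hm' : IsMonicPoly ι t n' m') : IsMonicPoly ι t (n + n') (m * m') := by
  have h1 := h.mul_mem' hm hm'.mem (d := n + n') (by omega)
  have h2 := h.mul_mem' (pow_mem_polyLT (ι := ι) (t := t) (Nat.lt_succ_self n)) hm'
    (d := n + n') (by omega)
  have := add_mem h1 h2
  rwa [sub_mul, mul_sub, ← pow_add, sub_add_sub_cancel] at this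

end IsSkewCommuting

namespace IsSkewVariable

/-- Left multiplication by a monic polynomial of degree `n` raises the degree by `n`. -/
theorem mem_of_monic_mul_mem (h : IsSkewVariable σ ι t) {n f : ℕ} {m : R}
    (hm : IsMonicPoly ι t n m) :
    ∀ {N : ℕ} {r : R}, r ∈ polyLT ι t N → m * r ∈ polyLT ι t (n + f) → r ∈ polyLT ι t f
  | 0, r, hr, _ => polyLT_mono (Nat.zero_le _) hr
  | N + 1, r, hr, hmr => by
    rcases le_or_gt (N + 1) f with hN | hN
    · exact polyLT_mono hN hr
    refine mem_of_monic_mul_mem h hm (N := N) ?_ hmr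
    obtain ⟨a, ha⟩ := mem_polyLT_succ.1 hr
    -- Up to degree below n + N the product `m * r` is σⁿ(a) tⁿ⁺ᴺ. Since n + f ≤ n + N this term
    -- itself has lower degree, so independence kills a.
    have e : ι ((σ ^ n) a) * t ^ (n + N)
        = m * r - (m - t ^ n) * r - t ^ n * (r - ι a * t ^ N) := by
      rw [pow_add, ← mul_assoc, ← h.pow_mul]
      noncomm_ring
    have h1 : ι ((σ ^ n) a) * t ^ (n + N) ∈ polyLT ι t (n + N) := by
      rw [e]
      refine sub_mem (sub_mem (polyLT_mono (by omega) hmr) ?_) ?_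
      · exact h.mul_mem' hm hr (by omega)
      · exact h.mul_mem' (pow_mem_polyLT (Nat.lt_succ_self n)) ha (by omega)
    have h2 := h.indep _ _ h1
    rw [EmbeddingLike.map_eq_zero_iff] at h2
    simpa [h2] using ha

theorem mem_of_mul_monic_mem (h : IsSkewVariable σ ι t) {n f : ℕ} {m : R}
    (hm : IsMonicPoly ι t n m) :
    ∀ {N : ℕ} {r : R}, r ∈ polyLT ι t N → r * m ∈ polyLT ι t (f + n) → r ∈ polyLT ι t f
  | 0, r, hr, _ => polyLT_mono (Nat.zero_le _) hr
  | N + 1, r, hr, hmr => by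
    rcases le_or_gt (N + 1) f with hN | hN
    · exact polyLT_mono hN hr
    refine mem_of_mul_monic_mem h hm (N := N) ?_ hmr
    obtain ⟨a, ha⟩ := mem_polyLT_succ.1 hr
    have e : ι a * t ^ (N + n) = r * m - r * (m - t ^ n) - (r - ι a * t ^ N) * t ^ n := by
      rw [pow_add]
      noncomm_ring
    have h1 : ι a * t ^ (N + n) ∈ polyLT ι t (N + n) := by
      rw [e]
      refine sub_mem (sub_mem (polyLT_mono (by omega) hmr) ?_) ?_
      · exact h.mul_mem' hr hm (by omega)
      · exact h.mul_mem' ha (pow_mem_polyLT (Nat.lt_succ_self n)) (by omega)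
    have h2 := h.indep _ _ h1
    simpa [h2] using ha

/-- Division with remainder by a monic polynomial. -/
theorem exists_div (h : IsSkewVariable σ ι t) {n : ℕ} {m : R} (hm : IsMonicPoly ι t n m) :
    ∀ {N : ℕ} {r : R}, r ∈ polyLT ι t N →
      ∃ p ∈ polyLT ι t N, r - m * p ∈ polyLT ι t n
  | 0, r, hr => ⟨0, zero_mem _, by simpa using polyLT_mono (Nat.zero_le _) hr⟩
  | N + 1, r, hr => by
    rcases le_or_gt (N + 1) n with hN | hN
    · exact ⟨0, zero_mem _, by simpa using polyLT_mono hN hr⟩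
    obtain ⟨a, ha⟩ := h.mem_polyLT_succ_right.1 hr
    have e : r - m * (t ^ (N - n) * ι a)
        = (r - t ^ N * ι a) - (m - t ^ n) * (t ^ (N - n) * ι a) := by
      have : t ^ N = t ^ n * t ^ (N - n) := by rw [← pow_add]; congr 1; omega
      rw [this]
      noncomm_ring
    have hq : t ^ (N - n) * ι a ∈ polyLT ι t (N - n + 1) :=
      h.mul_map_mem a (pow_mem_polyLT (Nat.lt_succ_self _))
    have h1 : r - m * (t ^ (N - n) * ι a) ∈ polyLT ι t N := by
      rw [e]
      exact sub_mem ha (h.mul_mem' hm hq (by omega))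
    obtain ⟨p, hp, hp'⟩ := exists_div h hm h1
    refine ⟨t ^ (N - n) * ι a + p, add_mem (polyLT_mono (by omega) hq)
      (polyLT_mono (by omega) hp), ?_⟩
    rwa [mul_add, ← sub_sub]

end IsSkewVariable

section Op

open MulOpposite

/-- The homomorphism of opposite algebras defined by `ι`. -/
abbrev opHom (ι : S →ₐ[k] R) : Sᵐᵒᵖ →ₐ[k] Rᵐᵒᵖ := AlgHom.op ι

/-- The automorphism of the opposite algebra defined by the inverse of `σ`. -/
abbrev opSymm (σ : S ≃ₐ[k] S) : Sᵐᵒᵖ ≃ₐ[k] Sᵐᵒᵖ := AlgEquiv.op σ.symm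

/-- In the opposite algebra coefficients stand on the other side of the powers of t. As σ is
bijective they can be moved across without changing degrees, so every one-sided argument about
polynomials is available on the other side. -/
theorem polyLT_op (h : IsSkewCommuting σ ι t) (n : ℕ) {r : R} :
    op r ∈ polyLT (opHom ι) (op t) n ↔ r ∈ polyLT ι t n := by
  constructor
  · intro hr
    suffices polyLT (opHom ι) (op t) n ≤
        (polyLT ι t n).comap (MulOpposite.opLinearEquiv k).symm.toLinearMap from this hr
    refine Submodule.span_le.2 ?_
    rintro _ ⟨i, hi, a, rfl⟩
    change t ^ i * ι a.unop ∈ polyLT ι t n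
    rw [h.pow_mul]
    exact mul_pow_mem_polyLT hi _
  · intro hr
    suffices polyLT ι t n ≤
        (polyLT (opHom ι) (op t) n).comap (MulOpposite.opLinearEquiv k).toLinearMap from this hr
    refine Submodule.span_le.2 ?_
    rintro _ ⟨i, hi, a, rfl⟩
    refine Submodule.subset_span ⟨i, hi, op ((σ ^ i).symm a), ?_⟩
    change op (ι a * t ^ i) = op (t ^ i * ι _)
    rw [h.pow_mul, unop_op, AlgEquiv.apply_symm_apply]

theorem isMonicPoly_op (h : IsSkewCommuting σ ι t) {n : ℕ} {m : R} :
    IsMonicPoly (opHom ι) (op t) n (op m) ↔ IsMonicPoly ι t n m := by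
  rw [IsMonicPoly, IsMonicPoly, ← polyLT_op h, MulOpposite.op_sub, MulOpposite.op_pow]

theorem IsSkewCommuting.op (h : IsSkewCommuting σ ι t) :
    IsSkewCommuting (opSymm σ) (opHom ι) (op t) where
  comm a := by
    change MulOpposite.op (ι a.unop * t) = MulOpposite.op (t * ι (σ.symm a.unop))
    rw [h.comm, AlgEquiv.apply_symm_apply]

theorem IsSkewVariable.op (h : IsSkewVariable σ ι t) :
    IsSkewVariable (opSymm σ) (opHom ι) (MulOpposite.op t) where
  toIsSkewCommuting := h.toIsSkewCommuting.op
  indep n a ha := by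
    have e : (opHom ι) a * MulOpposite.op t ^ n = MulOpposite.op (t ^ n * ι a.unop) := rfl
    rw [e, polyLT_op h.toIsSkewCommuting, h.pow_mul] at ha
    have := h.indep _ _ ha
    rw [EmbeddingLike.map_eq_zero_iff] at this
    exact unop_injective this

end Op

end SkewVariable

end HomTr

namespace HomTr

/-! ### The Goldie quotient ring of a skew polynomial ring -/

section

variable {k : Type v} [Field k] {S R : Type u} [Ring S] [Algebra k S] [Ring R] [Algebra k R]

/-- `Q` is a ring of fractions, with monic denominators on either side, of the polynomials in a
skew variable. -/
structure IsSkewFractionRing (σ : S ≃ₐ[k] S) (ι : S →ₐ[k] R) (t : R) : Prop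
    extends IsSkewVariable σ ι t where
  isUnit_of_monic : ∀ {n m}, IsMonicPoly ι t n m → IsUnit m
  left_den : ∀ q, ∃ n m d, IsMonicPoly ι t n m ∧ m * q ∈ polyLT ι t d
  right_den : ∀ q, ∃ n m d, IsMonicPoly ι t n m ∧ q * m ∈ polyLT ι t d

variable {σ : S ≃ₐ[k] S} {ι : S →ₐ[k] R} {t : R}

theorem IsSkewFractionRing.op (h : IsSkewFractionRing σ ι t) :
    IsSkewFractionRing (opSymm σ) (opHom ι) (MulOpposite.op t) where
  toIsSkewVariable := h.toIsSkewVariable.op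
  isUnit_of_monic {n m} hm := by
    obtain ⟨m, rfl⟩ := MulOpposite.op_surjective m
    exact (h.isUnit_of_monic ((isMonicPoly_op h.toIsSkewCommuting).1 hm)).op
  left_den q := by
    obtain ⟨q, rfl⟩ := MulOpposite.op_surjective q
    obtain ⟨n, m, d, hm, hd⟩ := h.right_den q
    exact ⟨n, MulOpposite.op m, d, (isMonicPoly_op h.toIsSkewCommuting).2 hm, by
      rw [← MulOpposite.op_mul, polyLT_op h.toIsSkewCommuting]; exact hd⟩
  right_den q := by
    obtain ⟨q, rfl⟩ := MulOpposite.op_surjective q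
    obtain ⟨n, m, d, hm, hd⟩ := h.left_den q
    exact ⟨n, MulOpposite.op m, d, (isMonicPoly_op h.toIsSkewCommuting).2 hm, by
      rw [← MulOpposite.op_mul, polyLT_op h.toIsSkewCommuting]; exact hd⟩

/-- If the `S`-module generated by the powers of `t` modulo `J` has bounded length, then some power
of `t` is congruent modulo `J` to a combination of lower ones. -/
theorem exists_monic_mul [Nontrivial S] [IsSemisimpleRing S] (h : IsSkewVariable σ ι t)
    (hall : ∀ r, ∃ n, r ∈ polyLT ι t n) {f : R} (hf : IsRightRegular f) :
    ∃ g n, IsMonicPoly ι t n (g * f) := by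
  let _ : Module S R := Module.compHom R (ι : S →+* R)
  have smul_def (a : S) (r : R) : a • r = ι a * r := rfl
  have : IsScalarTower S R R := ⟨fun a r s ↦ by simp only [smul_def, smul_eq_mul, mul_assoc]⟩
  let PL (n : ℕ) : Submodule S R :=
    { (polyLT ι t n).toAddSubmonoid with smul_mem' := fun a r hr ↦ h.map_mul_mem a hr }
  have mem_PL (n : ℕ) (r : R) : r ∈ PL n ↔ r ∈ polyLT ι t n := Iff.rfl
  let J : Submodule S R := LinearMap.range (LinearMap.toSpanSingleton R R f) |>.restrictScalars S
  have mem_J (r : R) : r ∈ J ↔ ∃ g, g * f = r := Iff.rfl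
  let N (n : ℕ) : Submodule S (R ⧸ J) := (PL n).map J.mkQ
  by_contra! hcon
  -- the coordinates of polynomials
  let Φ (n : ℕ) : (Fin n → S) →ₗ[S] R :=
    { toFun := fun a ↦ ∑ i, ι (a i) * t ^ (i : ℕ)
      map_add' := fun a b ↦ by simp [add_mul, Finset.sum_add_distrib]
      map_smul' := fun c a ↦ by simp [smul_def, Finset.mul_sum, mul_assoc] }
  have hΦmem (n : ℕ) (a : Fin n → S) : Φ n a ∈ PL n :=
    show (∑ i : Fin n, ι (a i) * t ^ (i : ℕ)) ∈ PL n from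
      (PL n).sum_mem fun i _ ↦ mul_pow_mem_polyLT i.2 _
  have hΦsucc (n : ℕ) (a : Fin (n + 1) → S) :
      Φ (n + 1) a = Φ n (fun i ↦ a i.castSucc) + ι (a (Fin.last n)) * t ^ n := by
    change ∑ i : Fin (n + 1), _ = ∑ i : Fin n, _ + _
    rw [Fin.sum_univ_castSucc]
    simp
  have hΦinj (n : ℕ) : Function.Injective (Φ n) := by
    rw [← LinearMap.ker_eq_bot, LinearMap.ker_eq_bot']
    induction n with
    | zero => intro a _; exact Subsingleton.elim _ _
    | succ n ih =>
      intro a ha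
      rw [hΦsucc] at ha
      have h1 : a (Fin.last n) = 0 := h.indep n _ (by
        rw [← neg_eq_of_add_eq_zero_right ha]
        exact neg_mem (hΦmem n _))
      rw [h1, map_zero, zero_mul, add_zero] at ha
      have h2 := ih _ ha
      funext i
      refine Fin.lastCases h1 (fun i ↦ congrFun h2 i) i
  have hΦrange (n : ℕ) : LinearMap.range (Φ n) = PL n := by
    refine le_antisymm (by rintro _ ⟨a, rfl⟩; exact hΦmem n a) ?_
    induction n with
    | zero =>
      intro r hr
      rw [mem_PL, polyLT_zero, Submodule.mem_bot] at hr
      exact ⟨0, by rw [map_zero, hr]⟩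
    | succ n ih =>
      intro r hr
      obtain ⟨a, ha⟩ := mem_polyLT_succ.1 hr
      obtain ⟨b, hb⟩ := ih ha
      refine ⟨Fin.snoc b a, ?_⟩
      rw [hΦsucc]
      simp [hb]
  have hlen (n : ℕ) : Module.length S (PL n) = n * Module.length S S := by
    rw [← hΦrange, ← (LinearEquiv.ofInjective (Φ n) (hΦinj n)).length_eq, Module.length_pi]
    simp
  have hfin : Module.length S S ≠ ⊤ := Module.length_ne_top
  have hlt (n : ℕ) : N n < N (n + 1) := by
    refine lt_of_le_of_ne (Submodule.map_mono (polyLT_mono n.le_succ)) fun he ↦ ?_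
    have h1 : J.mkQ (t ^ n) ∈ N n := he ▸ Submodule.mem_map_of_mem (pow_mem_polyLT n.lt_succ_self)
    obtain ⟨p, hp, hpt⟩ := h1
    obtain ⟨g, hg⟩ := (mem_J _).1 ((Submodule.Quotient.eq J).1 hpt)
    -- Here g f = p − tⁿ with p of degree below n, so −g f is monic.
    refine hcon (-g) n ?_
    rw [IsMonicPoly, neg_mul, hg, neg_sub, sub_sub_cancel_left]
    exact neg_mem hp
  have hNlen (n : ℕ) : n ≤ Module.length S (N n) := by
    rw [Module.length_submodule]
    induction n with
    | zero => simp
    | succ n ih =>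
      push_cast
      exact (add_le_add_left ih 1).trans (Order.height_add_one_le (hlt n))
  obtain ⟨e, he⟩ := hall f
  let ρ (n : ℕ) : PL n →ₗ[S] PL (n + e) :=
    (LinearMap.toSpanSingleton R R f).restrictScalars S |>.restrict
      (fun r hr ↦ h.mul_mem' hr he (by omega))
  let g (n : ℕ) : PL n →ₗ[S] R ⧸ J := J.mkQ.comp (PL n).subtype
  have hg (n : ℕ) : LinearMap.range (g n) = N n := by
    rw [LinearMap.range_comp, Submodule.range_subtype]
  have hker (n : ℕ) (x : PL n) : ρ n x ∈ LinearMap.ker (g (n + e)) :=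
    (Submodule.Quotient.mk_eq_zero J).2 ⟨x, rfl⟩
  -- Right multiplication by f embeds the polynomials of degree below n in the kernel of those of
  -- degree below n + e modulo J, whose image there has length at least n + e.
  have hle (n : ℕ) : n * Module.length S S + (n + e : ℕ) ≤ (n + e : ℕ) * Module.length S S := by
    have hex : Function.Exact (LinearMap.ker (g (n + e))).subtype (g (n + e)).rangeRestrict := by
      rw [LinearMap.exact_iff, LinearMap.ker_rangeRestrict, Submodule.range_subtype]
    rw [← hlen, ← hlen, Module.length_eq_add_of_exact _ _ (Submodule.injective_subtype _)
      (LinearMap.surjective_rangeRestrict _) hex]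
    refine add_le_add (Module.length_le_of_injective ((ρ n).codRestrict _ (hker n)) ?_) ?_
    · intro x y hxy
      have h1 : (x : R) * f = (y : R) * f :=
        congrArg (fun z : LinearMap.ker (g (n + e)) ↦ ((z : PL (n + e)) : R)) hxy
      exact Subtype.ext (hf h1)
    · rw [hg]
      exact hNlen _
  obtain ⟨l, hl⟩ := ENat.ne_top_iff_exists.1 hfin
  -- With l the length of S the inequality says n + e ≤ e l, which fails for n = e l + 1.
  have := hle (e * l + 1)
  rw [← hl] at this
  norm_cast at this
  nlinarith

end

/-! ### The skew polynomial ring itself, and monic denominators in its Goldie quotient ring. -/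

section

variable {k : Type v} [Field k] {S : Type u} [Ring S] [Algebra k S]

namespace SkewPolynomialRing

variable (α : S ≃ₐ[k] S)

/-- The inclusion of the constants as a homomorphism of algebras. -/
noncomputable def CAlgHom : S →ₐ[k] SkewPolynomialRing α where
  __ := C α
  commutes' _ := rfl

theorem exists_coeff : ∃ c : ℕ → SkewPolynomialRing α →+ S,
    ∀ n m a, c n (CAlgHom α a * t α ^ m) = if m = n then a else 0 := by
  let _ := powerAction α
  refine ⟨fun n ↦ { toFun := fun p ↦ SkewPolynomial.coeff p n
                    map_zero' := rfl
                    map_add' := fun p q ↦ SkewPolynomial.coeff_add p q n }, fun n m a ↦ ?_⟩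
  have key : SkewPolynomial.coeff (SkewPolynomial.C a * SkewPolynomial.X ^ m) n
      = if m = n then a else 0 := by
    rw [SkewPolynomial.C_mul_X_pow_eq_monomial, SkewPolynomial.coeff_monomial]
  exact key

theorem exists_mem_polyLT (p : SkewPolynomialRing α) : ∃ n, p ∈ polyLT (CAlgHom α) (t α) n := by
  let _ := powerAction α
  have key (n : ℕ) (a : S) : (SkewPolynomial.monomial n a : SkewPolynomialRing α)
      = CAlgHom α a * t α ^ n :=
    (SkewPolynomial.C_mul_X_pow_eq_monomial (a := a) (n := n)).symm
  induction p using SkewPolynomial.induction with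
  | h0 => exact ⟨0, zero_mem _⟩
  | ha n r q _ _ ih =>
    obtain ⟨N, hN⟩ := ih
    refine ⟨max (n + 1) N, Submodule.add_mem _ ?_ (polyLT_mono (le_max_right _ _) hN)⟩
    rw [key]
    exact mul_pow_mem_polyLT (by omega) r

theorem isSkewVariable : IsSkewVariable α (CAlgHom α) (t α) where
  comm := t_mul_C α
  indep n a ha := by
    obtain ⟨c, hc⟩ := exists_coeff α
    have h : ∀ p ∈ polyLT (CAlgHom α) (t α) n, ∀ b, c n (CAlgHom α b * p) = 0 := by
      intro p hp
      induction hp using Submodule.span_induction with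
      | mem x hx =>
        obtain ⟨i, hi, a, rfl⟩ := hx
        intro b
        rw [← mul_assoc, ← map_mul, hc, if_neg hi.ne]
      | zero => simp
      | add x y _ _ hx hy => intro b; rw [mul_add, map_add, hx, hy, add_zero]
      | smul r x hx h =>
        intro b
        rw [Algebra.smul_def, ← (CAlgHom α).commutes, ← mul_assoc, ← map_mul]
        exact h _
    have := h _ ha 1
    rwa [map_one, one_mul, hc, if_pos rfl] at this

end SkewPolynomialRing

theorem map_polyLT {R Q : Type u} [Ring R] [Algebra k R] [Ring Q] [Algebra k Q] (ι : S →ₐ[k] R)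
    (t : R) (j : R →ₐ[k] Q) (n : ℕ) :
    (polyLT ι t n).map j.toLinearMap = polyLT (j.comp ι) (j t) n := by
  rw [polyLT, polyLT, Submodule.map_span]
  congr 1
  ext q
  constructor
  · rintro ⟨_, ⟨i, hi, a, rfl⟩, rfl⟩
    exact ⟨i, hi, a, by simp⟩
  · rintro ⟨i, hi, a, rfl⟩
    exact ⟨_, ⟨i, hi, a, rfl⟩, by simp⟩

/-- Multiplying numerator and denominator by the factor from `exists_monic_mul` makes the
denominator monic. Monic polynomials are regular, since multiplication by one raises degrees, and so
become units. Right fractions are treated in the opposite algebra. -/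
theorem IsGoldieQuotientRing.isSkewFractionRing [Nontrivial S] [IsSemisimpleRing S]
    {α : S ≃ₐ[k] S} {Q : Type u} [Ring Q] [Algebra k Q] (j : SkewPolynomialRing α →ₐ[k] Q)
    (hj : IsGoldieQuotientRing (j : SkewPolynomialRing α →+* Q)) :
    IsSkewFractionRing α (j.comp (SkewPolynomialRing.CAlgHom α)) (j (SkewPolynomialRing.t α)) := by
  have h := SkewPolynomialRing.isSkewVariable α
  have hall := SkewPolynomialRing.exists_mem_polyLT α
  set ι := SkewPolynomialRing.CAlgHom α
  set t := SkewPolynomialRing.t α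
  have hinj : Function.Injective j := hj.injective
  have hmap (n : ℕ) (r : SkewPolynomialRing α) :
      j r ∈ polyLT (j.comp ι) (j t) n ↔ r ∈ polyLT ι t n := by
    rw [← map_polyLT]
    exact Function.Injective.mem_set_image hinj
  have hmonic (n : ℕ) (r : SkewPolynomialRing α) :
      IsMonicPoly (j.comp ι) (j t) n (j r) ↔ IsMonicPoly ι t n r := by
    rw [IsMonicPoly, ← map_pow, ← map_sub, hmap, IsMonicPoly]
  have hpoly (q : Q) (n : ℕ) (hq : q ∈ polyLT (j.comp ι) (j t) n) :
      ∃ r ∈ polyLT ι t n, j r = q := by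
    rwa [← map_polyLT] at hq
  have hcancel {n : ℕ} {m r : SkewPolynomialRing α} (hm : IsMonicPoly ι t n m) :
      (m * r = 0 → r = 0) ∧ (r * m = 0 → r = 0) := by
    obtain ⟨N, hN⟩ := hall r
    constructor
    · intro h0
      have := h.mem_of_monic_mul_mem hm (f := 0) hN (h0 ▸ zero_mem _)
      rwa [polyLT_zero, Submodule.mem_bot] at this
    · intro h0
      have := h.mem_of_mul_monic_mem hm (f := 0) hN (h0 ▸ zero_mem _)
      rwa [polyLT_zero, Submodule.mem_bot] at this
  refine ⟨⟨⟨fun a ↦ ?_⟩, fun n a ha ↦ ?_⟩, fun {n m} hm ↦ ?_, fun q ↦ ?_, fun q ↦ ?_⟩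
  · change j t * j (ι a) = j (ι (α a)) * j t
    rw [← map_mul, h.comm, map_mul]
  · refine h.indep n a ((hmap n _).1 ?_)
    simpa using ha
  · obtain ⟨r, -, rfl⟩ := hpoly m (n + 1) hm.mem
    have hm' := (hmonic n r).1 hm
    refine hj.isUnit_map r ⟨fun x y hxy ↦ ?_, fun x y hxy ↦ ?_⟩
    · exact sub_eq_zero.1 ((hcancel hm').1 (by simpa [mul_sub, sub_eq_zero] using hxy))
    · exact sub_eq_zero.1 ((hcancel hm').2 (by simpa [sub_mul, sub_eq_zero] using hxy))
  · obtain ⟨r, s, hs, hq⟩ := hj.left_fraction q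
    obtain ⟨g, n, hg⟩ := exists_monic_mul h hall hs.right
    obtain ⟨d, hd⟩ := hall (g * r)
    refine ⟨n, j (g * s), d, (hmonic _ _).2 hg, ?_⟩
    rw [map_mul, mul_assoc]
    change j g * ((j : SkewPolynomialRing α →+* Q) s * q) ∈ _
    rw [hq]
    change j g * j r ∈ _
    rw [← map_mul, hmap]
    exact hd
  · obtain ⟨r, s, hs, hq⟩ := hj.right_fraction q
    have hall' : ∀ r, ∃ n, r ∈ polyLT (opHom ι) (MulOpposite.op t) n := fun r ↦ by
      obtain ⟨r, rfl⟩ := MulOpposite.op_surjective r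
      obtain ⟨n, hn⟩ := hall r
      exact ⟨n, (polyLT_op h.toIsSkewCommuting n).2 hn⟩
    obtain ⟨g, n, hg⟩ := exists_monic_mul h.op hall' (f := MulOpposite.op s)
      (isRightRegular_op.2 hs.left)
    obtain ⟨g, rfl⟩ := MulOpposite.op_surjective g
    rw [← MulOpposite.op_mul, isMonicPoly_op h.toIsSkewCommuting] at hg
    obtain ⟨d, hd⟩ := hall (r * g)
    refine ⟨n, j (s * g), d, (hmonic _ _).2 hg, ?_⟩
    rw [map_mul, ← mul_assoc]
    change q * (j : SkewPolynomialRing α →+* Q) s * j g ∈ _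
    rw [hq]
    change j r * j g ∈ _
    rw [← map_mul, hmap]
    exact hd

end

end HomTr

namespace HomTr

/-! ### The constant coefficient of a skew fraction -/

section

variable {k : Type v} [Field k] {S Q : Type u} [Ring S] [Algebra k S] [Ring Q] [Algebra k Q]
variable {σ : S ≃ₐ[k] S} {ι : S →ₐ[k] Q} {t : Q}

/-- The fractions of negative degree. -/
def IsNegative (ι : S →ₐ[k] Q) (t q : Q) : Prop :=
  ∃ n m, IsMonicPoly ι t n m ∧ m * q ∈ polyLT ι t n

theorem IsSkewCommuting.conj_mem (h : IsSkewCommuting σ ι t) {t' : Q} (ht : t * t' = 1) {n : ℕ}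
    {p : Q} (hp : p ∈ polyLT ι t n) : t * p * t' ∈ polyLT ι t n := by
  suffices polyLT ι t n ≤ (polyLT ι t n).comap
      (LinearMap.mulRight k t' ∘ₗ LinearMap.mulLeft k t) from this hp
  refine Submodule.span_le.2 ?_
  rintro _ ⟨i, hi, a, rfl⟩
  have : t * (ι a * t ^ i) * t' = ι (σ a) * t ^ i := by
    rw [← mul_assoc, h.comm, mul_assoc, mul_assoc, ← mul_assoc t, ← pow_succ', pow_succ,
      mul_assoc, ht, mul_one]
  change t * (ι a * t ^ i) * t' ∈ polyLT ι t n
  rw [this]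
  exact mul_pow_mem_polyLT hi _

theorem IsSkewCommuting.exists_constant (h : IsSkewCommuting σ ι t) :
    ∀ {n : ℕ} {p : Q}, p ∈ polyLT ι t n → ∃ a, ∃ r ∈ polyLT ι t n, p = ι a + t * r
  | 0, p, hp => ⟨0, 0, zero_mem _, by simpa [polyLT_zero] using hp⟩
  | n + 1, p, hp => by
    obtain ⟨b, hb⟩ := h.mem_polyLT_succ_right.1 hp
    obtain ⟨a, r, hr, e⟩ := exists_constant h hb
    rw [sub_eq_iff_eq_add] at e
    cases n with
    | zero =>
      refine ⟨a + b, r, polyLT_mono (Nat.le_succ _) hr, ?_⟩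
      rw [e, pow_zero, one_mul, map_add]
      abel
    | succ n =>
      refine ⟨a, r + t ^ n * ι b, add_mem (polyLT_mono (Nat.le_succ _) hr)
        (h.mul_map_mem _ (pow_mem_polyLT (by omega))), ?_⟩
      rw [e, mul_add, pow_succ', mul_assoc]
      abel

namespace IsSkewFractionRing

theorem isUnit_t (h : IsSkewFractionRing σ ι t) : IsUnit t :=
  h.isUnit_of_monic (n := 1) (by simpa using isMonicPoly_pow (ι := ι) (t := t) 1)

/-- Left Ore condition for the monic polynomials. -/
theorem ore (h : IsSkewFractionRing σ ι t) (s : Q) {n : ℕ} {m : Q} (hm : IsMonicPoly ι t n m) :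
    ∃ n' m' d s', IsMonicPoly ι t n' m' ∧ s' ∈ polyLT ι t d ∧ m' * s = s' * m := by
  obtain ⟨u, rfl⟩ := h.isUnit_of_monic hm
  obtain ⟨n', m', d, hm', hd⟩ := h.left_den (s * ↑u⁻¹)
  exact ⟨n', m', d, _, hm', hd, by simp [mul_assoc]⟩

/-- Cancelling the monic `m` bounds the degree of `s` by N − n, against the degree of `y`, which is
below n. If N < n this forces s = 0; the truncated subtraction covers that case. -/
theorem mul_mem_of_mul_monic_mem (h : IsSkewFractionRing σ ι t) {n N d : ℕ} {m s y : Q}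
    (hm : IsMonicPoly ι t n m) (hs : s ∈ polyLT ι t d) (hsm : s * m ∈ polyLT ι t (N + 1))
    (hy : y ∈ polyLT ι t n) : s * y ∈ polyLT ι t N := by
  have := h.mem_of_mul_monic_mem hm (f := N + 1 - n) hs (polyLT_mono (by omega) hsm)
  rcases Nat.eq_zero_or_pos (N + 1 - n) with h0 | h0
  · rw [h0, polyLT_zero, Submodule.mem_bot] at this
    rw [this, zero_mul]
    exact zero_mem _
  · exact h.mul_mem' this hy (by omega)

/-- Two monic denominators have a common left multiple, so whether the numerator has smaller degree
than the denominator does not depend on the fraction chosen. -/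
theorem isNegative_iff (h : IsSkewFractionRing σ ι t) {q : Q} : IsNegative ι t q ↔
    ∀ n m d, IsMonicPoly ι t n m → m * q ∈ polyLT ι t d → m * q ∈ polyLT ι t n := by
  constructor
  · rintro ⟨n₀, m₀, hm₀, hq⟩ n m d hm hd
    obtain ⟨e, v, f, v', hv, hv', hvv⟩ := h.ore m hm₀
    refine h.mem_of_monic_mul_mem hv hd ?_
    have e1 : v * (m * q) = v' * (m₀ * q) := by rw [← mul_assoc, hvv, mul_assoc]
    rw [e1]
    refine h.mul_mem_of_mul_monic_mem hm₀ hv' ?_ hq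
    rw [← hvv]
    exact (h.monic_mul hv hm).mem
  · intro hq
    obtain ⟨n, m, d, hm, hd⟩ := h.left_den q
    exact ⟨n, m, hm, hq n m d hm hd⟩

theorem common_den (h : IsSkewFractionRing σ ι t) (q₁ q₂ : Q) :
    ∃ n m d, IsMonicPoly ι t n m ∧ m * q₁ ∈ polyLT ι t d ∧ m * q₂ ∈ polyLT ι t d := by
  obtain ⟨n, m, d, hm, hd⟩ := h.left_den q₁
  obtain ⟨n', m', d', hm', hd'⟩ := h.left_den (m * q₂)
  refine ⟨n' + n, m' * m, n' + d + d', h.monic_mul hm' hm, ?_, ?_⟩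
  · rw [mul_assoc]
    exact h.mul_mem' hm'.mem hd (by omega)
  · rw [mul_assoc]
    exact polyLT_mono (by omega) hd'

theorem isNegative_zero : IsNegative ι t 0 := ⟨0, 1, isMonicPoly_one, by simp⟩

theorem isNegative_add (h : IsSkewFractionRing σ ι t) {q₁ q₂ : Q} (h₁ : IsNegative ι t q₁)
    (h₂ : IsNegative ι t q₂) : IsNegative ι t (q₁ + q₂) := by
  obtain ⟨n, m, d, hm, hd₁, hd₂⟩ := h.common_den q₁ q₂
  refine ⟨n, m, hm, ?_⟩
  rw [mul_add]
  exact add_mem (h.isNegative_iff.1 h₁ n m d hm hd₁) (h.isNegative_iff.1 h₂ n m d hm hd₂)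

theorem isNegative_map_mul (h : IsSkewFractionRing σ ι t) {q : Q} (a : S)
    (hq : IsNegative ι t q) : IsNegative ι t (ι a * q) := by
  obtain ⟨n, m, hm, hq⟩ := hq
  obtain ⟨n', m', d, s, hm', hs, e⟩ := h.ore (ι a) hm
  refine ⟨n', m', hm', ?_⟩
  have e1 : m' * (ι a * q) = s * (m * q) := by rw [← mul_assoc, e, mul_assoc]
  rw [e1]
  refine h.mul_mem_of_mul_monic_mem hm hs ?_ hq
  rw [← e]
  exact h.mul_map_mem a hm'.mem

theorem isNegative_mul_map (h : IsSkewFractionRing σ ι t) {q : Q} (a : S)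
    (hq : IsNegative ι t q) : IsNegative ι t (q * ι a) := by
  obtain ⟨n, m, hm, hq⟩ := hq
  refine ⟨n, m, hm, ?_⟩
  rw [← mul_assoc]
  exact h.mul_map_mem a hq

theorem isNegative_conj (h : IsSkewFractionRing σ ι t) {t' : Q} (ht : t * t' = 1)
    (ht' : t' * t = 1) {q : Q} (hq : IsNegative ι t q) : IsNegative ι t (t * q * t') := by
  obtain ⟨n, m, hm, hq⟩ := hq
  refine ⟨n, t * m * t', ?_, ?_⟩
  · have e : t * m * t' - t ^ n = t * (m - t ^ n) * t' := by
      rw [mul_sub, sub_mul, ← pow_succ', pow_succ, mul_assoc (t ^ n), ht, mul_one]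
    rw [IsMonicPoly, e]
    exact h.conj_mem ht hm
  · have e : t * m * t' * (t * q * t') = t * (m * q) * t' := by
      calc _ = t * m * (t' * t) * q * t' := by noncomm_ring
        _ = _ := by rw [ht']; noncomm_ring
    rw [e]
    exact h.conj_mem ht hq

theorem eq_zero_of_isNegative (h : IsSkewFractionRing σ ι t) {d : ℕ} {p : Q}
    (hp : p ∈ polyLT ι t d) (hn : IsNegative ι t p) : p = 0 := by
  obtain ⟨n, m, hm, hq⟩ := hn
  have := h.mem_of_monic_mul_mem hm (f := 0) hp hq
  rwa [polyLT_zero, Submodule.mem_bot] at this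

/-- A polynomial that is also a fraction of negative degree vanishes, and t is monic, so its
cancellation separates the constant from the multiple of t. -/
theorem constant_unique (h : IsSkewFractionRing σ ι t) {d : ℕ} {r : Q} {a : S}
    (hr : r ∈ polyLT ι t d) (hn : IsNegative ι t (ι a + t * r)) : a = 0 := by
  have ht : IsMonicPoly ι t 1 t := by simpa using isMonicPoly_pow (ι := ι) (t := t) 1
  have h0 : ι a + t * r = 0 := by
    refine h.eq_zero_of_isNegative (d := d + 1) (add_mem (map_mem_polyLT (by omega) a) ?_) hn
    exact h.mul_mem' ht.mem hr (by omega)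
  have h1 : r ∈ polyLT ι t 0 := by
    refine h.mem_of_monic_mul_mem ht hr ?_
    rw [← neg_eq_of_add_eq_zero_right h0]
    exact neg_mem (map_mem_polyLT (by omega) a)
  rw [polyLT_zero, Submodule.mem_bot] at h1
  refine h.indep 0 a ?_
  rw [pow_zero, mul_one]
  simp only [h1, mul_zero, add_zero] at h0
  rw [h0]
  exact zero_mem _

/-- `a` is the constant coefficient of `q`. -/
theorem exists_constant_coeff (h : IsSkewFractionRing σ ι t) (q : Q) :
    ∃ a, ∃ d, ∃ r ∈ polyLT ι t d, IsNegative ι t (q - ι a - t * r) := by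
  obtain ⟨n, m, d, hm, hd⟩ := h.left_den q
  -- q is the polynomial p plus m⁻¹ times a remainder of degree below that of m, and the latter
  -- fraction is negative.
  obtain ⟨p, hp, hr⟩ := h.exists_div hm hd
  obtain ⟨a, r, hr', rfl⟩ := h.exists_constant hp
  refine ⟨a, d, r, hr', n, m, hm, ?_⟩
  rwa [sub_sub, mul_sub]

/-- The constant coefficient of a skew fraction, for the expansion in powers of `t⁻¹`. -/
noncomputable def coeffZero (h : IsSkewFractionRing σ ι t) (q : Q) : S :=
  (h.exists_constant_coeff q).choose

theorem coeffZero_eq (h : IsSkewFractionRing σ ι t) {q : Q} {a : S} {d : ℕ} {r : Q}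
    (hr : r ∈ polyLT ι t d) (hn : IsNegative ι t (q - ι a - t * r)) : h.coeffZero q = a := by
  obtain ⟨d', r', hr', hn'⟩ := (h.exists_constant_coeff q).choose_spec
  change IsNegative ι t (q - ι (h.coeffZero q) - t * r') at hn'
  have h2 := h.isNegative_map_mul (-1) hn'
  rw [map_neg, map_one, neg_one_mul] at h2
  have h1 := h.isNegative_add hn h2
  have e : q - ι a - t * r + -(q - ι (h.coeffZero q) - t * r')
      = ι (h.coeffZero q - a) + t * (r' - r) := by
    rw [map_sub]
    noncomm_ring
  rw [e] at h1
  exact sub_eq_zero.1 (h.constant_unique (d := max d d')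
    (sub_mem (polyLT_mono (le_max_right _ _) hr') (polyLT_mono (le_max_left _ _) hr)) h1)

theorem coeffZero_spec (h : IsSkewFractionRing σ ι t) (q : Q) :
    ∃ d, ∃ r ∈ polyLT ι t d, IsNegative ι t (q - ι (h.coeffZero q) - t * r) :=
  (h.exists_constant_coeff q).choose_spec

theorem coeffZero_add (h : IsSkewFractionRing σ ι t) (p q : Q) :
    h.coeffZero (p + q) = h.coeffZero p + h.coeffZero q := by
  obtain ⟨d, r, hr, hn⟩ := h.coeffZero_spec p
  obtain ⟨d', r', hr', hn'⟩ := h.coeffZero_spec q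
  refine h.coeffZero_eq (d := max d d') (r := r + r')
    (add_mem (polyLT_mono (le_max_left _ _) hr) (polyLT_mono (le_max_right _ _) hr')) ?_
  convert h.isNegative_add hn hn' using 1
  rw [map_add]
  noncomm_ring

theorem coeffZero_map_mul (h : IsSkewFractionRing σ ι t) (a : S) (q : Q) :
    h.coeffZero (ι a * q) = a * h.coeffZero q := by
  obtain ⟨d, r, hr, hn⟩ := h.coeffZero_spec q
  refine h.coeffZero_eq (d := d) (r := ι (σ.symm a) * r) (h.map_mul_mem _ hr) ?_
  convert h.isNegative_map_mul a hn using 1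
  rw [← mul_assoc t, h.comm, AlgEquiv.apply_symm_apply, map_mul]
  noncomm_ring

theorem coeffZero_mul_map (h : IsSkewFractionRing σ ι t) (q : Q) (a : S) :
    h.coeffZero (q * ι a) = h.coeffZero q * a := by
  obtain ⟨d, r, hr, hn⟩ := h.coeffZero_spec q
  refine h.coeffZero_eq (d := d) (r := r * ι a) (h.mul_map_mem _ hr) ?_
  convert h.isNegative_mul_map a hn using 1
  rw [map_mul]
  noncomm_ring

theorem coeffZero_map (h : IsSkewFractionRing σ ι t) (a : S) : h.coeffZero (ι a) = a :=
  h.coeffZero_eq (d := 0) (r := 0) (zero_mem _) (by simpa using isNegative_zero)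

theorem coeffZero_one (h : IsSkewFractionRing σ ι t) : h.coeffZero 1 = 1 := by
  simpa using h.coeffZero_map 1

theorem coeffZero_conj (h : IsSkewFractionRing σ ι t) {t' : Q} (ht : t * t' = 1)
    (ht' : t' * t = 1) (q : Q) : h.coeffZero (t * q * t') = σ (h.coeffZero q) := by
  obtain ⟨d, r, hr, hn⟩ := h.coeffZero_spec q
  refine h.coeffZero_eq (d := d) (r := t * r * t') (h.conj_mem ht hr) ?_
  convert h.isNegative_conj ht ht' hn using 1
  rw [mul_sub, mul_sub, sub_mul, sub_mul, h.comm, mul_assoc (ι _), ht, mul_one]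
  noncomm_ring

theorem coeffZero_pow (h : IsSkewFractionRing σ ι t) {i : ℕ} (hi : 0 < i) :
    h.coeffZero (t ^ i) = 0 := by
  refine h.coeffZero_eq (d := i) (r := t ^ (i - 1)) (pow_mem_polyLT (by omega)) ?_
  rw [← pow_succ', Nat.sub_add_cancel hi]
  simpa using isNegative_zero

/-- An element of Q has a finite degree, and multiplication by a high power of t⁻¹ makes it
negative. -/
theorem coeffZero_eventually (h : IsSkewFractionRing σ ι t) {t' : Q} (ht : t * t' = 1) (q : Q) :
    ∃ N, ∀ i ≥ N, h.coeffZero (t' ^ i * q) = 0 := by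
  obtain ⟨n, m, d, hm, hd⟩ := h.left_den q
  refine ⟨d, fun i hi ↦ h.coeffZero_eq (d := 0) (r := 0) (zero_mem _) ?_⟩
  refine ⟨n + i, m * t ^ i, h.monic_mul hm (isMonicPoly_pow i), ?_⟩
  have e : t ^ i * t' ^ i = 1 := pow_mul_pow_eq_one i ht
  have e1 : m * t ^ i * (t' ^ i * q - ι 0 - t * 0) = m * q := by
    rw [map_zero, mul_zero, sub_zero, sub_zero, mul_assoc, ← mul_assoc (t ^ i), e, one_mul]
  rw [e1]
  exact polyLT_mono (by omega) hd

/-- The constant coefficient as a linear map. -/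
noncomputable def coeffZeroₗ (h : IsSkewFractionRing σ ι t) : Q →ₗ[k] S where
  toFun := h.coeffZero
  map_add' := h.coeffZero_add
  map_smul' c q := by
    rw [Algebra.smul_def, ← ι.commutes, h.coeffZero_map_mul, RingHom.id_apply, Algebra.smul_def]

end IsSkewFractionRing

end

end HomTr

namespace HomTr

/-! ### Extending twisted derivations to skew fractions -/

section

variable {k : Type v} [Field k] {S Q : Type u} [Ring S] [Algebra k S] [Ring Q] [Algebra k Q]
variable {σ : S ≃ₐ[k] S} {ι : S →ₐ[k] Q} {t : Q}

namespace IsSkewFractionRing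

section Lift

variable {T : Type u} [Ring T] [Algebra k T] {κ : S →ₐ[k] T} {τ : T}

/-- Powers of t being independent, a polynomial in (t, τ) is determined by its first component. Thus
identities between polynomials in Q, Ore relations in particular, transfer to the operators obtained
by substituting τ. -/
theorem eq_zero_of_lift (h : IsSkewFractionRing σ ι t) :
    ∀ {n : ℕ} {p : Q × T}, p ∈ polyLT (ι.prod κ) (t, τ) n → p.1 = 0 → p = 0
  | 0, p, hp, _ => by rwa [polyLT_zero, Submodule.mem_bot] at hp
  | n + 1, p, hp, h0 => by
    obtain ⟨a, ha⟩ := mem_polyLT_succ.1 hp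
    have h1 : (AlgHom.fst k Q T) (p - (ι.prod κ) a * (t, τ) ^ n) ∈ polyLT ι t n := by
      have := Submodule.mem_map_of_mem (f := (AlgHom.fst k Q T).toLinearMap) ha
      rw [map_polyLT] at this
      exact this
    have h2 : a = 0 := by
      refine h.indep n a ?_
      have e : (AlgHom.fst k Q T) (p - (ι.prod κ) a * (t, τ) ^ n) = -(ι a * t ^ n) := by
        simp [h0]
      rw [e] at h1
      simpa using neg_mem h1
    rw [h2, map_zero, zero_mul, sub_zero] at ha
    exact eq_zero_of_lift h ha h0

theorem exists_lift {n : ℕ} {p : Q} (hp : p ∈ polyLT ι t n) (κ : S →ₐ[k] T) (τ : T) :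
    ∃ P, (p, P) ∈ polyLT (ι.prod κ) (t, τ) n := by
  have : p ∈ (polyLT (ι.prod κ) (t, τ) n).map (AlgHom.fst k Q T).toLinearMap := by
    rw [map_polyLT]
    exact hp
  obtain ⟨⟨_, P⟩, hP, rfl⟩ := this
  exact ⟨P, hP⟩

theorem exists_monic_lift {n : ℕ} {m : Q} (hm : IsMonicPoly ι t n m) (κ : S →ₐ[k] T) (τ : T) :
    ∃ M, IsMonicPoly (ι.prod κ) (t, τ) n (m, M) := by
  obtain ⟨P, hP⟩ := exists_lift hm κ τ
  refine ⟨P + τ ^ n, ?_⟩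
  rw [IsMonicPoly]
  convert hP using 1
  ext <;> simp

end Lift

variable {X : Type u} [AddCommGroup X] [Module Q X]

/-- A module over the polynomials in `t` on which the monic ones are invertible is a module of
fractions; this is the case of the extension of `Q` by `X` defined by `ψ`. -/
theorem exists_twisted_derivation (h : IsSkewFractionRing σ ι t) (ψ : Q →+ X)
    (hψ : ∀ a q, ψ (ι a * q) = ι a • ψ q) :
    ∃ φ : Q →+ X, (∀ a q, φ (ι a * q) = ι a • φ q) ∧ ∀ q, φ (t * q) = t • (φ q + ψ q) := by
  let _ : Module k X := Module.compHom X (algebraMap k Q)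
  have ksmul (c : k) (x : X) : c • x = algebraMap k Q c • x := rfl
  have : IsScalarTower k Q X := ⟨fun c q x ↦ by rw [ksmul, Algebra.smul_def, mul_smul]⟩
  let ψ' : Q →ₗ[k] X :=
    { ψ with
      map_smul' := fun c q ↦ by
        change ψ (c • q) = c • ψ q
        rw [Algebra.smul_def, ← ι.commutes, hψ, ι.commutes, ksmul] }
  let κ : S →ₐ[k] Module.End k (X × Q) := (Algebra.lsmul k k (X × Q)).comp ι
  -- On the extension X × Q of Q by X, let t act with the cocycle ψ. The solution φ(q) will be the
  -- X-component of q applied to (0, 1), and the formula for τ is the required twisted Leibniz rule.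
  let τ : Module.End k (X × Q) :=
    LinearMap.prod (Algebra.lsmul k k X t ∘ₗ (LinearMap.fst k X Q + ψ' ∘ₗ LinearMap.snd k X Q))
      (Algebra.lsmul k k Q t ∘ₗ LinearMap.snd k X Q)
  have κ_apply (a : S) (y : X × Q) : κ a y = (ι a • y.1, ι a * y.2) := rfl
  have τ_apply (y : X × Q) : τ y = (t • (y.1 + ψ y.2), t * y.2) := rfl
  have hc : IsSkewCommuting σ (ι.prod κ) (t, τ) := by
    refine ⟨fun a ↦ Prod.ext (h.comm a) (LinearMap.ext fun y ↦ ?_)⟩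
    change τ (κ a y) = κ (σ a) (τ y)
    rw [κ_apply, τ_apply, τ_apply, κ_apply, hψ, ← smul_add, ← mul_smul, ← mul_smul, h.comm,
      ← mul_assoc, h.comm, mul_assoc]
  -- the action of polynomials on the extension
  have hact {n : ℕ} {p : Q × Module.End k (X × Q)} (hp : p ∈ polyLT (ι.prod κ) (t, τ) n) :
      (∀ x, p.2 (x, 0) = (p.1 • x, 0)) ∧ ∀ y, (p.2 y).2 = p.1 * y.2 := by
    induction hp using Submodule.span_induction with
    | mem p hp =>
      obtain ⟨i, -, a, rfl⟩ := hp
      have hτ (i : ℕ) : (∀ x, (τ ^ i) (x, 0) = (t ^ i • x, 0)) ∧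
          ∀ y, ((τ ^ i) y).2 = t ^ i * y.2 := by
        induction i with
        | zero => simp
        | succ i ih =>
          refine ⟨fun x ↦ ?_, fun y ↦ ?_⟩
          · rw [pow_succ', Module.End.mul_apply, ih.1, τ_apply, pow_succ']
            simp [mul_smul]
          · rw [pow_succ', Module.End.mul_apply, τ_apply, ih.2, pow_succ', mul_assoc]
      refine ⟨fun x ↦ ?_, fun y ↦ ?_⟩
      · change κ a ((τ ^ i) (x, 0)) = ((ι a * t ^ i) • x, 0)
        rw [(hτ i).1, κ_apply, mul_smul, mul_zero]
      · change (κ a ((τ ^ i) y)).2 = ι a * t ^ i * y.2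
        rw [κ_apply, (hτ i).2, mul_assoc]
    | zero => exact ⟨fun x ↦ by rw [Prod.fst_zero, zero_smul]; rfl, fun y ↦ by simp⟩
    | add p q _ _ hp hq =>
      refine ⟨fun x ↦ ?_, fun y ↦ ?_⟩
      · rw [Prod.snd_add, LinearMap.add_apply, hp.1, hq.1, Prod.fst_add, add_smul]
        simp
      · rw [Prod.snd_add, LinearMap.add_apply, Prod.snd_add, hp.2, hq.2, Prod.fst_add, add_mul]
    | smul c p _ hp =>
      refine ⟨fun x ↦ ?_, fun y ↦ ?_⟩
      · rw [Prod.smul_snd, LinearMap.smul_apply, hp.1, Prod.smul_fst, smul_assoc]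
        simp
      · rw [Prod.smul_snd, LinearMap.smul_apply, Prod.smul_snd, hp.2, Prod.smul_fst, smul_mul_assoc]
  -- The operator of a monic polynomial is triangular, acting on the submodule X and on the quotient
  -- Q as multiplication by the same unit.
  have hbij {n : ℕ} {p : Q × Module.End k (X × Q)} (hp : IsMonicPoly (ι.prod κ) (t, τ) n p) :
      IsUnit p.1 ∧ Function.Bijective p.2 := by
    have hu : IsUnit p.1 := by
      refine h.isUnit_of_monic (n := n) ?_
      have := Submodule.mem_map_of_mem (f := (AlgHom.fst k Q (Module.End k (X × Q))).toLinearMap) hp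
      rw [map_polyLT] at this
      exact this
    obtain ⟨u, hu'⟩ := hu
    have h1 := (hact hp.mem).1
    have h2 := (hact hp.mem).2
    rw [← hu'] at h1 h2
    refine ⟨⟨u, hu'⟩, ?_, ?_⟩
    · refine (injective_iff_map_eq_zero p.2).2 fun y hy ↦ ?_
      have h3 : y.2 = 0 := by simpa [hy] using (h2 y).symm
      have h4 : y = (y.1, 0) := Prod.ext rfl h3
      rw [h4, h1] at hy
      have h5 : (u : Q) • y.1 = 0 := congrArg Prod.fst hy
      have h6 : y.1 = 0 := by
        rw [← one_smul Q y.1, ← u.inv_mul, mul_smul, h5, smul_zero]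
      rw [h4, h6]
      rfl
    · intro y
      let z := p.2 (0, (↑u⁻¹ : Q) * y.2)
      refine ⟨(0, (↑u⁻¹ : Q) * y.2) + ((↑u⁻¹ : Q) • (y.1 - z.1), 0), ?_⟩
      rw [map_add, h1, ← mul_smul, u.mul_inv, one_smul]
      have hz : z.2 = y.2 := by
        change (p.2 _).2 = _
        rw [h2, ← mul_assoc, u.mul_inv, one_mul]
      exact Prod.ext (add_sub_cancel z.1 y.1) (by simpa using hz)
  let y₀ : X × Q := (0, 1)
  -- The graph of q ↦ q · (0, 1): if m q = p with m monic, then y is the solution of m y = p (0, 1).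
  -- The Ore condition makes it additive, stable under polynomials and single-valued.
  let G (q : Q) (y : X × Q) : Prop := ∃ n d, ∃ m p : Q × Module.End k (X × Q),
    IsMonicPoly (ι.prod κ) (t, τ) n m ∧ p ∈ polyLT (ι.prod κ) (t, τ) d ∧ m.1 * q = p.1 ∧
      m.2 y = p.2 y₀
  have hore (s : Q × Module.End k (X × Q)) {n d : ℕ} {m : Q × Module.End k (X × Q)}
      (hs : s ∈ polyLT (ι.prod κ) (t, τ) d)
      (hm : IsMonicPoly (ι.prod κ) (t, τ) n m) : ∃ n' d', ∃ m' s' : Q × Module.End k (X × Q),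
        IsMonicPoly (ι.prod κ) (t, τ) n' m' ∧ s' ∈ polyLT (ι.prod κ) (t, τ) d' ∧
        m' * s = s' * m := by
    have hm1 : IsMonicPoly ι t n m.1 := by
      have := Submodule.mem_map_of_mem (f := (AlgHom.fst k Q (Module.End k (X × Q))).toLinearMap) hm
      rw [map_polyLT] at this
      exact this
    obtain ⟨n', m', d', s', hm', hs', e⟩ := h.ore s.1 hm1
    obtain ⟨M', hM'⟩ := exists_monic_lift hm' κ τ
    obtain ⟨S', hS'⟩ := exists_lift hs' κ τ
    refine ⟨n', d', (m', M'), (s', S'), hM', hS', ?_⟩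
    refine sub_eq_zero.1 (h.eq_zero_of_lift (κ := κ) (τ := τ) (n := n' + d + (d' + n))
      (sub_mem ?_ ?_) (sub_eq_zero.2 e))
    · exact hc.mul_mem' hM'.mem hs (by omega)
    · exact hc.mul_mem' hS' hm.mem (by omega)
  have hGzero {y : X × Q} (hy : G 0 y) : y = 0 := by
    obtain ⟨n, d, m, p, hm, hp, e₁, e₂⟩ := hy
    have hp0 := h.eq_zero_of_lift hp (by rw [← e₁, mul_zero])
    rw [hp0] at e₂
    exact (hbij hm).2.1 (by simpa using e₂)
  have hGadd {q q' : Q} {y y' : X × Q} (hy : G q y) (hy' : G q' y') : G (q + q') (y + y') := by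
    obtain ⟨n, d, m, p, hm, hp, e₁, e₂⟩ := hy
    obtain ⟨n', d', m', p', hm', hp', e₁', e₂'⟩ := hy'
    obtain ⟨e, f, u, v, hu, hv, huv⟩ := hore m hm.mem hm'
    refine ⟨e + n, e + d + (f + d'), u * m, u * p + v * p', hc.monic_mul hu hm,
      add_mem (hc.mul_mem' hu.mem hp (by omega)) (hc.mul_mem' hv hp' (by omega)), ?_, ?_⟩
    · rw [mul_add]
      nth_rw 2 [huv]
      simp only [Prod.fst_mul, Prod.fst_add, mul_assoc, e₁, e₁']
    · rw [map_add]
      nth_rw 2 [huv]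
      simp only [Prod.snd_mul, Prod.snd_add, Module.End.mul_apply, e₂, e₂', LinearMap.add_apply]
  have hGmul {q : Q} {y : X × Q} {d : ℕ} {s : Q × Module.End k (X × Q)}
      (hs : s ∈ polyLT (ι.prod κ) (t, τ) d) (hy : G q y) : G (s.1 * q) (s.2 y) := by
    obtain ⟨n, d, m, p, hm, hp, e₁, e₂⟩ := hy
    obtain ⟨e, f, u, v, hu, hv, huv⟩ := hore s hs hm
    refine ⟨e, f + d, u, v * p, hu, hc.mul_mem' hv hp (by omega), ?_, ?_⟩
    · rw [← mul_assoc, ← Prod.fst_mul, huv, Prod.fst_mul, mul_assoc, e₁, Prod.fst_mul]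
    · rw [← Module.End.mul_apply, ← Prod.snd_mul, huv, Prod.snd_mul, Module.End.mul_apply, e₂,
        Prod.snd_mul, Module.End.mul_apply]
  have hGtotal (q : Q) : ∃ y, G q y := by
    obtain ⟨n, m, d, hm, hd⟩ := h.left_den q
    obtain ⟨M, hM⟩ := exists_monic_lift hm κ τ
    obtain ⟨P, hP⟩ := exists_lift hd κ τ
    obtain ⟨y, hy⟩ := (hbij hM).2.2 (P y₀)
    exact ⟨y, n, d, _, _, hM, hP, rfl, hy⟩
  have hGneg {q : Q} {y : X × Q} (hy : G q y) : G (-q) (-y) := by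
    have h1 : ((-1, -1) : Q × Module.End k (X × Q)) ∈ polyLT (ι.prod κ) (t, τ) 1 := by
      have := map_mem_polyLT (ι := ι.prod κ) (t := (t, τ)) one_pos (-1)
      rw [map_neg, map_one] at this
      exact this
    simpa using hGmul h1 hy
  have hGuniq {q : Q} {y y' : X × Q} (hy : G q y) (hy' : G q y') : y = y' := by
    refine sub_eq_zero.1 (hGzero ?_)
    rw [sub_eq_add_neg, ← add_neg_cancel q]
    exact hGadd hy (hGneg hy')
  choose f hf using hGtotal
  have hfadd (q q' : Q) : f (q + q') = f q + f q' := hGuniq (hf _) (hGadd (hf q) (hf q'))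
  have hf2 (q : Q) : (f q).2 = q := by
    obtain ⟨n, d, m, p, hm, hp, e₁, e₂⟩ := hf q
    have h1 := (hact hm.mem).2 (f q)
    rw [e₂, (hact hp).2, mul_one, ← e₁] at h1
    exact ((hbij hm).1.mul_left_cancel h1).symm
  refine ⟨⟨⟨fun q ↦ (f q).1, ?_⟩, fun q q' ↦ ?_⟩, fun a q ↦ ?_, fun q ↦ ?_⟩
  · have := hfadd 0 0
    rw [add_zero, left_eq_add] at this
    rw [this]
    rfl
  · change (f (q + q')).1 = _
    rw [hfadd]
    rfl
  · have := hGuniq (hf _) (hGmul (map_mem_polyLT one_pos a) (hf q))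
    exact congrArg Prod.fst this
  · have h1 : ((t, τ) : Q × Module.End k (X × Q)) ∈ polyLT (ι.prod κ) (t, τ) 2 := by
      simpa using pow_mem_polyLT (ι := ι.prod κ) (t := (t, τ)) (i := 1) (n := 2) (by omega)
    have := hGuniq (hf _) (hGmul h1 (hf q))
    have := congrArg Prod.fst this
    rw [τ_apply, hf2] at this
    exact this

/-- An additive map that commutes with `S` and `t` is `Q`-linear. -/
theorem map_mul_of_commute (h : IsSkewFractionRing σ ι t) {φ : Q →+ X}
    (hφ : ∀ a q, φ (ι a * q) = ι a • φ q) (hφt : ∀ q, φ (t * q) = t • φ q) (q : Q) :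
    φ q = q • φ 1 := by
  have hpow (i : ℕ) (q : Q) : φ (t ^ i * q) = t ^ i • φ q := by
    induction i generalizing q with
    | zero => simp
    | succ i ih => rw [pow_succ, mul_assoc, ih, hφt, mul_smul]
  have hpoly {n : ℕ} {p : Q} (hp : p ∈ polyLT ι t n) : ∀ q, φ (p * q) = p • φ q := by
    induction hp using Submodule.span_induction with
    | mem p hp =>
      obtain ⟨i, -, a, rfl⟩ := hp
      intro q
      rw [mul_assoc, hφ, hpow, mul_smul]
    | zero => simp
    | add p p' _ _ hp hp' => intro q; rw [add_mul, map_add, hp, hp', add_smul]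
    | smul c p _ hp =>
      intro q
      rw [Algebra.smul_def, ← ι.commutes, mul_assoc, hφ, hp, mul_smul]
  obtain ⟨n, m, d, hm, hd⟩ := h.left_den q
  have h1 := hpoly hm.mem q
  have h2 := hpoly hd 1
  rw [mul_one, h1, mul_smul] at h2
  obtain ⟨u, rfl⟩ := h.isUnit_of_monic hm
  simpa [← mul_smul] using congrArg (fun x ↦ (↑u⁻¹ : Q) • x) h2

end IsSkewFractionRing

end

end HomTr

namespace HomTr

/-! ### Leading coefficients and the noetherian property -/

section LeadingCoefficients

variable {k : Type v} [Field k] {S R : Type u} [Ring S] [Algebra k S] [Ring R] [Algebra k R]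
variable {σ : S ≃ₐ[k] S} {ι : S →ₐ[k] R} {t : R}

namespace IsSkewCommuting

/-- The leading coefficients, written on the right, of the polynomials of degree `d` in `I`. -/
def leadingIdeal (h : IsSkewCommuting σ ι t) (I : Ideal R) (d : ℕ) : Ideal S where
  carrier := {a | ∃ p ∈ I, p - t ^ d * ι a ∈ polyLT ι t d}
  zero_mem' := ⟨0, I.zero_mem, by simp⟩
  add_mem' := by
    rintro a b ⟨p, hp, hpa⟩ ⟨q, hq, hqb⟩
    refine ⟨p + q, I.add_mem hp hq, ?_⟩
    convert add_mem hpa hqb using 1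
    rw [map_add, mul_add]
    abel
  smul_mem' := by
    rintro c a ⟨p, hp, hpa⟩
    refine ⟨ι ((σ ^ d) c) * p, I.mul_mem_left _ hp, ?_⟩
    convert h.map_mul_mem ((σ ^ d) c) hpa using 1
    rw [smul_eq_mul, map_mul, ← mul_assoc, h.pow_mul, mul_sub, mul_assoc]

variable (h : IsSkewCommuting σ ι t)

/-- With coefficients on the right, left multiplication by a power of t does not twist the leading
coefficient. -/
theorem leadingIdeal_mono {I I' : Ideal R} (hI : I ≤ I') {d d' : ℕ} (hd : d ≤ d') :
    h.leadingIdeal I d ≤ h.leadingIdeal I' d' := by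
  rintro a ⟨p, hp, hpa⟩
  refine ⟨t ^ (d' - d) * p, I'.mul_mem_left _ (hI hp), ?_⟩
  have e : t ^ (d' - d) * p - t ^ d' * ι a = t ^ (d' - d) * (p - t ^ d * ι a) := by
    rw [mul_sub, ← mul_assoc, ← pow_add, Nat.sub_add_cancel hd]
  rw [e]
  exact h.mul_mem' (pow_mem_polyLT (Nat.lt_succ_self _)) hpa (by omega)

/-- Reduction of the polynomials in `I'` modulo `I` when the leading coefficients agree
from degree `N` on. -/
theorem exists_reduction {I I' : Ideal R} (hI : I ≤ I') {N : ℕ}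
    (hlc : ∀ d, N ≤ d → h.leadingIdeal I' d ≤ h.leadingIdeal I d) :
    ∀ {n : ℕ} {p : R}, p ∈ I' → p ∈ polyLT ι t n → ∃ q ∈ polyLT ι t N, p - q ∈ I
  | 0, p, _, hp => ⟨0, zero_mem _, by
      rw [polyLT_zero, Submodule.mem_bot] at hp
      simp [hp]⟩
  | n + 1, p, hp', hp => by
    rcases le_or_gt (n + 1) N with hn | hn
    · exact ⟨p, polyLT_mono hn hp, by simp⟩
    obtain ⟨a, ha⟩ := h.mem_polyLT_succ_right.1 hp
    obtain ⟨q, hq, hqa⟩ := hlc n (by omega) ⟨p, hp', ha⟩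
    obtain ⟨r, hr, hpr⟩ := exists_reduction hI hlc (n := n) (p := p - q) (I'.sub_mem hp' (hI hq)) (by
      convert sub_mem ha hqa using 1
      abel)
    refine ⟨r, hr, ?_⟩
    convert I.add_mem hpr hq using 1
    abel

include h in
/-- A ring of fractions of skew polynomials over a left noetherian ring is left noetherian. -/
theorem isNoetherianRing [IsNoetherianRing S]
    (hden : ∀ x, ∃ m d, IsUnit m ∧ m * x ∈ polyLT ι t d) : IsNoetherianRing R := by
  refine monotone_stabilizes_iff_noetherian.1 fun I ↦ ?_
  obtain ⟨N, hN⟩ := monotone_stabilizes_iff_noetherian.2 ‹IsNoetherianRing S›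
    ⟨fun i ↦ h.leadingIdeal (I i) i, fun i j hij ↦ h.leadingIdeal_mono (I.mono hij) hij⟩
  have hd (d : ℕ) := monotone_stabilizes_iff_noetherian.2 ‹IsNoetherianRing S›
    ⟨fun i ↦ h.leadingIdeal (I i) d, fun i j hij ↦ h.leadingIdeal_mono (I.mono hij) le_rfl⟩
  choose M hM using hd
  -- Degrees at least N are settled by the diagonal chain `I i`, degree i, and the finitely many
  -- degrees below N by their own chains; K exceeds all these indices.
  let K := N + (Finset.range N).sup M
  refine ⟨K, fun i hi ↦ le_antisymm (I.mono hi) fun x hx ↦ ?_⟩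
  have hlc (d : ℕ) : h.leadingIdeal (I i) d ≤ h.leadingIdeal (I K) d := by
    rcases le_or_gt N d with hd | hd
    · calc h.leadingIdeal (I i) d ≤ h.leadingIdeal (I (i + d)) (i + d) :=
            h.leadingIdeal_mono (I.mono (by omega)) (by omega)
        _ = h.leadingIdeal (I N) N := (hN (i + d) (by omega)).symm
        _ ≤ h.leadingIdeal (I K) d := h.leadingIdeal_mono (I.mono (by omega)) hd
    · have hK : M d ≤ K := (Finset.le_sup (Finset.mem_range.2 hd)).trans (Nat.le_add_left _ _)
      exact ((hM d i (hK.trans hi)).symm.trans (hM d K hK)).le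
  obtain ⟨m, d, hm, hd⟩ := hden x
  obtain ⟨q, hq, hpq⟩ := h.exists_reduction (I.mono hi) (N := 0) (fun d _ ↦ hlc d)
    (Ideal.mul_mem_left (I i) m hx) hd
  rw [polyLT_zero, Submodule.mem_bot] at hq
  rw [hq, sub_zero] at hpq
  exact (Ideal.unit_mul_mem_iff_mem _ hm).1 hpq

end IsSkewCommuting

/-! ### The artinian property and simplicity of the ring of fractions. -/

namespace IsSkewFractionRing

/-- The left ideal of all leading coefficients. -/
def leading (h : IsSkewFractionRing σ ι t) (I : Ideal R) : Ideal S :=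
  ⨆ d, h.leadingIdeal I d

variable (h : IsSkewFractionRing σ ι t)

theorem mem_leading {I : Ideal R} {a : S} : a ∈ h.leading I ↔ ∃ d, a ∈ h.leadingIdeal I d :=
  Submodule.mem_iSup_of_directed _
    (Monotone.directed_le fun _ _ hd ↦ h.leadingIdeal_mono le_rfl hd)

theorem exists_leading_eq [IsNoetherianRing S] (I : Ideal R) :
    ∃ N, ∀ d, N ≤ d → h.leadingIdeal I d = h.leading I := by
  obtain ⟨N, hN⟩ := monotone_stabilizes_iff_noetherian.2 ‹IsNoetherianRing S›
    ⟨fun i ↦ h.leadingIdeal I i, fun i j hij ↦ h.leadingIdeal_mono le_rfl hij⟩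
  refine ⟨N, fun d hd ↦ le_antisymm (le_iSup (h.leadingIdeal I) d) (iSup_le fun e ↦ ?_)⟩
  calc h.leadingIdeal I e ≤ h.leadingIdeal I (e + d) := h.leadingIdeal_mono le_rfl (by omega)
    _ = h.leadingIdeal I N := (hN (e + d) (by omega)).symm
    _ = h.leadingIdeal I d := hN d hd

/-- If the leading ideals agree, any polynomial p in the larger ideal and all tⁱp reduce modulo the
smaller one to degree below a fixed N. They lie in a noetherian S-module, so some (tᴰ − r)p with r
of degree below D falls in the smaller ideal; its monic factor is a unit. Hence a descending chain
in Q gives one in S. -/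
theorem leading_strictMono [IsNoetherianRing S] : StrictMono h.leading := by
  intro I I' hII
  have hle : h.leading I ≤ h.leading I' :=
    iSup_mono fun d ↦ h.leadingIdeal_mono hII.le le_rfl
  refine lt_of_le_of_ne hle fun heq ↦ hII.not_ge fun x hx ↦ ?_
  obtain ⟨N, hN⟩ := h.exists_leading_eq I
  have hlc (d : ℕ) (hd : N ≤ d) : h.leadingIdeal I' d ≤ h.leadingIdeal I d := by
    rw [hN d hd, heq]
    exact le_iSup (h.leadingIdeal I') d
  obtain ⟨n, m, e, hm, hd⟩ := h.left_den x
  rw [← Ideal.unit_mul_mem_iff_mem _ (h.isUnit_of_monic hm)]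
  set p := m * x
  have hp : p ∈ I' := I'.mul_mem_left m hx
  let _ : Module S R := Module.compHom R (ι : S →+* R)
  have smul_def (a : S) (r : R) : a • r = ι a * r := rfl
  have : IsScalarTower S R R := ⟨fun a r s ↦ by simp only [smul_def, smul_eq_mul, mul_assoc]⟩
  let J : Submodule S R := Submodule.restrictScalars S I
  let Φ : (Fin N → S) →ₗ[S] R :=
    { toFun := fun a ↦ ∑ i, ι (a i) * t ^ (i : ℕ)
      map_add' := fun a b ↦ by simp [add_mul, Finset.sum_add_distrib]
      map_smul' := fun c a ↦ by simp [smul_def, Finset.mul_sum, mul_assoc] }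
  have hΦ {q : R} (hq : q ∈ polyLT ι t N) : q ∈ LinearMap.range Φ := by
    induction hq using Submodule.span_induction with
    | mem q hq =>
      obtain ⟨i, hi, a, rfl⟩ := hq
      refine ⟨Pi.single ⟨i, hi⟩ a, ?_⟩
      change ∑ j : Fin N, _ = _
      rw [Finset.sum_eq_single ⟨i, hi⟩ (fun j _ hj ↦ by simp [hj]) (by simp), Pi.single_eq_same]
    | zero => exact zero_mem _
    | add a b _ _ ha hb => exact add_mem ha hb
    | smul c q _ hq =>
      have : c • q = algebraMap k S c • q := by
        rw [smul_def, ι.commutes, Algebra.smul_def]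
      rw [this]
      exact Submodule.smul_mem _ _ hq
  let M : Submodule S (R ⧸ J) := LinearMap.range (J.mkQ ∘ₗ Φ)
  have hMn : IsNoetherian S M := isNoetherian_of_surjective
    (J.mkQ ∘ₗ Φ).rangeRestrict (LinearMap.range_rangeRestrict _)
  have hmem (i : ℕ) : J.mkQ (t ^ i * p) ∈ M := by
    have h1 : t ^ i * p ∈ polyLT ι t (i + e) :=
      h.mul_mem' (pow_mem_polyLT (Nat.lt_succ_self i)) hd (by omega)
    obtain ⟨q, hq, hpq⟩ := h.exists_reduction hII.le hlc (I'.mul_mem_left _ hp) h1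
    obtain ⟨a, ha⟩ := hΦ hq
    refine ⟨a, ?_⟩
    rw [LinearMap.comp_apply, ha]
    exact ((Submodule.Quotient.eq J).2 hpq).symm
  let y (i : ℕ) : M := ⟨_, hmem i⟩
  -- The chain of spans of p, tp, …, tⁿ⁻¹p modulo I stabilises, which produces the relation for tᴰp.
  obtain ⟨D, hD⟩ := monotone_stabilizes_iff_noetherian.2 hMn
    ⟨fun n ↦ Submodule.span S (y '' {i | i < n}), fun a b hab ↦
      Submodule.span_mono (Set.image_mono fun i (hi : i < a) ↦ hi.trans_le hab)⟩
  have hyD : y D ∈ Submodule.span S (y '' {i | i < D}) := by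
    have : y D ∈ Submodule.span S (y '' {i | i < D + 1}) :=
      Submodule.subset_span ⟨D, Nat.lt_succ_self D, rfl⟩
    have e := hD (D + 1) (by omega)
    change Submodule.span S _ = Submodule.span S _ at e
    rwa [← e] at this
  have hspan {z : M} (hz : z ∈ Submodule.span S (y '' {i | i < D})) :
      ∃ r ∈ polyLT ι t D, (z : R ⧸ J) = J.mkQ (r * p) := by
    induction hz using Submodule.span_induction with
    | mem z hz =>
      obtain ⟨i, hi, rfl⟩ := hz
      exact ⟨t ^ i, pow_mem_polyLT hi, rfl⟩
    | zero => exact ⟨0, zero_mem _, by simp⟩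
    | add z w _ _ hz hw =>
      obtain ⟨r, hr, e⟩ := hz
      obtain ⟨s, hs, e'⟩ := hw
      exact ⟨r + s, add_mem hr hs, by rw [add_mul, map_add, ← e, ← e']; rfl⟩
    | smul a z _ hz =>
      obtain ⟨r, hr, e⟩ := hz
      refine ⟨ι a * r, h.map_mul_mem a hr, ?_⟩
      rw [mul_assoc, ← smul_def, map_smul, ← e]
      rfl
  obtain ⟨r, hr, e⟩ := hspan hyD
  have h2 : (t ^ D - r) * p ∈ I := by
    rw [sub_mul]
    exact (Submodule.Quotient.eq J).1 e
  refine (Ideal.unit_mul_mem_iff_mem _ (h.isUnit_of_monic (n := D) (m := t ^ D - r) ?_)).1 h2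
  rw [IsMonicPoly, sub_sub_cancel_left]
  exact neg_mem hr

include h in
theorem isArtinianRing [IsArtinianRing S] : IsArtinianRing R :=
  ⟨h.leading_strictMono.wellFoundedLT.wf⟩

include h in
-- The right-hand leading coefficients of a two-sided ideal form a two-sided ideal of S. If nonzero
-- it contains 1, so the given ideal contains a monic polynomial, which is a unit.
theorem isSimpleRing [IsSimpleRing S] : IsSimpleRing R := by
  have hnt : Nontrivial R := by
    refine ⟨0, 1, fun h01 ↦ ?_⟩
    have := h.indep 0 1 (by rw [← mul_one (ι 1 * t ^ 0), ← h01, mul_zero]; exact zero_mem _)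
    exact one_ne_zero this
  have hone (J : TwoSidedIdeal R) (x : R) (hx : x ∈ J) (hx0 : x ≠ 0) : (1 : R) ∈ J := by
    let I : Ideal R := J.asIdeal
    have mem_I (y : R) : y ∈ I ↔ y ∈ J := TwoSidedIdeal.mem_asIdeal
    obtain ⟨n, m, d, hm, hd⟩ := h.left_den x
    let L : TwoSidedIdeal S := .mk' (h.leading I) (zero_mem _) (add_mem) (neg_mem)
      (fun {a b} hb ↦ Ideal.mul_mem_left _ a hb) (fun {a b} ha ↦ by
        obtain ⟨e, p, hp, hpa⟩ := h.mem_leading.1 ha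
        refine h.mem_leading.2 ⟨e, p * ι b, ?_, ?_⟩
        · rw [mem_I] at hp ⊢
          exact J.mul_mem_right _ _ hp
        · rw [map_mul, ← mul_assoc, ← sub_mul]
          exact h.mul_map_mem b hpa)
    have mem_L (a : S) : a ∈ L ↔ a ∈ h.leading I := TwoSidedIdeal.mem_mk' ..
    have key : ∀ {e : ℕ} {p : R}, p ∈ polyLT ι t e → p ∈ I → p ≠ 0 → ∃ a ∈ L, a ≠ 0 := by
      intro e
      induction e with
      | zero =>
        intro p hp _ hp0
        rw [polyLT_zero, Submodule.mem_bot] at hp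
        exact absurd hp hp0
      | succ e ih =>
        intro p hp hpI hp0
        obtain ⟨a, ha⟩ := h.mem_polyLT_succ_right.1 hp
        by_cases ha0 : a = 0
        · rw [ha0, map_zero, mul_zero, sub_zero] at ha
          exact ih ha hpI hp0
        · exact ⟨a, (mem_L a).2 (h.mem_leading.2 ⟨e, p, hpI, ha⟩), ha0⟩
    obtain ⟨a, haL, ha0⟩ := key hd (I.mul_mem_left m ((mem_I x).2 hx)) fun h0 ↦
      hx0 ((h.isUnit_of_monic hm).mul_right_eq_zero.1 h0)
    have h1 := (mem_L 1).1 (IsSimpleRing.one_mem_of_ne_zero_mem L ha0 haL)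
    obtain ⟨e, p, hp, hpe⟩ := h.mem_leading.1 h1
    rw [map_one, mul_one] at hpe
    obtain ⟨w, rfl⟩ := h.isUnit_of_monic (n := e) hpe
    have := I.mul_mem_left ↑w⁻¹ hp
    rwa [w.inv_mul, mem_I] at this
  refine ⟨⟨fun J ↦ ?_⟩⟩
  by_cases hJ : ∃ x ∈ J, x ≠ 0
  · obtain ⟨x, hx, hx0⟩ := hJ
    exact Or.inr (J.one_mem_iff.1 (hone J x hx hx0))
  · push Not at hJ
    exact Or.inl (eq_bot_iff.2 fun x hx ↦ (TwoSidedIdeal.mem_bot R).2 (hJ x hx))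

end IsSkewFractionRing

end LeadingCoefficients

end HomTr

namespace HomTr

/-! ### Base change of skew fractions -/

/-- The retraction sends b f(a) to r(b) a, so an element of A in the extension of a left ideal I
already lies in I. Extension of left ideals is therefore strictly increasing. -/
theorem isNoetherianRing_of_retraction {A B : Type u} [Ring A] [Ring B] [IsNoetherianRing B]
    (f : A →+* B) (r : B →+ A) (hr : ∀ b a, r (b * f a) = r b * a) (h1 : r 1 = 1) :
    IsNoetherianRing A := by
  have key (I : Ideal A) (a : A) (ha : f a ∈ Ideal.map f I) : a ∈ I := by
    suffices ∀ x ∈ Ideal.map f I, r x ∈ I by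
      have := this _ ha
      rwa [← one_mul (f a), hr, h1, one_mul] at this
    intro x hx
    induction hx using Submodule.span_induction with
    | mem x hx =>
      obtain ⟨a, ha, rfl⟩ := hx
      rw [← one_mul (f a), hr, h1, one_mul]
      exact ha
    | zero => simp
    | add x y _ _ hx hy => rw [map_add]; exact add_mem hx hy
    | smul b x hx h' =>
      rw [smul_eq_mul]
      clear a ha h'
      revert b
      induction hx using Submodule.span_induction with
      | mem x hx =>
        obtain ⟨a, ha, rfl⟩ := hx
        intro b
        rw [hr]
        exact I.mul_mem_left _ ha
      | zero => simp
      | add x y _ _ hx hy => intro b; rw [mul_add, map_add]; exact add_mem (hx b) (hy b)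
      | smul c x _ hx => intro b; rw [smul_eq_mul, ← mul_assoc]; exact hx _
  have hmono : StrictMono (Ideal.map f) := fun I J hIJ ↦
    lt_of_le_of_ne (Ideal.map_mono hIJ.le) fun e ↦ hIJ.not_ge fun a ha ↦
      key I a (e ▸ Ideal.mem_map_of_mem f ha)
  exact isNoetherian_iff'.2 hmono.wellFoundedGT

theorem IsNoetherianBothSides.of_ringEquiv {A B : Type u} [Ring A] [Ring B] (e : A ≃+* B)
    (h : IsNoetherianBothSides A) : IsNoetherianBothSides B :=
  ⟨have := h.1; isNoetherianRing_of_ringEquiv A e, have := h.2; isNoetherianRing_of_ringEquiv _ e.op⟩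

section

variable {k : Type v} [Field k] {S Q : Type u} [Ring S] [Algebra k S] [Ring Q] [Algebra k Q]
variable {σ : S ≃ₐ[k] S} {ι : S →ₐ[k] Q} {t : Q} (U : Type u) [Ring U] [Algebra k U]

theorem IsSkewCommuting.tensor (h : IsSkewCommuting σ ι t) :
    IsSkewCommuting (Algebra.TensorProduct.congr σ (AlgEquiv.refl (A₁ := U)))
      (Algebra.TensorProduct.map ι (AlgHom.id k U)) (t ⊗ₜ[k] (1 : U)) where
  comm a := by
    induction a using TensorProduct.induction_on with
    | zero => simp
    | tmul s u => simp [h.comm]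
    | add x y hx hy => rw [map_add, mul_add, hx, hy, map_add, map_add, add_mul]

theorem tmul_mem_polyLT {n : ℕ} {p : Q} (hp : p ∈ polyLT ι t n) (u : U) :
    p ⊗ₜ[k] u ∈ polyLT (Algebra.TensorProduct.map ι (AlgHom.id k U)) (t ⊗ₜ[k] (1 : U)) n := by
  induction hp using Submodule.span_induction with
  | mem p hp =>
    obtain ⟨i, hi, a, rfl⟩ := hp
    have := mul_pow_mem_polyLT (ι := Algebra.TensorProduct.map ι (AlgHom.id k U))
      (t := t ⊗ₜ[k] (1 : U)) hi (a ⊗ₜ u)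
    simpa [Algebra.TensorProduct.tmul_pow] using this
  | zero => simp
  | add p q _ _ hp hq => rw [add_tmul]; exact add_mem hp hq
  | smul c p _ hp => rw [← smul_tmul']; exact Submodule.smul_mem _ c hp

namespace IsSkewFractionRing

/-- The denominator may be kept of the form m ⊗ 1: common left multiples of monic polynomials from
`ore` handle sums. -/
theorem tensor_left_den (h : IsSkewFractionRing σ ι t) (x : Q ⊗[k] U) :
    ∃ n m d, IsMonicPoly ι t n m ∧ (m ⊗ₜ[k] (1 : U)) * x ∈
      polyLT (Algebra.TensorProduct.map ι (AlgHom.id k U)) (t ⊗ₜ[k] (1 : U)) d := by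
  induction x using TensorProduct.induction_on with
  | zero => exact ⟨0, 1, 0, isMonicPoly_one, by simp⟩
  | tmul q u =>
    obtain ⟨n, m, d, hm, hd⟩ := h.left_den q
    exact ⟨n, m, d, hm, by simpa using tmul_mem_polyLT U hd u⟩
  | add x y hx hy =>
    obtain ⟨n, m, d, hm, hd⟩ := hx
    obtain ⟨n', m', d', hm', hd'⟩ := hy
    obtain ⟨e, v, f, s, hv, hs, hvs⟩ := h.ore m hm'
    refine ⟨e + n, v * m, e + d + (f + d'), h.monic_mul hv hm, ?_⟩
    have hT := h.toIsSkewCommuting.tensor U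
    rw [mul_add]
    refine add_mem ?_ ?_
    · have : (v * m) ⊗ₜ[k] (1 : U) = v ⊗ₜ 1 * m ⊗ₜ 1 := by simp
      rw [this, mul_assoc]
      exact hT.mul_mem' (tmul_mem_polyLT U hv.mem 1) hd (by omega)
    · have : (v * m) ⊗ₜ[k] (1 : U) = s ⊗ₜ 1 * m' ⊗ₜ 1 := by simp [hvs]
      rw [this, mul_assoc]
      exact hT.mul_mem' (tmul_mem_polyLT U hs 1) hd' (by omega)

theorem isNoetherianRing_tensor (h : IsSkewFractionRing σ ι t) [IsNoetherianRing (S ⊗[k] U)] :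
    IsNoetherianRing (Q ⊗[k] U) := by
  refine (h.toIsSkewCommuting.tensor U).isNoetherianRing fun x ↦ ?_
  obtain ⟨n, m, d, hm, hd⟩ := h.tensor_left_den U x
  exact ⟨_, d, (h.isUnit_of_monic hm).map (Algebra.TensorProduct.includeLeft (S := k)), hd⟩

theorem isNoetherianBothSides_tensor (h : IsSkewFractionRing σ ι t)
    (hU : IsNoetherianBothSides (S ⊗[k] U)) : IsNoetherianBothSides (Q ⊗[k] U) := by
  have := hU.1
  refine ⟨h.isNoetherianRing_tensor U, ?_⟩
  have : IsNoetherianRing (Sᵐᵒᵖ ⊗[k] Uᵐᵒᵖ) :=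
    have := hU.2
    isNoetherianRing_of_ringEquiv _ (Algebra.TensorProduct.opAlgEquiv k k S U).symm.toRingEquiv
  have := h.op.isNoetherianRing_tensor Uᵐᵒᵖ
  exact isNoetherianRing_of_ringEquiv _ (Algebra.TensorProduct.opAlgEquiv k k Q U).toRingEquiv

end IsSkewFractionRing

end

/-! ### Coefficient maps on tensor products, and descent of the noetherian property. -/

section Coefficients

variable {k : Type v} [Field k] {S S' Q Q' : Type u} [Ring S] [Algebra k S] [Ring Q] [Algebra k Q]
  [Ring S'] [Algebra k S'] [Ring Q'] [Algebra k Q']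

theorem map_tensor_mul {ι : S →ₐ[k] Q} {ι' : S' →ₐ[k] Q'} {c : Q →ₗ[k] S} {c' : Q' →ₗ[k] S'}
    (hc : ∀ a q, c (ι a * q) = a * c q) (hc' : ∀ a q, c' (ι' a * q) = a * c' q)
    (e : S ⊗[k] S') (b : Q ⊗[k] Q') :
    TensorProduct.map c c' (Algebra.TensorProduct.map ι ι' e * b)
      = e * TensorProduct.map c c' b := by
  induction e using TensorProduct.induction_on with
  | zero => simp
  | add x y hx hy => rw [map_add, add_mul, map_add, hx, hy, add_mul]
  | tmul s s' =>
    induction b using TensorProduct.induction_on with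
    | zero => simp
    | add x y hx hy => rw [mul_add, map_add, hx, hy, map_add, mul_add]
    | tmul q q' => simp [hc, hc']

theorem map_mul_tensor {ι : S →ₐ[k] Q} {ι' : S' →ₐ[k] Q'} {c : Q →ₗ[k] S} {c' : Q' →ₗ[k] S'}
    (hc : ∀ q a, c (q * ι a) = c q * a) (hc' : ∀ q a, c' (q * ι' a) = c' q * a)
    (b : Q ⊗[k] Q') (e : S ⊗[k] S') :
    TensorProduct.map c c' (b * Algebra.TensorProduct.map ι ι' e)
      = TensorProduct.map c c' b * e := by
  induction e using TensorProduct.induction_on with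
  | zero => simp
  | add x y hx hy => rw [map_add, mul_add, map_add, hx, hy, mul_add]
  | tmul s s' =>
    induction b using TensorProduct.induction_on with
    | zero => simp
    | add x y hx hy => rw [add_mul, map_add, hx, hy, map_add, add_mul]
    | tmul q q' => simp [hc, hc']

variable {σ : S ≃ₐ[k] S} {ι : S →ₐ[k] Q} {t : Q} (U : Type u) [Ring U] [Algebra k U]

theorem IsSkewFractionRing.isNoetherianBothSides_of_tensor (h : IsSkewFractionRing σ ι t)
    (hU : IsNoetherianBothSides (Q ⊗[k] U)) : IsNoetherianBothSides (S ⊗[k] U) := by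
  let r : Q ⊗[k] U →ₗ[k] S ⊗[k] U := TensorProduct.map h.coeffZeroₗ LinearMap.id
  let f : S ⊗[k] U →ₐ[k] Q ⊗[k] U := Algebra.TensorProduct.map ι (AlgHom.id k U)
  have h1 : r 1 = 1 := by
    change r (1 ⊗ₜ 1) = 1 ⊗ₜ 1
    exact congrArg (· ⊗ₜ (1 : U)) h.coeffZero_one
  have := hU.1
  have := hU.2
  refine ⟨isNoetherianRing_of_retraction (f : S ⊗[k] U →+* Q ⊗[k] U) r.toAddMonoidHom
    (fun b a ↦ ?_) h1, isNoetherianRing_of_retraction (RingHom.op (f : S ⊗[k] U →+* Q ⊗[k] U))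
    (AddMonoidHom.mulOp r.toAddMonoidHom) (fun b a ↦ ?_) (congrArg MulOpposite.op h1)⟩
  · exact map_mul_tensor (fun q a ↦ h.coeffZero_mul_map q a) (fun _ _ ↦ rfl) b a
  · exact congrArg MulOpposite.op (map_tensor_mul (fun a q ↦ h.coeffZero_map_mul a q)
      (fun _ _ ↦ rfl) a.unop b.unop)

/-- The noetherian property of `S ⊗ S°` passes to `S ⊗ Q°`. -/
theorem IsSkewFractionRing.isNoetherianBothSides_tensor_op (h : IsSkewFractionRing σ ι t)
    (hU : IsNoetherianBothSides (U ⊗[k] Sᵐᵒᵖ)) : IsNoetherianBothSides (U ⊗[k] Qᵐᵒᵖ) :=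
  (h.op.isNoetherianBothSides_tensor U
    (hU.of_ringEquiv (Algebra.TensorProduct.comm k U Sᵐᵒᵖ).toRingEquiv)).of_ringEquiv
    (Algebra.TensorProduct.comm k Qᵐᵒᵖ U).toRingEquiv

end Coefficients

end HomTr

namespace HomTr

/-! ### Exact functors and `Ext` -/

section ExactFunctors

open Limits Abelian

universe w u₁ v₁ u₂ v₂ u₃ v₃

variable {C : Type u₁} [Category.{v₁} C] [Abelian C] {D : Type u₂} [Category.{v₂} D] [Abelian D]
  {D' : Type u₃} [Category.{v₃} D'] [Abelian D']

/-- Dimension shifting along an injective presentation, which the exact functor carries to another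
one. -/
theorem hasInjectiveDimensionLT_obj (G : C ⥤ D) [G.Additive] [PreservesFiniteLimits G]
    [PreservesFiniteColimits G] [G.PreservesInjectiveObjects] [EnoughInjectives C] (n : ℕ) (X : C)
    [hX : HasInjectiveDimensionLT X n] : HasInjectiveDimensionLT (G.obj X) n := by
  have key : ∀ (n : ℕ) (X : C), HasInjectiveDimensionLT X (n + 1) →
      HasInjectiveDimensionLT (G.obj X) (n + 1) := by
    intro n
    induction n with
    | zero =>
      intro X hX
      have : Injective X := injective_iff_hasInjectiveDimensionLT_one.2 hX
      exact injective_iff_hasInjectiveDimensionLT_one.1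
        (Functor.PreservesInjectiveObjects.injective_obj this)
    | succ n ih =>
      intro X hX
      let I : InjectivePresentation X := Classical.arbitrary _
      let S := ShortComplex.mk _ _ (cokernel.condition I.f)
      have hS : S.ShortExact := { exact := ShortComplex.exact_cokernel I.f }
      have hI : Injective S.X₂ := I.injective
      have h3 := (hS.hasInjectiveDimensionLT_X₃_iff n hI).2 hX
      have : Injective (S.map G).X₂ := Functor.PreservesInjectiveObjects.injective_obj hI
      exact ((hS.map_of_exact G).hasInjectiveDimensionLT_X₃_iff n this).1 (ih _ h3)
  cases n with
  | zero =>
    have := isZero_of_hasInjectiveDimensionLT_zero X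
    exact (G.map_isZero this).hasInjectiveDimensionLT_zero
  | succ n => exact key n X hX

theorem ext_comp_square [HasExt.{w} C] {A B A' B' Z Z' : C} {m n l : ℕ} {x : Ext A B m}
    {x' : Ext A' B' m} {a : A ⟶ A'} {b : B ⟶ B'} {y : Ext B Z n} {y' : Ext B' Z' n} {z : Z ⟶ Z'}
    (hx : x.comp (Ext.mk₀ b) (add_zero m) = (Ext.mk₀ a).comp x' (zero_add m))
    (hy : y.comp (Ext.mk₀ z) (add_zero n) = (Ext.mk₀ b).comp y' (zero_add n)) (h : m + n = l) :
    (x.comp y h).comp (Ext.mk₀ z) (add_zero l) = (Ext.mk₀ a).comp (x'.comp y' h) (zero_add l) := by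
  rw [Ext.comp_assoc_of_third_deg_zero, hy, ← Ext.comp_assoc_of_second_deg_zero, hx,
    Ext.comp_assoc _ _ _ (zero_add m) h (by omega)]

theorem ext_comp_g_comp_extClass [HasExt.{w} C] {S : ShortComplex C} (hS : S.ShortExact) {M : C}
    {n m : ℕ} (e : Ext M S.X₂ n) (hm : n + 1 = m) :
    (e.comp (Ext.mk₀ S.g) (add_zero n)).comp hS.extClass hm = 0 := by
  rw [Ext.comp_assoc_of_second_deg_zero, ShortComplex.ShortExact.comp_extClass, Ext.comp_zero]

/-- By a projective presentation a class of degree n + 1 is the Yoneda product of an extension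
class, whose naturality is known, with a class of degree n. -/
theorem mapExactFunctor_naturality [HasExt.{w} C] [HasExt.{w} D] [EnoughProjectives C]
    {F G : C ⥤ D} [F.Additive] [PreservesFiniteLimits F] [PreservesFiniteColimits F]
    [G.Additive] [PreservesFiniteLimits G] [PreservesFiniteColimits G] (α : F ⟶ G) {n : ℕ}
    {X Y : C} (e : Ext X Y n) :
    (e.mapExactFunctor F).comp (Ext.mk₀ (α.app Y)) (add_zero n) =
      (Ext.mk₀ (α.app X)).comp (e.mapExactFunctor G) (zero_add n) := by
  induction n generalizing X with
  | zero =>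
    obtain ⟨f, rfl⟩ := (Ext.mk₀_bijective X Y).2 e
    simp [Ext.mapExactFunctor_mk₀]
  | succ n ih =>
    let P : ProjectivePresentation X := Classical.arbitrary _
    let S := ShortComplex.mk _ _ (kernel.condition P.f)
    have hS : S.ShortExact := { exact := ShortComplex.exact_kernel P.f }
    have : Projective S.X₂ := P.projective
    obtain ⟨e, rfl⟩ := Ext.contravariant_sequence_exact₃ hS Y e (Ext.eq_zero_of_projective _)
      (add_comm 1 n)
    have nat := ShortComplex.ShortExact.extClass_naturality (hS.map_of_exact F)
      (hS.map_of_exact G) (S.mapNatTrans α)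
    rw [Ext.mapExactFunctor_comp, Ext.mapExactFunctor_comp]
    refine ext_comp_square (b := α.app S.X₁) ?_ (ih e) (add_comm 1 n)
    rw [Ext.mapExactFunctor_extClass, Ext.mapExactFunctor_extClass]
    exact nat

/-- The comparison of `Ext` groups attached to an exact functor `R`, a natural transformation
`ev : G ⋙ R ⟶ H`, and a morphism `i : N ⟶ R.obj M`. -/
noncomputable def extComparison [HasExt.{w} D] [HasExt.{w} D'] (R : D ⥤ D') [R.Additive]
    [PreservesFiniteLimits R] [PreservesFiniteColimits R] {G : C ⥤ D} {H : C ⥤ D'}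
    (ev : G ⋙ R ⟶ H) {M : D} {N : D'} (i : N ⟶ R.obj M) (X : C) (n : ℕ) :
    Ext M (G.obj X) n →+ Ext N (H.obj X) n where
  toFun e := ((Ext.mk₀ i).comp (e.mapExactFunctor R) (zero_add n)).comp (Ext.mk₀ (ev.app X))
    (add_zero n)
  map_zero' := by simp
  map_add' := by simp

section Comparison

variable [HasExt.{w} D] [HasExt.{w} D'] (R : D ⥤ D') [R.Additive]
    [PreservesFiniteLimits R] [PreservesFiniteColimits R] {G : C ⥤ D} {H : C ⥤ D'}
    (ev : G ⋙ R ⟶ H) {M : D} {N : D'} (i : N ⟶ R.obj M)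

omit [Abelian C] in
theorem extComparison_apply (X : C) {n : ℕ} (e : Ext M (G.obj X) n) :
    extComparison R ev i X n e = ((Ext.mk₀ i).comp (e.mapExactFunctor R) (zero_add n)).comp
      (Ext.mk₀ (ev.app X)) (add_zero n) := rfl

omit [Abelian C] in
theorem extComparison_mk₀_comp {X Y : C} {n : ℕ} (e : Ext M (G.obj X) n) (f : X ⟶ Y) :
    extComparison R ev i Y n (e.comp (Ext.mk₀ (G.map f)) (add_zero n)) =
      (extComparison R ev i X n e).comp (Ext.mk₀ (H.map f)) (add_zero n) := by
  simp only [extComparison_apply, Ext.mapExactFunctor_comp, Ext.mapExactFunctor_mk₀,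
    Ext.comp_assoc_of_third_deg_zero, Ext.mk₀_comp_mk₀]
  congr 3
  exact ev.naturality f

variable [G.Additive] [PreservesFiniteLimits G] [PreservesFiniteColimits G]
  [H.Additive] [PreservesFiniteLimits H] [PreservesFiniteColimits H]

theorem extComparison_comp_extClass {S : ShortComplex C} (hS : S.ShortExact) {n m : ℕ}
    (hm : n + 1 = m) (e : Ext M (G.obj S.X₃) n) :
    extComparison R ev i S.X₁ m (e.comp (hS.map_of_exact G).extClass hm) =
      (extComparison R ev i S.X₃ n e).comp (hS.map_of_exact H).extClass hm := by
  let φ : (S.map G).map R ⟶ S.map H :=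
    { τ₁ := ev.app _
      τ₂ := ev.app _
      τ₃ := ev.app _
      comm₁₂ := (ev.naturality S.f).symm
      comm₂₃ := (ev.naturality S.g).symm }
  have nat := ShortComplex.ShortExact.extClass_naturality
    ((hS.map_of_exact G).map_of_exact R) (hS.map_of_exact H) φ
  have h1 : Ext.mapExactFunctor R (Ext.comp e (hS.map_of_exact G).extClass hm) =
      (e.mapExactFunctor R).comp ((hS.map_of_exact G).map_of_exact R).extClass hm :=
    (Ext.mapExactFunctor_comp R _ _ hm).trans (congrArg (fun x ↦ Ext.comp _ x hm)
      (Ext.mapExactFunctor_extClass R (hS.map_of_exact G)))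
  refine (congrArg (fun x ↦ ((Ext.mk₀ i).comp x (zero_add m)).comp _ (add_zero m)) h1).trans ?_
  generalize ((hS.map_of_exact G).map_of_exact R).extClass = x at nat
  generalize (hS.map_of_exact H).extClass = x' at nat ⊢
  have assoc {A B A' B' : D'} (x : Ext A B 1) (x' : Ext A' B' 1) (a : A ⟶ A') (b : B ⟶ B')
      (y : Ext N A n)
      (hx : x.comp (Ext.mk₀ b) (add_zero 1) = (Ext.mk₀ a).comp x' (zero_add 1)) :
      (y.comp x hm).comp (Ext.mk₀ b) (add_zero m) =
        (y.comp (Ext.mk₀ a) (add_zero n)).comp x' hm := by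
    rw [Ext.comp_assoc_of_third_deg_zero, hx, Ext.comp_assoc_of_second_deg_zero]
  refine Eq.trans ?_ (assoc x x' φ.τ₃ φ.τ₁ ((Ext.mk₀ i).comp (e.mapExactFunctor R) (zero_add n))
    nat)
  exact congrArg (fun y ↦ Ext.comp y (Ext.mk₀ φ.τ₁) (add_zero m))
    (Ext.comp_assoc (Ext.mk₀ i) (e.mapExactFunctor R) x (zero_add n) hm (by omega)).symm

/-- Comparison of two effaceable cohomological functors. -/
theorem extComparison_bijective [EnoughInjectives C] [G.PreservesInjectiveObjects]
    [H.PreservesInjectiveObjects]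
    (h0 : ∀ X, Function.Bijective fun f : M ⟶ G.obj X ↦ i ≫ R.map f ≫ ev.app X) (n : ℕ) (X : C) :
    Function.Bijective (extComparison R ev i X n) := by
  induction n generalizing X with
  | zero =>
    have e : extComparison R ev i X 0 ∘ Ext.mk₀ = Ext.mk₀ ∘ fun f ↦ i ≫ R.map f ≫ ev.app X := by
      ext f
      simp [extComparison_apply, Ext.mapExactFunctor_mk₀]
    have h1 := (Ext.mk₀_bijective _ _).comp (h0 X)
    rw [← e] at h1
    exact (Function.Bijective.of_comp_iff _ (Ext.mk₀_bijective _ _)).1 h1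
  | succ n ih =>
    let I : InjectivePresentation X := Classical.arbitrary _
    let S := ShortComplex.mk _ _ (cokernel.condition I.f)
    have hS : S.ShortExact := { exact := ShortComplex.exact_cokernel I.f }
    have hG : Injective (S.map G).X₂ := Functor.PreservesInjectiveObjects.injective_obj I.injective
    have hH : Injective (S.map H).X₂ := Functor.PreservesInjectiveObjects.injective_obj I.injective
    constructor
    · refine (injective_iff_map_eq_zero _).2 fun e he ↦ ?_
      obtain ⟨e, rfl⟩ := Ext.covariant_sequence_exact₁ M (hS.map_of_exact G) e
        (Ext.eq_zero_of_injective _) rfl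
      -- A class killed by the connecting map lifts to the middle term; by induction the lift comes
      -- from the source group, so the original class is a product of consecutive maps of the
      -- sequence.
      have := (extComparison_comp_extClass R ev i hS rfl e).symm.trans he
      obtain ⟨e₂, he₂⟩ := Ext.covariant_sequence_exact₃ N (hS.map_of_exact H) _ rfl this
      obtain ⟨e₂, rfl⟩ := (ih S.X₂).2 e₂
      have h1 := (extComparison_mk₀_comp R ev i e₂ S.g).trans he₂
      rw [← (ih S.X₃).1 h1]
      exact ext_comp_g_comp_extClass (hS.map_of_exact G) e₂ rfl
    · intro e
      obtain ⟨e, rfl⟩ := Ext.covariant_sequence_exact₁ N (hS.map_of_exact H) e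
        (Ext.eq_zero_of_injective _) rfl
      obtain ⟨e, rfl⟩ := (ih S.X₃).2 e
      exact ⟨_, extComparison_comp_extClass R ev i hS rfl e⟩

end Comparison

end ExactFunctors

/-! ### `Ext` of finitely generated modules over a noetherian ring -/

section FiniteSupport

open Abelian

variable {R : Type u} [Ring R] [IsNoetherianRing R]

/-- In degree 0 it suffices to treat the finitely many values on generators. Higher degrees follow
by shifting along a finite free cover, whose kernel is again finitely generated as R is noetherian.
-/
theorem eventually_ext_comp_eq_zero {J : Type*} (l : Filter J) {X : ModuleCat.{u} R}
    {Y : J → ModuleCat.{u} R} (π : ∀ j, X ⟶ Y j) (hπ : ∀ x : X, ∀ᶠ j in l, (π j) x = 0) {n : ℕ}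
    {M : ModuleCat.{u} R} [hM : Module.Finite R M] (ξ : Ext M X n) :
    ∀ᶠ j in l, ξ.comp (Ext.mk₀ (π j)) (add_zero n) = 0 := by
  induction n generalizing M with
  | zero =>
    obtain ⟨f, rfl⟩ := (Ext.mk₀_bijective M X).2 ξ
    obtain ⟨s, hs⟩ := hM.fg_top
    have := (Filter.eventually_all_finset s).2 fun m _ ↦ hπ (f m)
    filter_upwards [this] with j hj
    have : f ≫ π j = 0 := by
      ext m
      have hm : m ∈ Submodule.span R (s : Set M) := hs ▸ Submodule.mem_top
      induction hm using Submodule.span_induction with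
      | mem m hm => exact hj m hm
      | zero => simp
      | add x y _ _ hx hy => rw [map_add, hx, hy, map_add]
      | smul r x _ hx => rw [map_smul, hx, map_smul]
    rw [Ext.mk₀_comp_mk₀, this, Ext.mk₀_zero]
  | succ n ih =>
    obtain ⟨d, f, hf⟩ := Module.Finite.exists_fin' R M
    have hS := f.shortExact_shortComplexKer hf
    have : Projective (f.shortComplexKer).X₂ := by
      change Projective (ModuleCat.of R (Fin d → R))
      infer_instance
    obtain ⟨ξ', rfl⟩ := Ext.contravariant_sequence_exact₃ hS X ξ (Ext.eq_zero_of_projective _)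
      (add_comm 1 n)
    have : Module.Finite R f.shortComplexKer.X₁ := by
      change Module.Finite R f.ker
      infer_instance
    filter_upwards [ih ξ'] with j hj
    rw [Ext.comp_assoc_of_third_deg_zero, hj, Ext.comp_zero]

end FiniteSupport

end HomTr

namespace HomTr

/-! ### Restriction and coextension of scalars -/

section ChangeOfRings

open Limits

variable {A B : Type u} [Ring A] [Ring B] (f : A →+* B)

theorem restrictScalars_map_exact (S : ShortComplex (ModuleCat.{u} B)) (h : S.Exact) :
    (S.map (ModuleCat.restrictScalars.{u} f)).Exact := by
  rw [ShortComplex.ShortExact.moduleCat_exact_iff_function_exact] at h ⊢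
  exact h

instance : PreservesFiniteLimits (ModuleCat.restrictScalars.{u} f) :=
  (((Functor.exact_tfae (ModuleCat.restrictScalars.{u} f)).out 1 3 rfl rfl).mp
    (restrictScalars_map_exact f)).1

instance : PreservesFiniteColimits (ModuleCat.restrictScalars.{u} f) :=
  (((Functor.exact_tfae (ModuleCat.restrictScalars.{u} f)).out 1 3 rfl rfl).mp
    (restrictScalars_map_exact f)).2

instance : (ModuleCat.coextendScalars.{u, u, u} f).Additive where
  map_add := rfl

instance : (ModuleCat.coextendScalars.{u, u, u} f).PreservesInjectiveObjects :=
  Functor.preservesInjectiveObjects_of_adjunction_of_preservesMonomorphisms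
    (ModuleCat.restrictCoextendScalarsAdj.{u, u, u} f)

/-- `B` is projective as a left `A`-module. -/
def IsLeftProjective : Prop :=
  Module.Projective A ((ModuleCat.restrictScalars.{u} f).obj (ModuleCat.of B B))

variable {f} in
-- Coextension is Hom from B over A, and B is projective.
theorem coextendScalars_map_exact (hf : IsLeftProjective f) (S : ShortComplex (ModuleCat.{u} A))
    (h : S.Exact) : (S.map (ModuleCat.coextendScalars.{u, u, u} f)).Exact := by
  rw [ShortComplex.ShortExact.moduleCat_exact_iff_function_exact] at h ⊢
  intro φ
  constructor
  · intro hφ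
    have hφ' (b : B) : S.g ((ModuleCat.CoextendScalars.equiv f S.X₂ φ) b) = 0 :=
      LinearMap.congr_fun (congrArg (ModuleCat.CoextendScalars.equiv f S.X₃) hφ) b
    let g : S.X₁ →ₗ[A] LinearMap.ker S.g.hom := S.f.hom.codRestrict _ fun x ↦ (h _).2 ⟨x, rfl⟩
    have hg : Function.Surjective g := fun ⟨y, hy⟩ ↦ by
      obtain ⟨x, rfl⟩ := (h y).1 hy
      exact ⟨x, rfl⟩
    obtain ⟨l, hl⟩ := @Module.projective_lifting_property _ _ _ _ _ _ _ _ _ _ _ hf g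
      ((ModuleCat.CoextendScalars.equiv f S.X₂ φ).codRestrict (LinearMap.ker S.g.hom) hφ') hg
    refine ⟨(ModuleCat.CoextendScalars.equiv f S.X₁).symm l, ModuleCat.CoextendScalars.ext ?_⟩
    ext b
    exact congrArg Subtype.val (LinearMap.congr_fun hl b)
  · rintro ⟨φ, rfl⟩
    refine ModuleCat.CoextendScalars.ext (LinearMap.ext fun b ↦ ?_)
    exact (h _).2 ⟨_, rfl⟩

variable {f} in
theorem IsLeftProjective.preserves (hf : IsLeftProjective f) :
    PreservesFiniteLimits (ModuleCat.coextendScalars.{u, u, u} f) ∧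
      PreservesFiniteColimits (ModuleCat.coextendScalars.{u, u, u} f) :=
  ((Functor.exact_tfae (ModuleCat.coextendScalars.{u, u, u} f)).out 1 3 rfl rfl).mp
    (coextendScalars_map_exact hf)

/-- The right `A`-module `B / N` is locally projective: finite subsets have dual bases. -/
def HasLocalDualBasis (N : Ideal B) : Prop :=
  ∀ s : Finset B, ∃ (J : Type) (_ : Fintype J) (e : J → B) (ψ : J → B →+ A),
    (∀ i b a, ψ i (b * f a) = ψ i b * a) ∧ (∀ i, ∀ b ∈ N, ψ i b = 0) ∧
      ∀ b ∈ s, b - ∑ i, e i * f (ψ i b) ∈ N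

variable {f} in
/-- The annihilator of `N` in an injective `B`-module is injective over `A`. -/
theorem HasLocalDualBasis.injective {N : Ideal B} (hN : HasLocalDualBasis f N) {X I : Type u}
    [AddCommGroup X] [Module B X] [AddCommGroup I] [Module B I] [Module A X]
    (hX : ∀ (a : A) (x : X), a • x = f a • x) [hI : Module.Injective B I] (κ : X →ₗ[B] I)
    (hκ : Function.Injective κ) (hκN : ∀ y : I, (∀ b ∈ N, b • y = 0) → y ∈ LinearMap.range κ)
    (hNX : ∀ b ∈ N, ∀ x : X, b • x = 0) : Module.Injective A X := by
  refine Module.Baer.injective fun J g ↦ ?_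
  let Φ : (J →₀ B) →ₗ[B] B ⧸ N :=
    N.mkQ ∘ₗ Finsupp.linearCombination B fun j : J ↦ f (j : A)
  let Γ : (J →₀ B) →ₗ[B] X := Finsupp.linearCombination B fun j : J ↦ g j
  -- The dual basis does the work of flatness: a relation ∑ bⱼ f(j) ∈ N becomes, under each ψᵢ, a
  -- relation ∑ ψᵢ(bⱼ) j = 0 in the ideal, to which g applies.
  have hker : LinearMap.ker Φ ≤ LinearMap.ker Γ := by
    intro v hv
    have hv : v.sum (fun j b ↦ b * f (j : A)) ∈ N := by
      rw [LinearMap.mem_ker] at hv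
      exact (Submodule.Quotient.mk_eq_zero N).1 hv
    classical
    obtain ⟨_, _, e, ψ, h1, h2, h3⟩ := hN (v.support.image v)
    have h4 (j : J) (hj : j ∈ v.support) : v j • g j = ∑ i, e i • g (ψ i (v j) • j) := by
      have := hNX _ (h3 _ (Finset.mem_image_of_mem v hj)) (g j)
      rw [sub_smul, sub_eq_zero] at this
      rw [this, Finset.sum_smul]
      refine Finset.sum_congr rfl fun i _ ↦ ?_
      rw [mul_smul, map_smul, hX]
    rw [LinearMap.mem_ker]
    change v.sum (fun j b ↦ b • g j) = 0
    rw [Finsupp.sum, Finset.sum_congr rfl h4, Finset.sum_comm]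
    refine Finset.sum_eq_zero fun i _ ↦ ?_
    rw [← Finset.smul_sum, ← map_sum]
    have h5 : ∑ j ∈ v.support, ψ i (v j) • j = 0 := by
      refine Subtype.ext ?_
      have := h2 i _ hv
      rw [Finsupp.sum, map_sum, Finset.sum_congr rfl fun j _ ↦ h1 i (v j) j] at this
      simpa using this
    rw [h5, map_zero, smul_zero]
  let Φ' : ((J →₀ B) ⧸ LinearMap.ker Φ) →ₗ[B] B ⧸ N := (LinearMap.ker Φ).liftQ Φ le_rfl
  have hΦ' : Function.Injective Φ' := LinearMap.ker_eq_bot.1 (Submodule.ker_liftQ_eq_bot' _ _ rfl)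
  obtain ⟨l, hl⟩ := hI.out Φ' hΦ' (κ ∘ₗ (LinearMap.ker Φ).liftQ Γ hker)
  -- The class of 1 in B / N is killed by N, so its image lies in X; it is the element required by
  -- Baer's criterion.
  obtain ⟨x, hx⟩ := hκN (l (N.mkQ 1)) fun b hb ↦ by
    rw [← map_smul, ← map_smul, smul_eq_mul, mul_one, Submodule.mkQ_apply,
      (Submodule.Quotient.mk_eq_zero N).2 hb, map_zero]
  refine ⟨LinearMap.toSpanSingleton A X x, fun a ha ↦ hκ ?_⟩
  rw [LinearMap.toSpanSingleton_apply, hX, map_smul, hx, ← map_smul, ← map_smul, smul_eq_mul,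
    mul_one]
  have := hl ((LinearMap.ker Φ).mkQ (Finsupp.single ⟨a, ha⟩ 1))
  have e1 : Φ' ((LinearMap.ker Φ).mkQ (Finsupp.single ⟨a, ha⟩ 1)) = N.mkQ (f a) := by
    rw [Submodule.mkQ_apply, Submodule.liftQ_apply]
    simp [Φ]
  rw [e1] at this
  rw [this, LinearMap.comp_apply, Submodule.mkQ_apply, Submodule.liftQ_apply]
  simp [Γ]

variable {f} in
theorem HasLocalDualBasis.preservesInjectiveObjects (hf : HasLocalDualBasis f ⊥) :
    (ModuleCat.restrictScalars.{u} f).PreservesInjectiveObjects where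
  injective_obj {I} hI := by
    have : Module.Injective B I := Module.injective_module_of_injective_object B I
    let _ : Module A I := Module.compHom I f
    have : Module.Injective A I :=
      hf.injective (X := I) (I := I) (fun _ _ ↦ rfl) LinearMap.id Function.injective_id
        (fun y _ ↦ ⟨y, rfl⟩) (fun b hb x ↦ by rw [(Submodule.mem_bot B).1 hb, zero_smul])
    exact Module.injective_object_of_injective_module A I

end ChangeOfRings

/-! ### Modules over a ring of skew fractions -/

/-- The unit `t` of `B` normalises the image of `A`, and an `A`-linear map from `B` to a `B`-module
is a derivation twisted by `t` of some `A`-linear map, which is unique up to `B`-linear ones. -/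
structure IsSkewExtension {A B : Type u} [Ring A] [Ring B] (f : A →+* B) (σ : A ≃+* A)
    (t : Bˣ) : Prop where
  comm : ∀ a, t * f a = f (σ a) * t
  exists_twisted : ∀ (X : Type u) [AddCommGroup X] [Module B X] (ψ : B →+ X),
    (∀ a b, ψ (f a * b) = f a • ψ b) →
      ∃ φ : B →+ X, (∀ a b, φ (f a * b) = f a • φ b) ∧ ∀ b, φ (t * b) = (t : B) • (φ b + ψ b)
  linear_of_commute : ∀ (X : Type u) [AddCommGroup X] [Module B X] (φ : B →+ X),
    (∀ a b, φ (f a * b) = f a • φ b) → (∀ b, φ (t * b) = (t : B) • φ b) → ∀ b, φ b = b • φ 1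

namespace IsSkewExtension

variable {A B : Type u} [Ring A] [Ring B] {f : A →+* B} {σ : A ≃+* A} {t : Bˣ}

/-- Coextension to `B` of the restriction to `A`. -/
noncomputable abbrev coind (f : A →+* B) (X : ModuleCat.{u} B) : ModuleCat.{u} B :=
  (ModuleCat.coextendScalars.{u, u, u} f).obj ((ModuleCat.restrictScalars.{u} f).obj X)

/-- The element of `coind f X` given by a map. -/
noncomputable def coindMk (X : ModuleCat.{u} B) (φ : B →+ X)
    (hφ : ∀ a b, φ (f a * b) = f a • φ b) : coind f X :=
  (ModuleCat.CoextendScalars.equiv f ((ModuleCat.restrictScalars.{u} f).obj X)).symm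
    { toFun := φ
      map_add' := map_add φ
      map_smul' := hφ }

theorem coind_map_add {X : ModuleCat.{u} A} (φ : (ModuleCat.coextendScalars.{u, u, u} f).obj X)
    (b c : B) : φ (b + c) = φ b + φ c :=
  map_add (ModuleCat.CoextendScalars.equiv f X φ) b c

theorem coind_map_mul {X : ModuleCat.{u} A} (φ : (ModuleCat.coextendScalars.{u, u, u} f).obj X)
    (a : A) (b : B) : φ (f a * b) = a • φ b :=
  (ModuleCat.CoextendScalars.equiv f X φ).map_smul a b

theorem coind_ext {X : ModuleCat.{u} A} {φ ψ : (ModuleCat.coextendScalars.{u, u, u} f).obj X}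
    (h : ∀ b : B, φ b = ψ b) : φ = ψ :=
  ModuleCat.CoextendScalars.ext (LinearMap.ext h)

/-- The additive map underlying an element of `coind f X`. -/
noncomputable def coindHom (X : ModuleCat.{u} B) (φ : coind f X) : B →+ X where
  toFun b := φ b
  map_zero' := map_zero (ModuleCat.CoextendScalars.equiv f _ φ)
  map_add' := coind_map_add φ

/-- The twist `φ ↦ t⁻¹ ∘ φ ∘ t` of `coind f X`. -/
noncomputable def twist (h : IsSkewExtension f σ t) (X : ModuleCat.{u} B) :
    coind f X ⟶ coind f X :=
  ModuleCat.ofHom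
    { toFun := fun φ ↦ coindMk X
        { toFun := fun b ↦ (↑t⁻¹ : B) • coindHom X φ (t * b)
          map_zero' := by simp
          map_add' := fun b c ↦ by rw [mul_add, map_add, smul_add] }
        (fun a b ↦ by
          change (↑t⁻¹ : B) • coindHom X φ (t * (f a * b)) =
            f a • (↑t⁻¹ : B) • coindHom X φ (t * b)
          rw [← mul_assoc, h.comm, mul_assoc]
          have e : coindHom X φ (f (σ a) * (t * b)) = f (σ a) • coindHom X φ (t * b) :=
            coind_map_mul φ (σ a) (t * b)
          rw [e, ← mul_smul, ← mul_smul]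
          congr 1
          rw [Units.inv_mul_eq_iff_eq_mul, ← mul_assoc, h.comm, Units.mul_inv_cancel_right])
      map_add' := fun φ ψ ↦ coind_ext fun b ↦ smul_add (↑t⁻¹ : B) _ _
      map_smul' := fun c φ ↦ coind_ext fun b ↦ by
        change (↑t⁻¹ : B) • coindHom X φ (t * b * c) = (↑t⁻¹ : B) • coindHom X φ (t * (b * c))
        rw [mul_assoc] }

/-- The embedding of a module in its coinduced module. -/
noncomputable def toCoind (f : A →+* B) (X : ModuleCat.{u} B) : X ⟶ coind f X :=
  (ModuleCat.restrictCoextendScalarsAdj.{u, u, u} f).unit.app X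

/-- The two-term resolution of a `B`-module by coinduced modules. -/
noncomputable def resolution (h : IsSkewExtension f σ t) (X : ModuleCat.{u} B) :
    ShortComplex (ModuleCat.{u} B) :=
  ShortComplex.mk (toCoind f X) (h.twist X - 𝟙 _) (by
    refine ModuleCat.hom_ext (LinearMap.ext fun x ↦ coind_ext fun b ↦ ?_)
    change (↑t⁻¹ : B) • (t * b) • x - b • x = 0
    rw [mul_smul, ← mul_smul, Units.inv_mul, one_smul, sub_self])

/-- A map fixed by the twist commutes with t, hence is multiplication on an element of X. Preimages
of ψ are the solutions of the twisted derivation equation, which becomes t⁻¹φ(tb) − φ(b) = ψ(b). -/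
theorem resolution_shortExact (h : IsSkewExtension f σ t) (X : ModuleCat.{u} B) :
    (h.resolution X).ShortExact := by
  refine ModuleCat.shortComplex_shortExact _ (fun φ ↦ ⟨fun hφ ↦ ?_, ?_⟩) (fun x y hxy ↦ ?_)
    fun ψ ↦ ?_
  · refine ⟨coindHom X φ 1, coind_ext fun b ↦ ?_⟩
    refine (h.linear_of_commute X (coindHom X φ) (fun a b ↦ coind_map_mul φ a b) (fun b ↦ ?_)
      b).symm
    have h1 : (↑t⁻¹ : B) • coindHom X φ (t * b) - coindHom X φ b = 0 :=
      congrArg (fun χ ↦ coindHom X χ b) hφ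
    rw [sub_eq_zero] at h1
    rw [← h1, ← mul_smul, Units.mul_inv, one_smul]
  · rintro ⟨x, rfl⟩
    have := (h.resolution X).zero
    exact congrArg (fun g ↦ g.hom x) this
  · have h1 : (1 : B) • x = (1 : B) • y := congrArg (fun χ ↦ coindHom X χ 1) hxy
    simpa using h1
  · obtain ⟨φ, h1, h2⟩ := h.exists_twisted X (coindHom X ψ) (fun a b ↦ coind_map_mul ψ a b)
    refine ⟨coindMk X φ h1, coind_ext fun b ↦ ?_⟩
    change (↑t⁻¹ : B) • φ (t * b) - φ b = coindHom X ψ b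
    rw [h2, ← mul_smul, Units.inv_mul, one_smul, add_sub_cancel_left]

/-- Coextension is exact and preserves injectives, so the two coinduced terms of the resolution
inherit the bound, and the kernel costs one more. -/
theorem hasInjectiveDimensionLT_succ (h : IsSkewExtension f σ t) (hf : IsLeftProjective f) {n : ℕ}
    (X : ModuleCat.{u} B)
    (hX : HasInjectiveDimensionLT ((ModuleCat.restrictScalars.{u} f).obj X) n) :
    HasInjectiveDimensionLT X (n + 1) := by
  have := hf.preserves.1
  have := hf.preserves.2
  have h1 := hasInjectiveDimensionLT_obj (ModuleCat.coextendScalars.{u, u, u} f) n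
    ((ModuleCat.restrictScalars.{u} f).obj X)
  exact (h.resolution_shortExact X).hasInjectiveDimensionLT_X₁ n h1
    (@hasInjectiveDimensionLT_of_ge _ _ _ _ n _ (Nat.le_succ n) h1)

end IsSkewExtension

end HomTr

namespace HomTr

/-! ### Projectivity and local dual bases of tensor products -/

section Tensor

variable {k : Type v} [Field k] {S S' Q Q' : Type u} [Ring S] [Algebra k S] [Ring Q] [Algebra k Q]
  [Ring S'] [Algebra k S'] [Ring Q'] [Algebra k Q']

/-- A splitting of the free cover by additive maps, without restricted module structures; in this
form splittings can be tensored over k. -/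
theorem isLeftProjective_iff {A B : Type u} [Ring A] [Ring B] (f : A →+* B) :
    IsLeftProjective f ↔ ∃ s : B →+ (B →₀ A), (∀ a b, s (f a * b) = a • s b) ∧
      ∀ b, (s b).sum (fun x a ↦ f a * x) = b := by
  let P := (ModuleCat.restrictScalars.{u} f).obj (ModuleCat.of B B)
  constructor
  · rintro ⟨s, hs⟩
    exact ⟨s.toAddMonoidHom, fun a b ↦ s.map_smul a b, hs⟩
  · rintro ⟨s, hs, hs'⟩
    exact ⟨{ toFun := s, map_add' := map_add s, map_smul' := hs }, hs'⟩

theorem isLeftProjective_of_isSemisimpleRing {A B : Type u} [Ring A] [Ring B] [IsSemisimpleRing A]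
    (f : A →+* B) : IsLeftProjective f :=
  Module.projective_of_isSemisimpleRing A _

theorem IsLeftProjective.comp {A B C : Type u} [Ring A] [Ring B] [Ring C] {f : A →+* B}
    {g : B →+* C} (hf : IsLeftProjective f) (hg : IsLeftProjective g) :
    IsLeftProjective (g.comp f) := by
  obtain ⟨s, hs, hs'⟩ := (isLeftProjective_iff _).1 hg
  let _ : Module A B := Module.compHom B f
  let _ : Module A C := Module.compHom C (g.comp f)
  have : Module.Projective A B := hf
  classical
  have : Module.Projective A (C →₀ B) := .of_equiv (finsuppLequivDFinsupp A (ι := C) (M := B)).symm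
  have smul_def (a : A) (b : B) : a • b = f a * b := rfl
  have smul_def' (a : A) (c : C) : a • c = g (f a) * c := rfl
  let i : C →ₗ[A] (C →₀ B) :=
    { toFun := s, map_add' := map_add s, map_smul' := fun a c ↦ hs (f a) c }
  let p : (C →₀ B) →ₗ[A] C := Finsupp.lsum ℕ fun c ↦
    { toFun := fun b ↦ g b * c
      map_add' := fun b b' ↦ by rw [map_add, add_mul]
      map_smul' := fun a b ↦ by
        rw [smul_def, map_mul, mul_assoc, RingHom.id_apply, smul_def'] }
  exact Module.Projective.of_split (P := C) (M := C →₀ B) i p (LinearMap.ext fun c ↦ hs' c)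

theorem IsLeftProjective.id {A : Type u} [Ring A] : IsLeftProjective (RingHom.id A) := by
  rw [isLeftProjective_iff]
  refine ⟨Finsupp.singleAddHom 1, fun a b ↦ by simp, fun b ↦ by simp⟩

/-- Two splittings are tensored, a tensor product of free modules being free on the product of the
index sets. -/
theorem IsLeftProjective.tensor {ι : S →ₐ[k] Q} {ι' : S' →ₐ[k] Q'}
    (h : IsLeftProjective (ι : S →+* Q)) (h' : IsLeftProjective (ι' : S' →+* Q')) :
    IsLeftProjective (Algebra.TensorProduct.map ι ι' : S ⊗[k] S' →+* Q ⊗[k] Q') := by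
  obtain ⟨s, hs, hs'⟩ := (isLeftProjective_iff _).1 h
  obtain ⟨r, hr, hr'⟩ := (isLeftProjective_iff _).1 h'
  have lin {S Q : Type u} [Ring S] [Algebra k S] [Ring Q] [Algebra k Q] {ι : S →ₐ[k] Q}
      {s : Q →+ (Q →₀ S)} (hs : ∀ a b, s ((ι : S →+* Q) a * b) = a • s b) (c : k) (q : Q) :
      s (c • q) = c • s q := by
    rw [Algebra.smul_def, ← ι.commutes]
    exact (hs _ _).trans (algebraMap_smul S c (s q))
  let sₗ : Q →ₗ[k] (Q →₀ S) := { s with map_smul' := lin hs }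
  let rₗ : Q' →ₗ[k] (Q' →₀ S') := { r with map_smul' := lin hr }
  let e := finsuppTensorFinsupp k k S S' Q Q'
  let i : Q ⊗[k] Q' →ₗ[k] (Q × Q' →₀ S ⊗[k] S') := e.toLinearMap ∘ₗ TensorProduct.map sₗ rₗ
  let P := (ModuleCat.restrictScalars.{u}
    (Algebra.TensorProduct.map ι ι' : S ⊗[k] S' →+* Q ⊗[k] Q')).obj (ModuleCat.of _ (Q ⊗[k] Q'))
  let p : (Q × Q' →₀ S ⊗[k] S') →ₗ[S ⊗[k] S'] P :=
    Finsupp.linearCombination (S ⊗[k] S') fun x ↦ (x.1 ⊗ₜ[k] x.2 : Q ⊗[k] Q')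
  have hi (a : S ⊗[k] S') (b : Q ⊗[k] Q') :
      i (Algebra.TensorProduct.map ι ι' a * b) = a • i b := by
    induction a using TensorProduct.induction_on with
    | zero => simp
    | add x y hx hy => rw [map_add, add_mul, map_add, hx, hy, add_smul]
    | tmul a a' =>
      induction b using TensorProduct.induction_on with
      | zero => simp
      | add x y hx hy => rw [mul_add, map_add, hx, hy, map_add, smul_add]
      | tmul q q' =>
        refine Finsupp.ext fun ⟨x, x'⟩ ↦ ?_
        have h1 : s (ι a * q) = a • s q := hs a q
        have h2 : r (ι' a' * q') = a' • r q' := hr a' q'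
        rw [Algebra.TensorProduct.map_tmul, Algebra.TensorProduct.tmul_mul_tmul,
          Finsupp.smul_apply, smul_eq_mul]
        change e (s (ι a * q) ⊗ₜ r (ι' a' * q')) (x, x') = (a ⊗ₜ a') * e (s q ⊗ₜ r q') (x, x')
        rw [h1, h2, finsuppTensorFinsupp_apply, finsuppTensorFinsupp_apply]
        simp
  have hp (x : Q →₀ S) (y : Q' →₀ S') : p (e (x ⊗ₜ y)) =
      (x.sum fun q a ↦ ι a * q) ⊗ₜ[k] (y.sum fun q a ↦ ι' a * q) := by
    induction x using Finsupp.induction_linear with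
    | zero => simp; rfl
    | add x₁ x₂ h₁ h₂ =>
      rw [add_tmul, map_add, map_add, h₁, h₂, Finsupp.sum_add_index' (by simp)
        (by simp [add_mul]), add_tmul]
      rfl
    | single q a =>
      induction y using Finsupp.induction_linear with
      | zero => simp; rfl
      | add x₁ x₂ h₁ h₂ =>
        rw [tmul_add, map_add, map_add, h₁, h₂, Finsupp.sum_add_index' (by simp)
          (by simp [add_mul]), tmul_add]
        rfl
      | single q' a' =>
        rw [finsuppTensorFinsupp_single, Finsupp.sum_single_index (by simp),
          Finsupp.sum_single_index (by simp)]
        refine (Finsupp.linearCombination_single ..).trans ?_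
        exact Algebra.TensorProduct.tmul_mul_tmul (ι a) (q : Q) (ι' a') q'
  refine Module.Projective.of_split (P := P) (M := Q × Q' →₀ S ⊗[k] S')
    { toFun := i, map_add' := map_add i, map_smul' := hi } p (LinearMap.ext fun b ↦ ?_)
  change p (i b) = b
  suffices ∀ b : Q ⊗[k] Q', (p (i b) : Q ⊗[k] Q') = b from this b
  intro b
  induction b using TensorProduct.induction_on with
  | zero => simp; rfl
  | add x y hx hy =>
    rw [map_add, map_add]
    exact congrArg₂ (· + ·) hx hy
  | tmul q q' => exact (hp (s q) (r q')).trans (congrArg₂ _ (hs' q) (hr' q'))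

theorem HasLocalDualBasis.id {A : Type u} [Ring A] : HasLocalDualBasis (RingHom.id A) ⊥ :=
  fun _ ↦ ⟨Unit, inferInstance, fun _ ↦ 1, fun _ ↦ AddMonoidHom.id A, fun _ _ _ ↦ rfl,
    fun _ b hb ↦ hb, fun b _ ↦ by simp⟩

/-- Finitely many tensors involve finitely many entries, so an identity for a k-linear operator on
them can be tested on pure tensors of those entries. -/
theorem exists_finset_tensor (s : Finset (Q ⊗[k] Q')) : ∃ (s₁ : Finset Q) (s₂ : Finset Q'),
    ∀ L : Q ⊗[k] Q' →ₗ[k] Q ⊗[k] Q', (∀ q ∈ s₁, ∀ q' ∈ s₂, L (q ⊗ₜ q') = q ⊗ₜ q') →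
      ∀ b ∈ s, L b = b := by
  classical
  have key (b : Q ⊗[k] Q') : ∃ (s₁ : Finset Q) (s₂ : Finset Q'),
    ∀ L : Q ⊗[k] Q' →ₗ[k] Q ⊗[k] Q', (∀ q ∈ s₁, ∀ q' ∈ s₂, L (q ⊗ₜ q') = q ⊗ₜ q') → L b = b := by
    induction b using TensorProduct.induction_on with
    | zero => exact ⟨∅, ∅, fun L _ ↦ map_zero L⟩
    | tmul q q' => exact ⟨{q}, {q'}, fun L hL ↦ hL q (by simp) q' (by simp)⟩
    | add x y hx hy =>
      obtain ⟨s₁, s₂, h⟩ := hx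
      obtain ⟨r₁, r₂, h'⟩ := hy
      refine ⟨s₁ ∪ r₁, s₂ ∪ r₂, fun L hL ↦ ?_⟩
      rw [map_add, h L fun q hq q' hq' ↦ hL q (Finset.mem_union_left _ hq) q'
        (Finset.mem_union_left _ hq'), h' L fun q hq q' hq' ↦ hL q (Finset.mem_union_right _ hq) q'
        (Finset.mem_union_right _ hq')]
  choose s₁ s₂ h using key
  exact ⟨s.biUnion s₁, s.biUnion s₂, fun L hL b hb ↦ h b L fun q hq q' hq' ↦
    hL q (Finset.mem_biUnion.2 ⟨b, hb, hq⟩) q' (Finset.mem_biUnion.2 ⟨b, hb, hq'⟩)⟩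

theorem HasLocalDualBasis.tensor {ι : S →ₐ[k] Q} {ι' : S' →ₐ[k] Q'}
    (h : HasLocalDualBasis (ι : S →+* Q) ⊥) (h' : HasLocalDualBasis (ι' : S' →+* Q') ⊥) :
    HasLocalDualBasis (Algebra.TensorProduct.map ι ι' : S ⊗[k] S' →+* Q ⊗[k] Q') ⊥ := by
  intro s
  obtain ⟨s₁, s₂, hs⟩ := exists_finset_tensor s
  obtain ⟨J, _, e, ψ, hψ, -, he⟩ := h s₁
  obtain ⟨J', _, e', ψ', hψ', -, he'⟩ := h' s₂
  have lin {S Q : Type u} [Ring S] [Algebra k S] [Ring Q] [Algebra k Q] {ι : S →ₐ[k] Q}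
      {ψ : Q →+ S} (hψ : ∀ b a, ψ (b * (ι : S →+* Q) a) = ψ b * a) (c : k) (q : Q) :
      ψ (c • q) = c • ψ q := by
    rw [Algebra.smul_def, Algebra.commutes, ← ι.commutes, Algebra.smul_def, Algebra.commutes c]
    exact hψ _ _
  let ψₗ (j : J) : Q →ₗ[k] S := { ψ j with map_smul' := lin (hψ j) }
  let ψₗ' (j : J') : Q' →ₗ[k] S' := { ψ' j with map_smul' := lin (hψ' j) }
  refine ⟨J × J', inferInstance, fun j ↦ e j.1 ⊗ₜ e' j.2,
    fun j ↦ (TensorProduct.map (ψₗ j.1) (ψₗ' j.2)).toAddMonoidHom,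
    fun j b a ↦ map_mul_tensor (fun q a ↦ hψ j.1 q a) (fun q a ↦ hψ' j.2 q a) b a,
    fun j b hb ↦ by rw [(Submodule.mem_bot _).1 hb, map_zero], fun b hb ↦ ?_⟩
  rw [Submodule.mem_bot, sub_eq_zero]
  let L : Q ⊗[k] Q' →ₗ[k] Q ⊗[k] Q' := ∑ j : J × J', LinearMap.mulLeft k (e j.1 ⊗ₜ e' j.2) ∘ₗ
    (Algebra.TensorProduct.map ι ι').toLinearMap ∘ₗ TensorProduct.map (ψₗ j.1) (ψₗ' j.2)
  have hL := hs L (fun q hq q' hq' ↦ ?_) b hb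
  · refine hL.symm.trans ?_
    rw [LinearMap.sum_apply]
    rfl
  · have h1 := he q hq
    have h2 := he' q' hq'
    rw [Submodule.mem_bot, sub_eq_zero] at h1 h2
    conv_rhs => rw [h1, h2]
    rw [LinearMap.sum_apply, Fintype.sum_prod_type, sum_tmul]
    refine Finset.sum_congr rfl fun j _ ↦ ?_
    rw [tmul_sum]
    exact Finset.sum_congr rfl fun j' _ ↦ Algebra.TensorProduct.tmul_mul_tmul ..

end Tensor

/-! ### Local dual bases of skew fractions. -/

section Fractions

variable {k : Type v} [Field k] {S Q : Type u} [Ring S] [Algebra k S] [Ring Q] [Algebra k Q]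
variable {σ : S ≃ₐ[k] S} {ι : S →ₐ[k] Q} {t : Q}

namespace IsSkewFractionRing

theorem coeffZero_inv_pow (h : IsSkewFractionRing σ ι t) {t' : Q} (ht : t * t' = 1) {i : ℕ}
    (hi : 0 < i) : h.coeffZero (t' ^ i) = 0 := by
  refine h.coeffZero_eq (d := 0) (r := 0) (zero_mem _) ⟨i, t ^ i, isMonicPoly_pow i, ?_⟩
  rw [map_zero, mul_zero, sub_zero, sub_zero, pow_mul_pow_eq_one i ht]
  simpa using pow_mem_polyLT (ι := ι) (t := t) hi

theorem coeffZero_inv_pow_mul_pow (h : IsSkewFractionRing σ ι t) {t' : Q} (ht : t * t' = 1)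
    (ht' : t' * t = 1) (i j : ℕ) : h.coeffZero (t' ^ i * t ^ j) = if i = j then 1 else 0 := by
  rcases lt_trichotomy i j with hij | rfl | hij
  · obtain ⟨l, rfl⟩ := Nat.exists_eq_add_of_lt hij
    rw [if_neg hij.ne, add_assoc, pow_add, ← mul_assoc, pow_mul_pow_eq_one i ht', one_mul,
      h.coeffZero_pow (by omega)]
  · rw [if_pos rfl, pow_mul_pow_eq_one i ht', h.coeffZero_one]
  · obtain ⟨l, rfl⟩ := Nat.exists_eq_add_of_lt hij
    rw [if_neg hij.ne', add_assoc, add_comm, pow_add, mul_assoc, pow_mul_pow_eq_one j ht', mul_one,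
      h.coeffZero_inv_pow ht (by omega)]

/-- Multiplication by t⁻ʲ moves the right-hand coefficient of tʲ into degree 0, where the constant
coefficient reads it off. -/
theorem sum_coeffZero (h : IsSkewFractionRing σ ι t) {t' : Q} (ht : t * t' = 1)
    (ht' : t' * t = 1) {d : ℕ} {p : Q} (hp : p ∈ polyLT ι t d) :
    ∑ j : Fin d, t ^ (j : ℕ) * ι (h.coeffZero (t' ^ (j : ℕ) * p)) = p := by
  induction hp using Submodule.span_induction with
  | mem p hp =>
    obtain ⟨i, hi, a, rfl⟩ := hp
    obtain ⟨a, rfl⟩ := (σ ^ i).surjective a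
    rw [← h.pow_mul, Finset.sum_eq_single ⟨i, hi⟩ (fun j _ hj ↦ ?_) (by simp), ← mul_assoc,
      h.coeffZero_mul_map, h.coeffZero_inv_pow_mul_pow ht ht', if_pos rfl, one_mul]
    rw [← mul_assoc, h.coeffZero_mul_map, h.coeffZero_inv_pow_mul_pow ht ht', if_neg, zero_mul,
      map_zero, mul_zero]
    exact fun e ↦ hj (Fin.ext e)
  | zero =>
    have : h.coeffZero 0 = 0 := map_zero h.coeffZeroₗ
    simp [this]
  | add p q _ _ hp hq =>
    conv_rhs => rw [← hp, ← hq]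
    rw [← Finset.sum_add_distrib]
    simp only [mul_add, h.coeffZero_add, map_add]
  | smul c p _ hp =>
    conv_rhs => rw [← hp]
    rw [Finset.smul_sum]
    refine Finset.sum_congr rfl fun j _ ↦ ?_
    have : h.coeffZero (c • (t' ^ (j : ℕ) * p)) = c • h.coeffZero (t' ^ (j : ℕ) * p) :=
      map_smul h.coeffZeroₗ _ _
    rw [mul_smul_comm, this, map_smul, mul_smul_comm]

theorem exists_common_den (h : IsSkewFractionRing σ ι t) (s : Finset Q) :
    ∃ n m d, IsMonicPoly ι t n m ∧ ∀ q ∈ s, m * q ∈ polyLT ι t d := by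
  classical
  induction s using Finset.induction_on with
  | empty => exact ⟨0, 1, 0, isMonicPoly_one, by simp⟩
  | insert q s _ ih =>
    obtain ⟨n, m, d, hm, hd⟩ := ih
    obtain ⟨n', m', d', hm', hd'⟩ := h.left_den (m * q)
    refine ⟨n' + n, m' * m, n' + d + d', h.monic_mul hm' hm, fun p hp ↦ ?_⟩
    rw [mul_assoc]
    rcases Finset.mem_insert.1 hp with rfl | hp
    · exact polyLT_mono (by omega) hd'
    · exact h.mul_mem' hm'.mem (hd p hp) (by omega)

/-- After clearing a common monic denominator m, the given elements become polynomials of degree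
below d. The dual basis consists of the m⁻¹tʲ, with coordinates b ↦ coefficient of degree 0 of
t⁻ʲmb. -/
theorem hasLocalDualBasis (h : IsSkewFractionRing σ ι t) :
    HasLocalDualBasis (ι : S →+* Q) ⊥ := by
  intro s
  obtain ⟨n, m, d, hm, hd⟩ := h.exists_common_den s
  obtain ⟨m, rfl⟩ := h.isUnit_of_monic hm
  obtain ⟨u, rfl⟩ := h.isUnit_t
  refine ⟨Fin d, inferInstance, fun j ↦ ↑m⁻¹ * u ^ (j : ℕ), fun j ↦
    h.coeffZeroₗ.toAddMonoidHom.comp (AddMonoidHom.mulLeft ((↑u⁻¹ : Q) ^ (j : ℕ) * m)),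
    fun j b a ↦ ?_, fun j b hb ↦ by rw [(Submodule.mem_bot _).1 hb, map_zero], fun b hb ↦ ?_⟩
  · change h.coeffZero (_ * (b * ι a)) = _
    rw [← mul_assoc]
    exact h.coeffZero_mul_map _ a
  · rw [Submodule.mem_bot, sub_eq_zero]
    have := h.sum_coeffZero u.mul_inv u.inv_mul (hd b hb)
    rw [← Units.inv_mul_cancel_left m b]
    conv_lhs => rw [← this]
    rw [Units.inv_mul_cancel_left, Finset.mul_sum]
    refine Finset.sum_congr rfl fun j _ ↦ ?_
    rw [mul_assoc]
    exact congrArg (fun x ↦ (↑m⁻¹ : Q) * (↑u ^ (j : ℕ) * ι (h.coeffZero x))) (mul_assoc _ _ _).symm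

end IsSkewFractionRing

end Fractions

end HomTr

namespace HomTr

/-! ### Skew fractions tensored with an algebra U. -/

section

variable {k : Type v} [Field k] {S Q : Type u} [Ring S] [Algebra k S] [Ring Q] [Algebra k Q]
variable {σ : S ≃ₐ[k] S} {ι : S →ₐ[k] Q} {t : Q}

/-- The ring homomorphism from `S ⊗ U` to `Q ⊗ U`. -/
noncomputable abbrev baseHom (ι : S →ₐ[k] Q) (U : Type u) [Ring U] [Algebra k U] :
    S ⊗[k] U →+* Q ⊗[k] U :=
  (Algebra.TensorProduct.map ι (AlgHom.id k U) : S ⊗[k] U →ₐ[k] Q ⊗[k] U)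

variable (U : Type u) [Ring U] [Algebra k U]

theorem isLeftProjective_baseHom [IsSemisimpleRing S] (ι : S →ₐ[k] Q) :
    IsLeftProjective (baseHom ι U) :=
  (isLeftProjective_of_isSemisimpleRing (ι : S →+* Q)).tensor (ι' := AlgHom.id k U)
    IsLeftProjective.id

namespace IsSkewFractionRing

/-- The unit `t ⊗ 1`. -/
noncomputable def unitT (h : IsSkewFractionRing σ ι t) : (Q ⊗[k] U)ˣ :=
  Units.map ((Algebra.TensorProduct.includeLeftRingHom : Q →+* Q ⊗[k] U) : Q →* Q ⊗[k] U)
    h.isUnit_t.unit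

theorem coe_unitT (h : IsSkewFractionRing σ ι t) :
    (h.unitT U : Q ⊗[k] U) = t ⊗ₜ 1 := rfl

/-- Since 1 ⊗ U lies in the image of S ⊗ U, an admissible additive map on Q ⊗ U is determined by its
restriction to Q ⊗ 1. Both statements reduce to those for Q, and 1 ⊗ u commutes with t ⊗ 1. -/
theorem isSkewExtension (h : IsSkewFractionRing σ ι t) : IsSkewExtension (baseHom ι U)
    (Algebra.TensorProduct.congr σ (AlgEquiv.refl (A₁ := U))).toRingEquiv (h.unitT U) where
  comm a := (h.toIsSkewCommuting.tensor U).comm a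
  exists_twisted X _ _ ψ hψ := by
    let _ : Module Q X := Module.compHom X
      (Algebra.TensorProduct.includeLeftRingHom : Q →+* Q ⊗[k] U)
    have smul_def (q : Q) (x : X) : q • x = (q ⊗ₜ[k] (1 : U)) • x := rfl
    let ψ₀ : Q →+ X :=
      { toFun := fun q ↦ ψ (q ⊗ₜ 1)
        map_zero' := by simp
        map_add' := fun p q ↦ by rw [add_tmul, map_add] }
    obtain ⟨φ₀, h1, h2⟩ := h.exists_twisted_derivation ψ₀ fun a q ↦ by
      have := hψ (a ⊗ₜ 1) (q ⊗ₜ 1)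
      change ψ _ = _ • ψ _
      simpa [smul_def] using this
    let φ : Q ⊗[k] U →+ X := TensorProduct.liftAddHom
      { toFun := fun q ↦
          { toFun := fun u ↦ ((1 : Q) ⊗ₜ[k] u) • φ₀ q
            map_zero' := by simp
            map_add' := fun u u' ↦ by rw [tmul_add, add_smul] }
        map_zero' := by ext; simp
        map_add' := fun p q ↦ by ext; simp } fun c q u ↦ by
          change ((1 : Q) ⊗ₜ[k] u) • φ₀ (c • q) = ((1 : Q) ⊗ₜ[k] (c • u)) • φ₀ q
          rw [Algebra.smul_def, ← ι.commutes, h1, smul_def, ← mul_smul, ι.commutes,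
            Algebra.algebraMap_eq_smul_one]
          simp [smul_tmul']
    have hφ (q : Q) (u : U) : φ (q ⊗ₜ u) = ((1 : Q) ⊗ₜ[k] u) • φ₀ q := rfl
    refine ⟨φ, fun a b ↦ ?_, fun b ↦ ?_⟩
    · induction a using TensorProduct.induction_on with
      | zero => simp
      | add x y hx hy => rw [map_add, add_mul, map_add, hx, hy, add_smul]
      | tmul s u' =>
        induction b using TensorProduct.induction_on with
        | zero => simp
        | add x y hx hy => rw [mul_add, map_add, hx, hy, map_add, smul_add]
        | tmul q u =>
          have e : baseHom ι U (s ⊗ₜ u') = ι s ⊗ₜ u' := rfl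
          rw [e, Algebra.TensorProduct.tmul_mul_tmul, hφ, hφ, h1, smul_def, ← mul_smul, ← mul_smul]
          simp
    · rw [coe_unitT]
      induction b using TensorProduct.induction_on with
      | zero => simp
      | add x y hx hy =>
        rw [mul_add, map_add, hx, hy, map_add, map_add, ← smul_add]
        congr 1
        abel
      | tmul q u =>
        have e : ψ (q ⊗ₜ u) = ((1 : Q) ⊗ₜ[k] u) • ψ₀ q := by
          have := hψ (1 ⊗ₜ u) (q ⊗ₜ 1)
          change _ = _ • ψ _
          simpa using this
        rw [Algebra.TensorProduct.tmul_mul_tmul, hφ, hφ, h2, e, ← smul_add, smul_def, ← mul_smul,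
          ← mul_smul]
        simp
  linear_of_commute X _ _ φ h1 h2 b := by
    let _ : Module Q X := Module.compHom X
      (Algebra.TensorProduct.includeLeftRingHom : Q →+* Q ⊗[k] U)
    have smul_def (q : Q) (x : X) : q • x = (q ⊗ₜ[k] (1 : U)) • x := rfl
    let φ₀ : Q →+ X :=
      { toFun := fun q ↦ φ (q ⊗ₜ 1)
        map_zero' := by simp
        map_add' := fun p q ↦ by rw [add_tmul, map_add] }
    have key := h.map_mul_of_commute (φ := φ₀) (fun a q ↦ by
      have := h1 (a ⊗ₜ 1) (q ⊗ₜ 1)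
      change φ _ = _ • φ _
      simpa [smul_def] using this) (fun q ↦ by
      have := h2 (q ⊗ₜ 1)
      rw [coe_unitT, Algebra.TensorProduct.tmul_mul_tmul, mul_one] at this
      exact this)
    induction b using TensorProduct.induction_on with
    | zero => simp
    | add x y hx hy => rw [map_add, hx, hy, add_smul]
    | tmul q u =>
      have e : φ (q ⊗ₜ u) = ((1 : Q) ⊗ₜ[k] u) • φ₀ q := by
        have := h1 (1 ⊗ₜ u) (q ⊗ₜ 1)
        change _ = _ • φ _
        simpa using this
      rw [e, key, smul_def, ← mul_smul, Algebra.TensorProduct.tmul_mul_tmul, one_mul, mul_one]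
      rfl

end IsSkewFractionRing

end

/-! ### Injective dimension of projective modules over noetherian rings -/

section Bass

variable {A : Type u} [Ring A] [IsNoetherianRing A]

/-- A direct sum of copies of an injective module over a noetherian ring is injective. -/
theorem injective_finsupp (J : Type u) (X : Type u) [AddCommGroup X] [Module A X]
    [Module.Injective A X] : Module.Injective A (J →₀ X) := by
  classical
  refine Module.Baer.injective fun I g ↦ ?_
  have hfg : I.FG := IsNoetherian.noetherian I
  obtain ⟨s, hs⟩ := (Module.Finite.iff_fg.2 hfg).fg_top
  -- The ideal is finitely generated, so its image meets only finitely many coordinates and the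
  -- extension is made in these alone.
  let T : Finset J := s.biUnion fun x ↦ (g x).support
  have hT (x : I) (j : J) (hj : j ∉ T) : g x j = 0 := by
    have hx : x ∈ Submodule.span A (s : Set I) := hs ▸ Submodule.mem_top
    induction hx using Submodule.span_induction with
    | mem x hx =>
      by_contra hne
      exact hj (Finset.mem_biUnion.2 ⟨x, hx, Finsupp.mem_support_iff.2 hne⟩)
    | zero => simp
    | add x y _ _ hx hy => rw [map_add, Finsupp.add_apply, hx, hy, add_zero]
    | smul a x _ hx => rw [map_smul, Finsupp.smul_apply, hx, smul_zero]
  have hbaer : Module.Baer A X := Module.Baer.of_injective ‹_›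
  choose l hl using fun j ↦ hbaer I (Finsupp.lapply j ∘ₗ g)
  refine ⟨∑ j ∈ T, Finsupp.lsingle j ∘ₗ l j, fun x hx ↦ ?_⟩
  ext j
  rw [LinearMap.sum_apply, Finsupp.finsetSum_apply]
  by_cases hj : j ∈ T
  · rw [Finset.sum_eq_single j (fun i _ hi ↦ by simp [hi]) (fun h ↦ absurd hj h)]
    simp [hl j x hx]
  · rw [hT ⟨x, hx⟩ j hj, Finset.sum_eq_zero]
    intro i hi
    have : i ≠ j := fun e ↦ hj (e ▸ hi)
    simp [this]

omit [IsNoetherianRing A] in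
theorem finsupp_map_exact (J : Type u) {X Y Z : Type u} [AddCommGroup X] [Module A X]
    [AddCommGroup Y] [Module A Y] [AddCommGroup Z] [Module A Z] {f : X →ₗ[A] Y} {g : Y →ₗ[A] Z}
    (h : Function.Exact f g) : Function.Exact (Finsupp.mapRange.linearMap (α := J) f)
      (Finsupp.mapRange.linearMap (α := J) g) := by
  classical
  intro φ
  constructor
  · intro hφ
    have hφ' (j : J) : ∃ x, f x = φ j := (h _).1 (DFunLike.congr_fun hφ j)
    choose r hr using hφ'
    -- The lift is taken to be 0 wherever φ vanishes, to keep the support finite.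
    refine ⟨Finsupp.onFinset φ.support (fun j ↦ if φ j = 0 then 0 else r j) fun j hj ↦ ?_,
      Finsupp.ext fun j ↦ ?_⟩
    · rw [Finsupp.mem_support_iff]
      exact fun e ↦ hj (if_pos e)
    · rw [Finsupp.mapRange.linearMap_apply, Finsupp.mapRange_apply, Finsupp.onFinset_apply]
      split_ifs with e
      · rw [map_zero, e]
      · exact hr j
  · rintro ⟨φ, rfl⟩
    exact Finsupp.ext fun j ↦ (h _).2 ⟨_, rfl⟩

/-- The functor of direct sums of copies of a module. -/
noncomputable def finsuppFunctor (A : Type u) [Ring A] (J : Type u) :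
    ModuleCat.{u} A ⥤ ModuleCat.{u} A where
  obj X := ModuleCat.of A (J →₀ X)
  map f := ModuleCat.ofHom (Finsupp.mapRange.linearMap f.hom)
  map_id X := by ext; simp
  map_comp f g := by
    refine ModuleCat.hom_ext (LinearMap.ext fun φ ↦ Finsupp.ext fun j ↦ ?_)
    simp

theorem hasInjectiveDimensionLT_finsupp (J : Type u) (n : ℕ) (X : ModuleCat.{u} A)
    (hX : HasInjectiveDimensionLT X n) : HasInjectiveDimensionLT (ModuleCat.of A (J →₀ X)) n := by
  have : (finsuppFunctor A J).Additive :=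
    { map_add := by
        intro X Y f g
        refine ModuleCat.hom_ext (LinearMap.ext fun φ ↦ Finsupp.ext fun j ↦ ?_)
        rfl }
  have hex : ∀ S : ShortComplex (ModuleCat.{u} A), S.Exact → (S.map (finsuppFunctor A J)).Exact := by
    intro S hS
    rw [ShortComplex.ShortExact.moduleCat_exact_iff_function_exact] at hS ⊢
    exact finsupp_map_exact J hS
  have := ((Functor.exact_tfae (finsuppFunctor A J)).out 1 3 rfl rfl).mp hex
  obtain ⟨_, _⟩ := this
  have : (finsuppFunctor A J).PreservesInjectiveObjects :=
    { injective_obj := fun {X} hX ↦ by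
        have : Module.Injective A X := Module.injective_module_of_injective_object A X
        have := injective_finsupp J X (A := A)
        exact Module.injective_object_of_injective_module A (J →₀ X) }
  exact hasInjectiveDimensionLT_obj (finsuppFunctor A J) n X

/-- A projective module is a retract of a direct sum of copies of A, and over a left noetherian ring
such sums do not raise the injective dimension. -/
theorem hasInjectiveDimensionLT_of_projective {n : ℕ}
    (hA : HasInjectiveDimensionLT (ModuleCat.of A A) n) (P : ModuleCat.{u} A)
    (hP : Module.Projective A P) : HasInjectiveDimensionLT P n := by
  obtain ⟨s, hs⟩ := hP.out
  have := hasInjectiveDimensionLT_finsupp P n (ModuleCat.of A A) hA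
  let r : Retract P (ModuleCat.of A (P →₀ A)) :=
    { i := ModuleCat.ofHom s
      r := ModuleCat.ofHom (Finsupp.linearCombination A id)
      retract := by ext x; exact hs x }
  exact r.hasInjectiveDimensionLT n

end Bass

/-! ### The bound for the injective dimension of skew fractions. -/

section

variable {k : Type v} [Field k] {S Q : Type u} [Ring S] [Algebra k S] [Ring Q] [Algebra k Q]
variable {σ : S ≃ₐ[k] S} {ι : S →ₐ[k] Q} {t : Q}

theorem IsSkewFractionRing.hasInjectiveDimensionLT_tensor [IsSemisimpleRing S]
    (h : IsSkewFractionRing σ ι t) (U : Type u) [Ring U] [Algebra k U]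
    [IsNoetherianRing (S ⊗[k] U)] {n : ℕ}
    (hn : HasInjectiveDimensionLT (ModuleCat.of (S ⊗[k] U) (S ⊗[k] U)) n) :
    HasInjectiveDimensionLT (ModuleCat.of (Q ⊗[k] U) (Q ⊗[k] U)) (n + 1) :=
  (h.isSkewExtension U).hasInjectiveDimensionLT_succ (isLeftProjective_baseHom U ι) _
    (hasInjectiveDimensionLT_of_projective hn _ (isLeftProjective_baseHom U ι))

theorem IsSkewFractionRing.injdim_tensor_le [IsSemisimpleRing S]
    (h : IsSkewFractionRing σ ι t) (U : Type u) [Ring U] [Algebra k U]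
    [IsNoetherianRing (S ⊗[k] U)] : injdim (Q ⊗[k] U) ≤ injdim (S ⊗[k] U) + 1 := by
  generalize hd : injdim (S ⊗[k] U) = d
  induction d with
  | bot =>
    -- Dimension −∞ means that S ⊗ U is the zero ring; then 1 = 0 in Q ⊗ U as well.
    have h0 := ModuleCat.subsingleton_of_isZero ((injectiveDimension_eq_bot_iff _).1 hd)
    have h1 : (1 : Q ⊗[k] U) = 0 := by
      rw [← map_one (baseHom ι U), ← map_zero (baseHom ι U)]
      exact congrArg _ (h0.elim _ _)
    have h2 : Subsingleton (ModuleCat.of (Q ⊗[k] U) (Q ⊗[k] U)) :=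
      subsingleton_of_zero_eq_one h1.symm
    exact ((injectiveDimension_eq_bot_iff _).2 (ModuleCat.isZero_of_subsingleton _)).le
  | coe d =>
    induction d with
    | top => exact le_top
    | coe d =>
      refine (injectiveDimension_le_iff _ (d + 1)).2 (h.hasInjectiveDimensionLT_tensor U ?_)
      exact (injectiveDimension_le_iff _ d).1 hd.le

end

end HomTr

namespace HomTr

open Abelian

/-! ### `Ext` into projective modules -/

section

variable {R : Type u} [Ring R] [IsNoetherianRing R]

/-- On a free module the identity is the limit of the finite sums of coordinate projections. Each
projection factors through R and kills the class, and by finiteness of M the remainder kills it too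
once the sum is large. -/
theorem subsingleton_ext_of_projective {M : ModuleCat.{u} R} [Module.Finite R M] {n : ℕ}
    (h : Subsingleton (Ext M (ModuleCat.of R R) n)) (P : ModuleCat.{u} R)
    (hP : Module.Projective R P) : Subsingleton (Ext M P n) := by
  classical
  let F := ModuleCat.of R (P →₀ R)
  have hF : ∀ ξ : Ext M F n, ξ = 0 := by
    intro ξ
    let e (x : P) : F ⟶ F := ModuleCat.ofHom (Finsupp.lsingle x ∘ₗ Finsupp.lapply x)
    have he (x : P) : ξ.comp (Ext.mk₀ (e x)) (add_zero n) = 0 := by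
      have e1 : e x = (ModuleCat.ofHom (Finsupp.lapply x) : F ⟶ ModuleCat.of R R) ≫
        ModuleCat.ofHom (Finsupp.lsingle x) := rfl
      rw [e1, ← Ext.mk₀_comp_mk₀, ← Ext.comp_assoc_of_second_deg_zero,
        h.elim (ξ.comp (Ext.mk₀ _) (add_zero n)) 0, Ext.zero_comp]
    have hT (T : Finset P) : ξ.comp (Ext.mk₀ (∑ x ∈ T, e x)) (add_zero n) = 0 := by
      induction T using Finset.induction_on with
      | empty => simp
      | insert x T hx ih => rw [Finset.sum_insert hx, Ext.mk₀_add, Ext.comp_add, ih, he, add_zero]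
    have hsum (T : Finset P) (φ : F) : (∑ x ∈ T, e x).hom φ = ∑ x ∈ T, Finsupp.single x (φ x) := by
      induction T using Finset.induction_on with
      | empty => simp
      | insert x T hx ih =>
        rw [Finset.sum_insert hx, Finset.sum_insert hx, ← ih]
        rfl
    obtain ⟨T, hT'⟩ := (eventually_ext_comp_eq_zero Filter.atTop
      (fun T : Finset P ↦ 𝟙 F - ∑ x ∈ T, e x) (fun φ ↦ by
        refine Filter.eventually_atTop.2 ⟨φ.support, fun T hT ↦ ?_⟩
        change φ - (∑ x ∈ T, e x).hom φ = 0
        rw [hsum, sub_eq_zero]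
        refine (Finsupp.sum_single φ).symm.trans ?_
        exact Finset.sum_subset hT fun x _ hx ↦ by simp [Finsupp.notMem_support_iff.1 hx]) ξ).exists
    have : Ext.mk₀ (𝟙 F) = Ext.mk₀ (𝟙 F - ∑ x ∈ T, e x) + Ext.mk₀ (∑ x ∈ T, e x) := by
      rw [← Ext.mk₀_add, sub_add_cancel]
    rw [← ξ.comp_mk₀_id, this, Ext.comp_add, hT', hT, add_zero]
  obtain ⟨s, hs⟩ := hP.out
  let i : P ⟶ F := ModuleCat.ofHom s
  let r : F ⟶ P := ModuleCat.ofHom (Finsupp.linearCombination R id)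
  have hir : i ≫ r = 𝟙 P := by ext x; exact hs x
  refine subsingleton_of_forall_eq 0 fun ξ ↦ ?_
  rw [← ξ.comp_mk₀_id, ← hir, ← Ext.mk₀_comp_mk₀, ← Ext.comp_assoc_of_second_deg_zero,
    hF (ξ.comp (Ext.mk₀ i) (add_zero n)), Ext.zero_comp]

end

/-! ### Bimodules, enveloping algebras and the comparison of homomorphism groups. -/

section

variable {k : Type v} [Field k] {S Q : Type u} [Ring S] [Algebra k S] [Ring Q] [Algebra k Q]

variable (k S) in
/-- The bimodule `S` as an additive group. -/
noncomputable def toBimod : S ≃+ bimod k S := AddEquiv.refl S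

theorem tmul_smul_toBimod (a b x : S) :
    (a ⊗ₜ[k] MulOpposite.op b : Env k S) • toBimod k S x = toBimod k S (a * x * b) := by
  let _ : Module (Env k S) S := instModuleTensorProductMop k S
  change (a ⊗ₜ[k] MulOpposite.op b : Env k S) • x = a * x * b
  rw [TensorProduct.Algebra.smul_def, mul_assoc]
  rfl

theorem finite_bimod : Module.Finite (Env k S) (bimod k S) := by
  refine ⟨⟨{toBimod k S 1}, ?_⟩⟩
  refine eq_top_iff.2 fun x _ ↦ ?_
  obtain ⟨x, rfl⟩ := (toBimod k S).surjective x
  rw [Finset.coe_singleton, Submodule.mem_span_singleton]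
  refine ⟨x ⊗ₜ MulOpposite.op 1, ?_⟩
  rw [tmul_smul_toBimod, mul_one, mul_one]

/-- The homomorphism from `S ⊗ S°` to `S ⊗ Q°`. -/
noncomputable abbrev halfHom (ι : S →ₐ[k] Q) : Env k S →+* S ⊗[k] Qᵐᵒᵖ :=
  (Algebra.TensorProduct.map (AlgHom.id k S) (opHom ι) : Env k S →ₐ[k] S ⊗[k] Qᵐᵒᵖ)

/-- The homomorphism of enveloping algebras induced by `ι`. -/
noncomputable abbrev envHom (ι : S →ₐ[k] Q) : Env k S →+* Env k Q :=
  (baseHom ι Qᵐᵒᵖ).comp (halfHom ι)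

theorem envHom_tmul (ι : S →ₐ[k] Q) (a b : S) :
    envHom ι (a ⊗ₜ MulOpposite.op b) = ι a ⊗ₜ MulOpposite.op (ι b) := rfl

theorem toBimod_map_smul (ι : S →ₐ[k] Q) (e : Env k S) (x : S) :
    toBimod k Q (ι ((toBimod k S).symm (e • toBimod k S x))) = envHom ι e • toBimod k Q (ι x) := by
  induction e using TensorProduct.induction_on with
  | zero =>
    have h1 : (0 : Env k S) • toBimod k S x = 0 := zero_smul (Env k S) (toBimod k S x)
    have h2 : envHom ι (0 : Env k S) • toBimod k Q (ι x) = 0 := by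
      rw [map_zero]
      exact zero_smul (Env k Q) (toBimod k Q (ι x))
    refine Eq.trans ?_ h2.symm
    refine (congrArg (fun y ↦ toBimod k Q (ι ((toBimod k S).symm y))) h1).trans ?_
    simp only [map_zero]
  | add e e' he he' => rw [add_smul, map_add, map_add, map_add, he, he', map_add, add_smul]
  | tmul a b =>
    obtain ⟨b, rfl⟩ := MulOpposite.op_surjective b
    rw [envHom_tmul, tmul_smul_toBimod, tmul_smul_toBimod, AddEquiv.symm_apply_apply, map_mul ι,
      map_mul ι]

/-- The inclusion of bimodules. -/
noncomputable def bimodMap (ι : S →ₐ[k] Q) :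
    bimod k S ⟶ (ModuleCat.restrictScalars.{u} (envHom ι)).obj (bimod k Q) :=
  ModuleCat.ofHom (X := bimod k S)
      (Y := (ModuleCat.restrictScalars.{u} (envHom ι)).obj (bimod k Q))
    { toFun := fun x ↦ toBimod k Q (ι ((toBimod k S).symm x))
      map_add' := fun x y ↦ by rw [map_add, map_add, map_add]; rfl
      map_smul' := fun e x ↦ toBimod_map_smul ι e ((toBimod k S).symm x) }

/-- Evaluation at `1` of coinduced modules. -/
noncomputable def coindEval (ι : S →ₐ[k] Q) :
    ModuleCat.coextendScalars.{u, u, u} (baseHom ι Qᵐᵒᵖ) ⋙ ModuleCat.restrictScalars.{u} (envHom ι)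
      ⟶ ModuleCat.restrictScalars.{u} (halfHom ι) where
  app X := (ModuleCat.restrictScalars.{u} (halfHom ι)).map
    ((ModuleCat.restrictCoextendScalarsAdj.{u, u, u} (baseHom ι Qᵐᵒᵖ)).counit.app X)
  naturality _ _ _ := rfl

-- Both sides are the elements x₀ of X, seen as an S-Q-bimodule, with s x₀ = x₀ ι(s) for all s in S.
-- On the left x₀ is the value at 1 of the image of 1; on the right it is the image of 1.
open MulOpposite in
theorem comparison_bijective (ι : S →ₐ[k] Q) (X : ModuleCat.{u} (S ⊗[k] Qᵐᵒᵖ)) :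
    Function.Bijective fun f : bimod k Q ⟶
        (ModuleCat.coextendScalars.{u, u, u} (baseHom ι Qᵐᵒᵖ)).obj X ↦
      bimodMap ι ≫ (ModuleCat.restrictScalars.{u} (envHom ι)).map f ≫ (coindEval ι).app X := by
  let val (f : bimod k Q ⟶ (ModuleCat.coextendScalars.{u, u, u} (baseHom ι Qᵐᵒᵖ)).obj X)
    (b : Env k Q) (q : Q) : X := (f (toBimod k Q q)) b
  have val_smul (f) (b c : Env k Q) (q : Q) :
      val f b ((toBimod k Q).symm (c • toBimod k Q q)) = val f (b * c) q :=
    congrArg (fun φ : (ModuleCat.coextendScalars.{u, u, u} (baseHom ι Qᵐᵒᵖ)).obj X ↦ φ b)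
      (f.hom.map_smul c (toBimod k Q q))
  have val_map (f) (a : S ⊗[k] Qᵐᵒᵖ) (q : Q) : val f (baseHom ι Qᵐᵒᵖ a) q = a • val f 1 q := by
    have := IsSkewExtension.coind_map_mul (f (toBimod k Q q)) a 1
    rwa [mul_one] at this
  -- By linearity f is recovered from x₀ = `val f 1 1`: its value is x₀ multiplied on the right by b
  -- · q.
  have val_eq (f) (b : Env k Q) (q : Q) : val f b q =
      ((1 : S) ⊗ₜ[k] op ((toBimod k Q).symm (b • toBimod k Q q))) • val f 1 1 := by
    rw [← val_map]
    have e : baseHom ι Qᵐᵒᵖ ((1 : S) ⊗ₜ[k] op ((toBimod k Q).symm (b • toBimod k Q q))) =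
        (1 : Q) ⊗ₜ op ((toBimod k Q).symm (b • toBimod k Q q)) := by
      change ι 1 ⊗ₜ _ = _
      rw [map_one]
      rfl
    rw [e, ← one_mul ((1 : Q) ⊗ₜ[k] op _), ← val_smul, tmul_smul_toBimod, one_mul, one_mul,
      AddEquiv.symm_apply_apply, val_smul, one_mul]
  constructor
  · intro f g hfg
    have h1 : val f 1 1 = val g 1 1 := by
      have := congrArg (fun χ ↦ χ.hom (toBimod k S 1)) hfg
      change val f 1 (ι 1) = val g 1 (ι 1) at this
      rwa [map_one] at this
    refine ModuleCat.hom_ext (LinearMap.ext fun x ↦ IsSkewExtension.coind_ext fun b ↦ ?_)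
    change val f b ((toBimod k Q).symm x) = val g b ((toBimod k Q).symm x)
    rw [val_eq, h1, ← val_eq]
  · intro g
    let x₀ : X := g (toBimod k S 1)
    let act (b : Env k Q) (q : Q) : Q := (toBimod k Q).symm (b • toBimod k Q q)
    have act_tmul (a b q : Q) : act (a ⊗ₜ op b) q = a * q * b := by
      change (toBimod k Q).symm _ = _
      rw [tmul_smul_toBimod, AddEquiv.symm_apply_apply]
    have act_add (b c : Env k Q) (q : Q) : act (b + c) q = act b q + act c q := by
      change (toBimod k Q).symm _ = _
      rw [add_smul, map_add]
    have act_add' (b : Env k Q) (q r : Q) : act b (q + r) = act b q + act b r := by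
      change (toBimod k Q).symm _ = _
      rw [map_add, smul_add, map_add]
    have act_mul (b c : Env k Q) (q : Q) : act (b * c) q = act b (act c q) := by
      change (toBimod k Q).symm _ = (toBimod k Q).symm (b • toBimod k Q ((toBimod k Q).symm _))
      rw [mul_smul, AddEquiv.apply_symm_apply]
    have hx₀ (s : S) : ((1 : S) ⊗ₜ[k] op (ι s)) • x₀ = (s ⊗ₜ[k] (1 : Qᵐᵒᵖ)) • x₀ := by
      have h1 := g.hom.map_smul ((1 : S) ⊗ₜ[k] op s) (toBimod k S 1)
      have h2 := g.hom.map_smul (s ⊗ₜ[k] op (1 : S)) (toBimod k S 1)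
      rw [tmul_smul_toBimod, one_mul, one_mul] at h1
      rw [tmul_smul_toBimod, mul_one, mul_one] at h2
      have h3 := h1.symm.trans h2
      have h4 : halfHom ι ((1 : S) ⊗ₜ[k] op s) • x₀ = halfHom ι (s ⊗ₜ[k] op (1 : S)) • x₀ := h3
      have h5 : halfHom ι (s ⊗ₜ[k] op (1 : S)) = s ⊗ₜ[k] (1 : Qᵐᵒᵖ) := by
        change s ⊗ₜ[k] op (ι 1) = _
        rw [map_one]
        rfl
      rwa [h5] at h4
    have hact (a : S ⊗[k] Qᵐᵒᵖ) (q : Q) : ((1 : S) ⊗ₜ[k] op (act (baseHom ι Qᵐᵒᵖ a) q)) • x₀ =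
        a • ((1 : S) ⊗ₜ[k] op q) • x₀ := by
      induction a using TensorProduct.induction_on with
      | zero =>
        have h0 : act (baseHom ι Qᵐᵒᵖ 0) q = 0 := by
          rw [map_zero]
          simpa using act_add 0 0 q
        have h1 : (0 : S ⊗[k] Qᵐᵒᵖ) • ((1 : S) ⊗ₜ[k] op q) • x₀ = 0 :=
          zero_smul (S ⊗[k] Qᵐᵒᵖ) (((1 : S) ⊗ₜ[k] op q) • x₀)
        rw [h0, h1, MulOpposite.op_zero, tmul_zero]
        exact zero_smul (S ⊗[k] Qᵐᵒᵖ) x₀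
      | add x y hx hy => rw [map_add, act_add, MulOpposite.op_add, tmul_add, add_smul, hx, hy, add_smul]
      | tmul s r =>
        obtain ⟨r, rfl⟩ := op_surjective r
        have e : baseHom ι Qᵐᵒᵖ (s ⊗ₜ op r) = ι s ⊗ₜ op r := rfl
        have e1 : (1 : S) ⊗ₜ[k] op (ι s * q * r) =
            ((1 : S) ⊗ₜ[k] op (q * r)) * ((1 : S) ⊗ₜ[k] op (ι s)) := by
          rw [Algebra.TensorProduct.tmul_mul_tmul, one_mul, ← op_mul, mul_assoc]
        rw [e, act_tmul, e1, mul_smul, hx₀, ← mul_smul, ← mul_smul,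
          Algebra.TensorProduct.tmul_mul_tmul, Algebra.TensorProduct.tmul_mul_tmul, one_mul,
          mul_one, mul_one, op_mul]
    let F : Q →+ (ModuleCat.coextendScalars.{u, u, u} (baseHom ι Qᵐᵒᵖ)).obj X :=
      { toFun := fun q ↦ (ModuleCat.CoextendScalars.equiv (baseHom ι Qᵐᵒᵖ) X).symm
          { toFun := fun b : Env k Q ↦ ((1 : S) ⊗ₜ[k] op (act b q)) • x₀
            map_add' := fun b c ↦ by
              refine (congrArg (fun y ↦ ((1 : S) ⊗ₜ[k] op y) • x₀) (act_add b c q)).trans ?_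
              rw [MulOpposite.op_add, tmul_add, add_smul]
            map_smul' := fun a b ↦ by
              refine (congrArg (fun y ↦ ((1 : S) ⊗ₜ[k] op y) • x₀)
                (act_mul (baseHom ι Qᵐᵒᵖ a) b q)).trans ?_
              exact hact a _ }
        map_zero' := IsSkewExtension.coind_ext fun b ↦ by
          change ((1 : S) ⊗ₜ[k] op (act b 0)) • x₀ = 0
          have : act b 0 = 0 := by simpa using act_add' b 0 0
          rw [this, MulOpposite.op_zero, tmul_zero]
          exact zero_smul (S ⊗[k] Qᵐᵒᵖ) x₀
        map_add' := fun q r ↦ IsSkewExtension.coind_ext fun b ↦ by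
          change ((1 : S) ⊗ₜ[k] op (act b (q + r))) • x₀ =
            ((1 : S) ⊗ₜ[k] op (act b q)) • x₀ + ((1 : S) ⊗ₜ[k] op (act b r)) • x₀
          rw [act_add', MulOpposite.op_add, tmul_add, add_smul] }
    refine ⟨ModuleCat.ofHom (X := bimod k Q)
      { toFun := fun x ↦ F ((toBimod k Q).symm x)
        map_add' := fun x y ↦ by rw [map_add, map_add]; rfl
        map_smul' := fun c x ↦ IsSkewExtension.coind_ext fun b ↦ by
          change ((1 : S) ⊗ₜ[k] op (act b ((toBimod k Q).symm (c • x)))) • x₀ =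
            ((1 : S) ⊗ₜ[k] op (act (b * c) ((toBimod k Q).symm x))) • x₀
          rw [act_mul]
          rfl }, ?_⟩
    refine ModuleCat.hom_ext (LinearMap.ext fun x ↦ ?_)
    obtain ⟨s, rfl⟩ := (toBimod k S).surjective x
    change ((1 : S) ⊗ₜ[k] op (act 1 (ι s))) • x₀ = g (toBimod k S s)
    have e1 : act 1 (ι s) = ι s := by
      change (toBimod k Q).symm _ = _
      rw [one_smul, AddEquiv.symm_apply_apply]
    have h2 := g.hom.map_smul (s ⊗ₜ[k] op (1 : S)) (toBimod k S 1)
    rw [tmul_smul_toBimod, mul_one, mul_one] at h2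
    rw [e1, hx₀]
    refine Eq.trans ?_ h2.symm
    change _ = (s ⊗ₜ[k] op (ι 1)) • x₀
    rw [map_one]
    rfl

end

end HomTr

namespace HomTr

open Abelian Limits

/-! ### Composites of exact functors, and vanishing in a short exact sequence. -/

section

universe w u₁ v₁ u₂ v₂ u₃ v₃

variable {C : Type u₁} [Category.{v₁} C] [Abelian C] {D : Type u₂} [Category.{v₂} D] [Abelian D]
  {D' : Type u₃} [Category.{v₃} D'] [Abelian D']

theorem mapExactFunctor_comp_functor [HasExt.{w} C] [HasExt.{w} D] [HasExt.{w} D']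
    [EnoughProjectives C] (F : C ⥤ D) (G : D ⥤ D') [F.Additive] [PreservesFiniteLimits F]
    [PreservesFiniteColimits F] [G.Additive] [PreservesFiniteLimits G] [PreservesFiniteColimits G]
    [PreservesFiniteLimits (F ⋙ G)] [PreservesFiniteColimits (F ⋙ G)]
    {n : ℕ} {X Y : C} (e : Ext X Y n) :
    e.mapExactFunctor (F ⋙ G) = (e.mapExactFunctor F).mapExactFunctor G := by
  induction n generalizing X with
  | zero =>
    obtain ⟨f, rfl⟩ := (Ext.mk₀_bijective X Y).2 e
    simp [Ext.mapExactFunctor_mk₀]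
  | succ n ih =>
    let P : ProjectivePresentation X := Classical.arbitrary _
    let S := ShortComplex.mk _ _ (kernel.condition P.f)
    have hS : S.ShortExact := { exact := ShortComplex.exact_kernel P.f }
    have : Projective S.X₂ := P.projective
    obtain ⟨e, rfl⟩ := Ext.contravariant_sequence_exact₃ hS Y e (Ext.eq_zero_of_projective _)
      (add_comm 1 n)
    rw [Ext.mapExactFunctor_comp, Ext.mapExactFunctor_comp, Ext.mapExactFunctor_comp, ih]
    exact congrArg (fun x ↦ Ext.comp x _ _) ((Ext.mapExactFunctor_extClass (F ⋙ G) hS).trans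
      ((Ext.mapExactFunctor_extClass G (hS.map_of_exact F)).symm.trans
        (congrArg _ (Ext.mapExactFunctor_extClass F hS).symm)))

theorem subsingleton_ext_of_shortExact [HasExt.{w} C] {T : ShortComplex C} (hT : T.ShortExact)
    (M : C) {j : ℕ} (h2 : Subsingleton (Ext M T.X₂ j))
    (h3 : ∀ i, i + 1 = j → Subsingleton (Ext M T.X₃ i)) : Subsingleton (Ext M T.X₁ j) := by
  refine subsingleton_of_forall_eq 0 fun e ↦ ?_
  cases j with
  | zero =>
    obtain ⟨f, rfl⟩ := (Ext.mk₀_bijective M T.X₁).2 e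
    have := h2.elim (Ext.mk₀ (f ≫ T.f)) 0
    rw [Ext.mk₀_eq_zero_iff] at this
    have := hT.mono_f
    rw [Ext.mk₀_eq_zero_iff, ← cancel_mono T.f, zero_comp]
    assumption
  | succ j =>
    obtain ⟨e, rfl⟩ := Ext.covariant_sequence_exact₁ M hT e (h2.elim _ _) rfl
    rw [(h3 j rfl).elim e 0, Ext.zero_comp]

end

/-! ### `Ext` over the enveloping algebra of Q: the upper bound for fhtr. -/

namespace IsSkewFractionRing

variable {k : Type v} [Field k] {S Q : Type u} [Ring S] [Algebra k S] [Ring Q] [Algebra k Q]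
variable {σ : S ≃ₐ[k] S} {ι : S →ₐ[k] Q} {t : Q}

theorem hasLocalDualBasis_halfHom (h : IsSkewFractionRing σ ι t) :
    HasLocalDualBasis (halfHom ι) ⊥ :=
  HasLocalDualBasis.tensor (ι := AlgHom.id k S) (ι' := opHom ι) HasLocalDualBasis.id
    h.op.hasLocalDualBasis

theorem isLeftProjective_halfHom [IsSemisimpleRing S] (ι : S →ₐ[k] Q) :
    IsLeftProjective (halfHom ι) :=
  IsLeftProjective.tensor (ι := AlgHom.id k S) (ι' := opHom ι) IsLeftProjective.id
    (isLeftProjective_of_isSemisimpleRing (opHom ι : Sᵐᵒᵖ →+* Qᵐᵒᵖ))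

theorem isLeftProjective_envHom [IsSemisimpleRing S] (ι : S →ₐ[k] Q) :
    IsLeftProjective (envHom ι) :=
  (isLeftProjective_halfHom ι).comp (isLeftProjective_baseHom Qᵐᵒᵖ ι)

/-- `Ext` over `Q ⊗ Q°` into coinduced modules. -/
theorem extComparison_coindEval_bijective [IsSemisimpleRing S] (h : IsSkewFractionRing σ ι t)
    (n : ℕ) (X : ModuleCat.{u} (S ⊗[k] Qᵐᵒᵖ)) :
    Function.Bijective (extComparison (ModuleCat.restrictScalars.{u} (envHom ι)) (coindEval ι)
      (bimodMap ι) X n) := by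
  have := (isLeftProjective_baseHom Qᵐᵒᵖ ι).preserves.1
  have := (isLeftProjective_baseHom Qᵐᵒᵖ ι).preserves.2
  have := h.hasLocalDualBasis_halfHom.preservesInjectiveObjects
  exact extComparison_bijective _ _ _ (comparison_bijective ι) n X

/-- If Extⁱ(S, Sᵉ) vanishes for all i ≥ j − 1, it also vanishes with coefficients in the projective
Sᵉ-module Qᵉ, hence Extⁱ(Q, −) vanishes on the coinduced terms of the resolution of Qᵉ, and so
Extʲ(Q, Qᵉ) = 0. -/
theorem exists_nontrivial_ext [IsSemisimpleRing S] [IsNoetherianRing (Env k S)]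
    (h : IsSkewFractionRing σ ι t) {j : ℕ}
    (hj : Nontrivial (Ext (bimod k Q) (ModuleCat.of (Env k Q) (Env k Q)) j)) :
    ∃ i, j ≤ i + 1 ∧ Nontrivial (Ext (bimod k S) (ModuleCat.of (Env k S) (Env k S)) i) := by
  by_contra! hn
  have : Module.Finite (Env k S) (bimod k S) := finite_bimod
  let BB := ModuleCat.of (Env k Q) (Env k Q)
  have key (i : ℕ) (hi : j ≤ i + 1) :
      Subsingleton (Ext (bimod k Q) (IsSkewExtension.coind (baseHom ι Qᵐᵒᵖ) BB) i) := by
    have h1 : Subsingleton (Ext (bimod k S)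
        ((ModuleCat.restrictScalars.{u} (envHom ι)).obj BB) i) :=
      subsingleton_ext_of_projective (hn i hi) _ (isLeftProjective_envHom ι)
    have h2 : Subsingleton (Ext (bimod k S) ((ModuleCat.restrictScalars.{u} (halfHom ι)).obj
      ((ModuleCat.restrictScalars.{u} (baseHom ι Qᵐᵒᵖ)).obj BB)) i) := h1
    exact (h.extComparison_coindEval_bijective i
      ((ModuleCat.restrictScalars.{u} (baseHom ι Qᵐᵒᵖ)).obj BB)).1.subsingleton
  have := subsingleton_ext_of_shortExact
    ((h.isSkewExtension Qᵐᵒᵖ).resolution_shortExact BB) (bimod k Q) (key j (Nat.le_succ j))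
    fun i hi ↦ key i hi.ge
  exact not_subsingleton_iff_nontrivial.2 hj this

end IsSkewFractionRing

/-! ### Graded retractions -/

section

variable {E B : Type u} [Ring E] [Ring B] (f : E →+* B) (σ : E ≃+* E) (w : Bˣ)

/-- Multiplication by a unit normalising the image of `f`. -/
noncomputable def mulUnit (hw : ∀ e, w * f e = f (σ e) * w) :
    ModuleCat.restrictScalars.{u} f ⟶
      ModuleCat.restrictScalars.{u} f ⋙ ModuleCat.restrictScalars.{u} σ.toRingHom where
  app X := ModuleCat.ofHom (X := (ModuleCat.restrictScalars.{u} f).obj X)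
    (Y := (ModuleCat.restrictScalars.{u} σ.toRingHom).obj ((ModuleCat.restrictScalars.{u} f).obj X))
    { toFun := fun x : X ↦ ((w : B) • x : X)
      map_add' := fun x y ↦ smul_add (w : B) (x : X) (y : X)
      map_smul' := fun e x ↦ by
        change (w : B) • f e • (x : X) = f (σ e) • (w : B) • (x : X)
        rw [← mul_smul, hw, mul_smul] }
  naturality X Y g := by
    refine ModuleCat.hom_ext (LinearMap.ext fun x ↦ ?_)
    exact (g.hom.map_smul (w : B) x).symm

/-- The maps π assign to a class ξ coefficients pⱼ in Extⁿ(N, E), and θ acts by pⱼ(θξ) = ν(pⱼ₊₁(ξ))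
with ν injective. Solving θξ − ξ = η, where η comes from a class η₀ put in degree 0, gives ν(pⱼ₊₁) −
pⱼ = 0 for j ≠ 0 and η₀ for j = 0. As almost all pⱼ vanish, descent from above gives pⱼ = 0 for j ≥
1 and ascent from below gives pⱼ = 0 for j ≤ 0, so η₀ = 0. -/
theorem subsingleton_ext_of_graded [IsNoetherianRing E] {f : E →+* B} {σ : E ≃+* E} {w : Bˣ}
    (hw : ∀ e, w * f e = f (σ e) * w) {Y : ModuleCat.{u} B}
    (π : ℤ → ((ModuleCat.restrictScalars.{u} f).obj Y ⟶ ModuleCat.of E E))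
    (hπ : ∀ y, ∀ᶠ i in Filter.cofinite, π i y = 0)
    (hπw : ∀ i (y : Y), (π (i + 1)).hom ((w : B) • y : Y) = σ ((π i).hom y))
    (inc : ModuleCat.of E E ⟶ (ModuleCat.restrictScalars.{u} f).obj Y)
    (hinc0 : inc ≫ π 0 = 𝟙 _) (hinc : ∀ j ≠ 0, inc ≫ π j = 0)
    {N : ModuleCat.{u} E} [Module.Finite E N] {M : ModuleCat.{u} B} (τ : N ≃+ N)
    (hτ : ∀ (e : E) (x : N), τ (e • x) = σ e • τ x)
    (i : N ⟶ (ModuleCat.restrictScalars.{u} f).obj M)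
    (hi : ∀ x, i.hom (τ x) = ((w : B) • (i.hom x : M) : M)) {n : ℕ} {Z : ModuleCat.{u} B}
    (θ : Z ⟶ Z) (ev : (ModuleCat.restrictScalars.{u} f).obj Z ⟶
      (ModuleCat.restrictScalars.{u} f).obj Y)
    (hev : ∀ z : Z, ((w : B) • (ev.hom (θ.hom z) : Y) : Y) = ev.hom ((w : B) • z : Z))
    (hsurj : ∀ η, ∃ ξ : Ext M Z n, ((Ext.mk₀ i).comp
      (ξ.mapExactFunctor (ModuleCat.restrictScalars.{u} f)) (zero_add n)).comp (Ext.mk₀ ev)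
        (add_zero n) = η)
    (hθ : ∀ η : Ext M Z n, ∃ ξ : Ext M Z n, ξ.comp (Ext.mk₀ (θ - 𝟙 Z)) (add_zero n) = η) :
    Subsingleton (Ext N (ModuleCat.of E E) n) := by
  let R := ModuleCat.restrictScalars.{u} f
  let R' := ModuleCat.restrictScalars.{u} σ.toRingHom
  let r (ξ : Ext M Z n) := ((Ext.mk₀ i).comp (ξ.mapExactFunctor R) (zero_add n)).comp (Ext.mk₀ ev)
        (add_zero n)
  let p (j : ℤ) (ξ : Ext M Z n) : Ext N (ModuleCat.of E E) n := (r ξ).comp (Ext.mk₀ (π j)) (add_zero n)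
  have p_add (j : ℤ) (ξ η) : p j (ξ + η) = p j ξ + p j η := by simp [p, r]
  have p_sub (j : ℤ) (ξ η) : p j (ξ - η) = p j ξ - p j η :=
    (AddMonoidHom.mk' (p j) (p_add j)).map_sub ξ η
  let τ' : N ⟶ R'.obj N := ModuleCat.ofHom (X := N) (Y := R'.obj N)
    { toFun := τ
      map_add' := map_add τ
      map_smul' := hτ }
  let s : R'.obj (ModuleCat.of E E) ⟶ ModuleCat.of E E :=
    ModuleCat.ofHom (X := R'.obj (ModuleCat.of E E)) (Y := ModuleCat.of E E)
      { toFun := σ.symm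
        map_add' := map_add σ.symm
        map_smul' := fun (a b : E) ↦ by
          change σ.symm (σ a * b) = a * σ.symm b
          rw [map_mul, σ.symm_apply_apply] }
  have : IsIso τ' := by
    rw [ConcreteCategory.isIso_iff_bijective]
    exact τ.bijective
  have : IsIso s := by
    rw [ConcreteCategory.isIso_iff_bijective]
    exact σ.symm.bijective
  let ν (ζ : Ext N (ModuleCat.of E E) n) : Ext N (ModuleCat.of E E) n :=
    ((Ext.mk₀ τ').comp (ζ.mapExactFunctor R') (zero_add n)).comp (Ext.mk₀ s) (add_zero n)
  have hν0 : ν 0 = 0 := by simp [ν]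
  have hν (ζ) (hζ : ν ζ = 0) : ζ = 0 := by
    have h1 : ζ.mapExactFunctor R' = ((Ext.mk₀ (inv τ')).comp (ν ζ) (zero_add n)).comp
        (Ext.mk₀ (inv s)) (add_zero n) := by
      simp only [ν, Ext.comp_assoc_of_third_deg_zero, Ext.mk₀_comp_mk₀, IsIso.hom_inv_id,
        Ext.comp_mk₀_id]
      rw [Ext.mk₀_comp_mk₀_assoc, IsIso.inv_hom_id, Ext.mk₀_id_comp]
    rw [hζ, Ext.comp_zero, Ext.zero_comp] at h1
    have : R'.IsEquivalence := ModuleCat.restrictScalars_isEquivalence_of_ringEquiv σ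
    refine (Functor.mapExt_bijective_of_preservesProjectiveObjects R' N (ModuleCat.of E E) n).1 ?_
    rw [map_zero, Functor.mapExtAddHom_apply, h1]
  let W := mulUnit f σ w hw
  have hp (j : ℤ) (ξ : Ext M Z n) :
      p j (ξ.comp (Ext.mk₀ θ) (add_zero n)) = ν (p (j + 1) ξ) := by
    have e1 : R.map θ ≫ ev ≫ π j = W.app Z ≫ R'.map ev ≫ R'.map (π (j + 1)) ≫ s := by
      refine ModuleCat.hom_ext (LinearMap.ext fun z ↦ ?_)
      exact (σ.symm_apply_apply _).symm.trans (congrArg σ.symm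
        ((hπw j (ev.hom (θ.hom z))).symm.trans (congrArg (π (j + 1)).hom (hev z))))
    have e2 : i ≫ W.app M = τ' ≫ R'.map i :=
      ModuleCat.hom_ext (LinearMap.ext fun x ↦ (hi x).symm)
    have nat := mapExactFunctor_naturality W ξ
    rw [mapExactFunctor_comp_functor R R'] at nat
    simp only [p, r, ν, Ext.mapExactFunctor_comp, Ext.mapExactFunctor_mk₀,
      Ext.comp_assoc_of_third_deg_zero, Ext.mk₀_comp_mk₀]
    rw [e1, ← Ext.mk₀_comp_mk₀, ← Ext.comp_assoc_of_third_deg_zero (ξ.mapExactFunctor R), nat]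
    simp only [Ext.comp_assoc_of_third_deg_zero]
    rw [Ext.mk₀_comp_mk₀_assoc, Ext.mk₀_comp_mk₀_assoc, e2, R'.map_comp, Category.assoc]
  refine subsingleton_of_forall_eq 0 fun η₀ ↦ ?_
  obtain ⟨η, hη⟩ := hsurj (η₀.comp (Ext.mk₀ inc) (add_zero n))
  have pη (j : ℤ) : p j η = η₀.comp (Ext.mk₀ (inc ≫ π j)) (add_zero n) := by
    simp only [p]
    refine (congrArg (fun x ↦ Ext.comp x (Ext.mk₀ (π j)) (add_zero n)) hη).trans ?_
    rw [Ext.comp_assoc_of_third_deg_zero, Ext.mk₀_comp_mk₀]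
  obtain ⟨ξ, hξ⟩ := hθ η
  have key (j : ℤ) : ν (p (j + 1) ξ) - p j ξ = p j η := by
    rw [← hp, ← p_sub, ← hξ]
    congr 1
    rw [sub_eq_add_neg θ, Ext.mk₀_add, Ext.comp_add, Ext.mk₀_neg, Ext.comp_neg, Ext.comp_mk₀_id,
      sub_eq_add_neg]
  have hfin : {j : ℤ | p j ξ ≠ 0}.Finite := eventually_ext_comp_eq_zero Filter.cofinite π hπ (r ξ)
  have hpos (j : ℤ) (hj : 1 ≤ j) : p j ξ = 0 := by
    obtain ⟨m, hm⟩ := hfin.bddAbove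
    have hm' (l : ℤ) (hl : m < l) : p l ξ = 0 := by
      by_contra hne
      exact absurd (hm hne) (not_le.2 hl)
    have hdesc (d : ℕ) : ∀ l : ℤ, 1 ≤ l → m < l + d → p l ξ = 0 := by
      induction d with
      | zero => exact fun l _ hl ↦ hm' l (by simpa using hl)
      | succ d ih =>
        intro l hl hlm
        have := key l
        rw [ih (l + 1) (by omega) (by push_cast at hlm; omega), hν0, pη, hinc l (by omega),
          Ext.mk₀_zero, Ext.comp_zero, zero_sub, neg_eq_zero] at this
        exact this
    exact hdesc (m - j + 1).toNat j hj (by omega)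
  have hneg (j : ℕ) : p (-j) ξ = 0 := by
    obtain ⟨m, hm⟩ := hfin.bddBelow
    have hm' (l : ℤ) (hl : l < m) : p l ξ = 0 := by
      by_contra hne
      exact absurd (hm hne) (not_le.2 hl)
    have hasc (d : ℕ) : ∀ l : ℤ, l ≤ 0 → l < m + d → p l ξ = 0 := by
      induction d with
      | zero => exact fun l _ hl ↦ hm' l (by simpa using hl)
      | succ d ih =>
        intro l hl hlm
        have := key (l - 1)
        rw [ih (l - 1) (by omega) (by push_cast at hlm; omega), pη, hinc (l - 1) (by omega),
          Ext.mk₀_zero, Ext.comp_zero, sub_zero, sub_add_cancel] at this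
        exact hν _ this
    exact hasc (-j - m + 1).toNat (-j) (by omega) (by omega)
  have := key 0
  rw [pη, hinc0, Ext.comp_mk₀_id, zero_add, hpos 1 le_rfl, hν0] at this
  rw [← this]
  simpa using hneg 0

end

end HomTr

namespace HomTr

open Abelian

/-! ### Coefficients in the enveloping algebra -/

section

variable {k : Type v} [Field k] {S Q : Type u} [Ring S] [Algebra k S] [Ring Q] [Algebra k Q]
variable {σ : S ≃ₐ[k] S} {ι : S →ₐ[k] Q} {t : Q}

variable (k) in
/-- The units `q ⊗ q⁻¹` of the enveloping algebra. -/
noncomputable def envUnit : Qˣ →* (Env k Q)ˣ where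
  toFun q :=
    { val := (q : Q) ⊗ₜ MulOpposite.op (↑q⁻¹ : Q)
      inv := (↑q⁻¹ : Q) ⊗ₜ MulOpposite.op (q : Q)
      val_inv := by
        rw [Algebra.TensorProduct.tmul_mul_tmul, ← MulOpposite.op_mul, Units.mul_inv]
        rfl
      inv_val := by
        rw [Algebra.TensorProduct.tmul_mul_tmul, ← MulOpposite.op_mul, Units.inv_mul]
        rfl }
  map_one' := Units.ext (by simp; rfl)
  map_mul' p q := Units.ext (by
    change ((p * q : Qˣ) : Q) ⊗ₜ[k] MulOpposite.op (↑(p * q)⁻¹ : Q) =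
      ((p : Q) ⊗ₜ MulOpposite.op (↑p⁻¹ : Q)) * ((q : Q) ⊗ₜ MulOpposite.op (↑q⁻¹ : Q))
    rw [Algebra.TensorProduct.tmul_mul_tmul, ← MulOpposite.op_mul, mul_inv_rev, Units.val_mul,
      Units.val_mul])

theorem coe_envUnit (q : Qˣ) :
    (envUnit k q : Env k Q) = (q : Q) ⊗ₜ MulOpposite.op (↑q⁻¹ : Q) := rfl

variable (k) in
/-- The automorphism of the enveloping algebra induced by an automorphism. -/
noncomputable abbrev envCongr (σ : S ≃ₐ[k] S) : Env k S ≃ₐ[k] Env k S :=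
  Algebra.TensorProduct.congr σ (AlgEquiv.op σ)

theorem envHom_eq (ι : S →ₐ[k] Q) (e : Env k S) :
    envHom ι e = Algebra.TensorProduct.map ι (opHom ι) e := by
  induction e using TensorProduct.induction_on with
  | zero => simp
  | add x y hx hy => rw [map_add, hx, hy, map_add]
  | tmul => rfl

namespace IsSkewFractionRing

/-- The variable as a unit. -/
noncomputable def unit (h : IsSkewFractionRing σ ι t) : Qˣ := h.isUnit_t.unit

theorem coe_unit (h : IsSkewFractionRing σ ι t) : (h.unit : Q) = t := rfl

theorem unit_mul_inv (h : IsSkewFractionRing σ ι t) : t * (↑h.unit⁻¹ : Q) = 1 := h.unit.mul_inv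

theorem inv_mul_unit (h : IsSkewFractionRing σ ι t) : (↑h.unit⁻¹ : Q) * t = 1 := h.unit.inv_mul

theorem coeffZero_zpow (h : IsSkewFractionRing σ ι t) {j : ℤ} (hj : j ≠ 0) :
    h.coeffZero (↑(h.unit ^ j) : Q) = 0 := by
  obtain ⟨n, rfl | rfl⟩ := j.eq_nat_or_neg
  · rw [zpow_natCast, Units.val_pow_eq_pow_val]
    exact h.coeffZero_pow (by omega)
  · rw [zpow_neg, zpow_natCast, ← inv_pow, Units.val_pow_eq_pow_val]
    exact h.coeffZero_inv_pow h.unit_mul_inv (by omega)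

theorem coeffZero_eventually_mul (h : IsSkewFractionRing σ ι t) (q : Q) :
    ∃ N, ∀ i ≥ N, h.coeffZero (q * (↑h.unit⁻¹ : Q) ^ i) = 0 := by
  obtain ⟨N, hN⟩ := h.coeffZero_eventually h.unit_mul_inv q
  refine ⟨N, fun i hi ↦ ?_⟩
  have key : ∀ (i : ℕ) (p : Q), h.coeffZero (t ^ i * p * (↑h.unit⁻¹ : Q) ^ i) =
      (σ ^ i) (h.coeffZero p) := by
    intro i
    induction i with
    | zero => intro p; simp
    | succ i ih =>
      intro p
      have := h.coeffZero_conj h.unit_mul_inv h.inv_mul_unit (t ^ i * p * (↑h.unit⁻¹ : Q) ^ i)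
      rw [ih, ← AlgEquiv.mul_apply, ← pow_succ'] at this
      rw [← this, pow_succ', pow_succ]
      congr 1
      noncomm_ring
  have := key i ((↑h.unit⁻¹ : Q) ^ i * q)
  rw [hN i hi, map_zero, ← mul_assoc, pow_mul_pow_eq_one i h.unit_mul_inv, one_mul] at this
  exact this

/-- Conjugation by t is conjugation by the inverse variable in the opposite algebra, and the
automorphism there is σ⁻¹; the two inversions cancel. -/
theorem coeffZero_op_conj (h : IsSkewFractionRing σ ι t) (q : Q) :
    h.op.coeffZero (MulOpposite.op (t * q * (↑h.unit⁻¹ : Q))) =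
      (AlgEquiv.op σ) (h.op.coeffZero (MulOpposite.op q)) := by
  have := h.op.coeffZero_conj (t' := MulOpposite.op (↑h.unit⁻¹ : Q))
    (by rw [← MulOpposite.op_mul, h.inv_mul_unit, MulOpposite.op_one])
    (by rw [← MulOpposite.op_mul, h.unit_mul_inv, MulOpposite.op_one])
    (MulOpposite.op (t * q * (↑h.unit⁻¹ : Q)))
  rw [← MulOpposite.op_mul, ← MulOpposite.op_mul] at this
  have e : (↑h.unit⁻¹ : Q) * (t * q * (↑h.unit⁻¹ : Q) * t) = q := by
    rw [mul_assoc _ _ t, h.inv_mul_unit, mul_one, ← mul_assoc, h.inv_mul_unit, one_mul]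
  rw [e] at this
  rw [this]
  exact ((AlgEquiv.op σ).apply_symm_apply _).symm

/-- The coefficient of degree zero in the enveloping algebra. -/
noncomputable def envCoeff (h : IsSkewFractionRing σ ι t) : Env k Q →ₗ[k] Env k S :=
  TensorProduct.map h.coeffZeroₗ h.op.coeffZeroₗ

theorem envCoeff_tmul (h : IsSkewFractionRing σ ι t) (p : Q) (q : Qᵐᵒᵖ) :
    h.envCoeff (p ⊗ₜ q) = h.coeffZero p ⊗ₜ h.op.coeffZero q := rfl

theorem envCoeff_map_mul (h : IsSkewFractionRing σ ι t) (e : Env k S) (b : Env k Q) :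
    h.envCoeff (envHom ι e * b) = e * h.envCoeff b := by
  rw [envHom_eq]
  exact map_tensor_mul (c := h.coeffZeroₗ) (c' := h.op.coeffZeroₗ)
    (fun a q ↦ h.coeffZero_map_mul a q) (fun a q ↦ h.op.coeffZero_map_mul a q) e b

theorem envCoeff_mul_map (h : IsSkewFractionRing σ ι t) (b : Env k Q) (e : Env k S) :
    h.envCoeff (b * envHom ι e) = h.envCoeff b * e := by
  rw [envHom_eq]
  exact map_mul_tensor (c := h.coeffZeroₗ) (c' := h.op.coeffZeroₗ)
    (fun q a ↦ h.coeffZero_mul_map q a) (fun q a ↦ h.op.coeffZero_mul_map q a) b e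

theorem envCoeff_zpow (h : IsSkewFractionRing σ ι t) {j : ℤ} (hj : j ≠ 0) :
    h.envCoeff ((envUnit k h.unit ^ j : (Env k Q)ˣ) : Env k Q) = 0 := by
  rw [← map_zpow, coe_envUnit, envCoeff_tmul, h.coeffZero_zpow hj, zero_tmul]

theorem envCoeff_one (h : IsSkewFractionRing σ ι t) : h.envCoeff 1 = 1 := by
  change h.coeffZero 1 ⊗ₜ h.op.coeffZero 1 = 1
  rw [coeffZero_one, coeffZero_one]
  rfl

theorem envCoeff_conj (h : IsSkewFractionRing σ ι t) (b : Env k Q) :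
    h.envCoeff ((envUnit k h.unit : Env k Q) * b * (↑(envUnit k h.unit)⁻¹ : Env k Q)) =
      envCongr k σ (h.envCoeff b) := by
  induction b using TensorProduct.induction_on with
  | zero => simp
  | add x y hx hy => rw [mul_add, add_mul, map_add, hx, hy, map_add, map_add]
  | tmul p q =>
    obtain ⟨q, rfl⟩ := MulOpposite.op_surjective q
    have e : (envUnit k h.unit : Env k Q) * (p ⊗ₜ MulOpposite.op q) *
        (↑(envUnit k h.unit)⁻¹ : Env k Q) =
        (t * p * (↑h.unit⁻¹ : Q)) ⊗ₜ MulOpposite.op (t * q * (↑h.unit⁻¹ : Q)) := by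
      rw [← map_inv, coe_envUnit, coe_envUnit, inv_inv, Algebra.TensorProduct.tmul_mul_tmul,
        Algebra.TensorProduct.tmul_mul_tmul, ← MulOpposite.op_mul, ← MulOpposite.op_mul, coe_unit,
        mul_assoc t q]
    rw [e, envCoeff_tmul, envCoeff_tmul, h.coeffZero_conj h.unit_mul_inv h.inv_mul_unit,
      h.coeffZero_op_conj]
    rfl

/-- In (p ⊗ q)w⁻ʲ the first factor becomes negative as j → ∞ and the second as j → −∞, w carrying
opposite powers of t in its two factors. -/
theorem envCoeff_mul_zpow_eventually (h : IsSkewFractionRing σ ι t) (b : Env k Q) :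
    ∀ᶠ j : ℤ in Filter.cofinite,
      h.envCoeff (b * ((envUnit k h.unit ^ (-j) : (Env k Q)ˣ) : Env k Q)) = 0 := by
  induction b using TensorProduct.induction_on with
  | zero => simp
  | add x y hx hy =>
    filter_upwards [hx, hy] with j h1 h2
    rw [add_mul, map_add, h1, h2, add_zero]
  | tmul p q =>
    obtain ⟨q, rfl⟩ := MulOpposite.op_surjective q
    obtain ⟨N, hN⟩ := h.coeffZero_eventually_mul p
    obtain ⟨N', hN'⟩ := h.op.coeffZero_eventually_mul (MulOpposite.op q)
    rw [Int.cofinite_eq, Filter.eventually_sup]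
    constructor
    · filter_upwards [Filter.eventually_le_atBot (-N' : ℤ)] with j hj
      obtain ⟨n, rfl⟩ : ∃ n : ℕ, j = -n := ⟨(-j).toNat, by omega⟩
      have e : MulOpposite.op q * MulOpposite.op (↑(h.unit ^ (- -(n : ℤ)))⁻¹ : Q) =
          MulOpposite.op q * (↑h.op.unit⁻¹ : Qᵐᵒᵖ) ^ n := by
        congr 1
        have e1 : (↑h.op.unit⁻¹ : Qᵐᵒᵖ) = MulOpposite.op (↑h.unit⁻¹ : Q) :=
          Units.inv_eq_of_mul_eq_one_right (by
            rw [coe_unit, ← MulOpposite.op_mul, h.inv_mul_unit, MulOpposite.op_one])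
        rw [e1, ← MulOpposite.op_pow, neg_neg, zpow_natCast, ← inv_pow, Units.val_pow_eq_pow_val]
      rw [← map_zpow, coe_envUnit, Algebra.TensorProduct.tmul_mul_tmul, envCoeff_tmul, e,
        hN' n (by omega), tmul_zero]
    · filter_upwards [Filter.eventually_ge_atTop (N : ℤ)] with j hj
      obtain ⟨n, rfl⟩ : ∃ n : ℕ, j = n := ⟨j.toNat, by omega⟩
      rw [← map_zpow, coe_envUnit, Algebra.TensorProduct.tmul_mul_tmul, envCoeff_tmul, zpow_neg,
        zpow_natCast, ← inv_pow, Units.val_pow_eq_pow_val, hN n (by omega), zero_tmul]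

theorem envUnit_mul_envHom (h : IsSkewFractionRing σ ι t) (e : Env k S) :
    (envUnit k h.unit : Env k Q) * envHom ι e = envHom ι (envCongr k σ e) * envUnit k h.unit := by
  induction e using TensorProduct.induction_on with
  | zero => simp
  | add x y hx hy => rw [map_add, mul_add, hx, hy, map_add, map_add, add_mul]
  | tmul a b =>
    obtain ⟨b, rfl⟩ := MulOpposite.op_surjective b
    change (_ ⊗ₜ _) * (ι a ⊗ₜ MulOpposite.op (ι b)) =
      (ι (σ a) ⊗ₜ MulOpposite.op (ι (σ b))) * (_ ⊗ₜ _)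
    rw [Algebra.TensorProduct.tmul_mul_tmul, Algebra.TensorProduct.tmul_mul_tmul,
      ← MulOpposite.op_mul, ← MulOpposite.op_mul, coe_unit, h.comm]
    have : ι b * (↑h.unit⁻¹ : Q) = (↑h.unit⁻¹ : Q) * ι (σ b) := by
      rw [Units.eq_inv_mul_iff_mul_eq, ← mul_assoc, coe_unit, h.comm, mul_assoc, h.unit_mul_inv,
        mul_one]
    rw [this]

/-- The graded argument is applied with w = t ⊗ t⁻¹, which acts on the bimodule Q as conjugation by
t and preserves S. The coefficient of degree j of b is the one of degree 0 of bw⁻ʲ. Vanishing of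
Extⁿ⁺¹(Q, Qᵉ) makes the twist minus the identity surjective on Extⁿ. -/
theorem subsingleton_ext [IsSemisimpleRing S] [IsNoetherianRing (Env k S)]
    (h : IsSkewFractionRing σ ι t) {n : ℕ} (hn : Subsingleton
      (Ext (bimod k Q) (ModuleCat.of (Env k Q) (Env k Q)) (n + 1))) :
    Subsingleton (Ext (bimod k S) (ModuleCat.of (Env k S) (Env k S)) n) := by
  let BB := ModuleCat.of (Env k Q) (Env k Q)
  let R := ModuleCat.restrictScalars.{u} (envHom ι)
  let π (j : ℤ) : R.obj BB ⟶ ModuleCat.of (Env k S) (Env k S) :=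
    ModuleCat.ofHom (X := R.obj BB) (Y := ModuleCat.of (Env k S) (Env k S))
      { toFun := fun b : Env k Q ↦
          h.envCoeff (b * ((envUnit k h.unit ^ (-j) : (Env k Q)ˣ) : Env k Q))
        map_add' := fun (b c : Env k Q) ↦
          (congrArg h.envCoeff (add_mul b c _)).trans (map_add h.envCoeff _ _)
        map_smul' := fun e (b : Env k Q) ↦
          (congrArg h.envCoeff (mul_assoc (envHom ι e) b _)).trans (h.envCoeff_map_mul e _) }
  have π_apply (j : ℤ) (b : Env k Q) : (π j).hom b =
      h.envCoeff (b * ((envUnit k h.unit ^ (-j) : (Env k Q)ˣ) : Env k Q)) := rfl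
  let inc : ModuleCat.of (Env k S) (Env k S) ⟶ R.obj BB :=
    ModuleCat.ofHom (X := ModuleCat.of (Env k S) (Env k S)) (Y := R.obj BB)
      { toFun := envHom ι
        map_add' := map_add (envHom ι)
        map_smul' := map_mul (envHom ι) }
  have : Module.Finite (Env k S) (bimod k S) := finite_bimod
  have hE := h.isSkewExtension Qᵐᵒᵖ
  refine subsingleton_ext_of_graded (f := envHom ι) (σ := (envCongr k σ).toRingEquiv)
    (w := envUnit k h.unit) h.envUnit_mul_envHom (Y := BB) π h.envCoeff_mul_zpow_eventually
    (fun j (b : Env k Q) ↦ ?_) inc (ModuleCat.hom_ext (LinearMap.ext fun e ↦ ?_))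
    (fun j hj ↦ ModuleCat.hom_ext (LinearMap.ext fun e ↦ ?_)) (N := bimod k S) (M := bimod k Q)
    (((toBimod k S).symm.trans σ.toRingEquiv.toAddEquiv).trans (toBimod k S)) (fun e x ↦ ?_)
    (bimodMap ι) (fun x ↦ ?_) (hE.twist BB)
    ((coindEval ι).app ((ModuleCat.restrictScalars.{u} (baseHom ι Qᵐᵒᵖ)).obj BB)) (fun z ↦ ?_)
    (fun η ↦ (h.extComparison_coindEval_bijective n
      ((ModuleCat.restrictScalars.{u} (baseHom ι Qᵐᵒᵖ)).obj BB)).2 η) (fun η ↦ ?_)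
  · change h.envCoeff ((envUnit k h.unit : Env k Q) * b * _) = envCongr k σ (h.envCoeff _)
    rw [← h.envCoeff_conj, neg_add_rev, add_comm, zpow_add, zpow_neg_one, Units.val_mul]
    simp only [mul_assoc]
  · change h.envCoeff (envHom ι e * _) = e
    rw [h.envCoeff_map_mul, neg_zero, zpow_zero, Units.val_one, envCoeff_one, mul_one]
  · change h.envCoeff (envHom ι e * _) = 0
    rw [h.envCoeff_map_mul, h.envCoeff_zpow (neg_ne_zero.2 hj), mul_zero]
  · obtain ⟨x, rfl⟩ := (toBimod k S).surjective x
    have := toBimod_map_smul (σ : S →ₐ[k] S) e x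
    rw [envHom_eq] at this
    exact this
  · obtain ⟨x, rfl⟩ := (toBimod k S).surjective x
    change toBimod k Q (ι (σ x)) = (envUnit k h.unit : Env k Q) • toBimod k Q (ι x)
    rw [coe_envUnit, tmul_smul_toBimod, coe_unit, h.comm, mul_assoc, h.unit_mul_inv, mul_one]
  · have e1 : (t ⊗ₜ[k] (1 : Qᵐᵒᵖ)) * (baseHom ι Qᵐᵒᵖ ((1 : S) ⊗ₜ MulOpposite.op (↑h.unit⁻¹ : Q))) =
        envUnit k h.unit := by
      change (t ⊗ₜ[k] (1 : Qᵐᵒᵖ)) * (ι 1 ⊗ₜ MulOpposite.op (↑h.unit⁻¹ : Q)) = _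
      rw [Algebra.TensorProduct.tmul_mul_tmul, map_one, mul_one, one_mul]
      rfl
    have e2 : (baseHom ι Qᵐᵒᵖ ((1 : S) ⊗ₜ MulOpposite.op (↑h.unit⁻¹ : Q))) * (t ⊗ₜ[k] (1 : Qᵐᵒᵖ)) =
        envUnit k h.unit := by
      change (ι 1 ⊗ₜ MulOpposite.op (↑h.unit⁻¹ : Q)) * (t ⊗ₜ[k] (1 : Qᵐᵒᵖ)) = _
      rw [Algebra.TensorProduct.tmul_mul_tmul, map_one, mul_one, one_mul]
      rfl
    have e3 : IsSkewExtension.coindHom BB z (1 * (envUnit k h.unit : Env k Q)) =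
        baseHom ι Qᵐᵒᵖ ((1 : S) ⊗ₜ MulOpposite.op (↑h.unit⁻¹ : Q)) *
          IsSkewExtension.coindHom BB z (t ⊗ₜ[k] (1 : Qᵐᵒᵖ)) := by
      rw [one_mul, ← e2]
      exact IsSkewExtension.coind_map_mul z _ _
    refine Eq.trans ?_ e3.symm
    change (envUnit k h.unit : Env k Q) * ((↑(h.unitT Qᵐᵒᵖ)⁻¹ : Env k Q) *
      IsSkewExtension.coindHom BB z (t ⊗ₜ[k] (1 : Qᵐᵒᵖ) * 1)) = _
    rw [← e1, mul_one, ← mul_assoc]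
    congr 1
    rw [e1, ← e2, mul_assoc, ← h.coe_unitT Qᵐᵒᵖ, Units.mul_inv, mul_one]
  · exact Ext.covariant_sequence_exact₃ (bimod k Q) (hE.resolution_shortExact BB) η rfl
      (hn.elim _ _)

end IsSkewFractionRing

end

end HomTr

namespace HomTr

open Abelian

/-! ### Comparison of the invariants -/

theorem add_one_le_add_one_iff {a b : WithBot ℕ∞} : a + 1 ≤ b + 1 ↔ a ≤ b := by
  refine ⟨fun h ↦ ?_, fun h ↦ add_le_add_left h 1⟩
  induction a with
  | bot => exact bot_le
  | coe a =>
    induction b with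
    | bot =>
      rw [WithBot.bot_add, le_bot_iff] at h
      exact absurd h (WithBot.coe_ne_bot (a := a + 1))
    | coe b =>
      have h1 : a + 1 ≤ b + 1 := WithBot.coe_le_coe.1 h
      exact WithBot.coe_le_coe.2 ((ENat.add_le_add_iff_right (by simp)).1 h1)

section

variable {k : Type v} [Field k] {S Q : Type u} [Ring S] [Algebra k S] [Ring Q] [Algebra k Q]
variable {σ : S ≃ₐ[k] S} {ι : S →ₐ[k] Q} {t : Q}

theorem le_fhtr {i : ℕ}
    (hi : Nontrivial (Ext (bimod k S) (ModuleCat.of (Env k S) (Env k S)) i)) :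
    (i : WithBot ℕ∞) ≤ fhtr k S :=
  le_iSup₂_of_le i hi le_rfl

variable (k S) in
theorem fhtr_le_htr : fhtr k S ≤ htr k S := by
  refine iSup₂_le fun i hi ↦ ?_
  refine (injectiveDimension_ge_iff _ i).2 fun hlt ↦ ?_
  exact not_subsingleton_iff_nontrivial.2 hi
    (HasInjectiveDimensionLT.subsingleton (ModuleCat.of (Env k S) (Env k S)) i i le_rfl _)

namespace IsSkewFractionRing

/-- Each nonzero Extⁿ for S produces a nonzero Extⁿ⁺¹ for Q; the opposite inequality is
`exists_nontrivial_ext`. -/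
theorem fhtr_eq [IsSemisimpleRing S] [IsNoetherianRing (Env k S)]
    (h : IsSkewFractionRing σ ι t) : fhtr k Q = fhtr k S + 1 := by
  apply le_antisymm
  · refine iSup₂_le fun j hj ↦ ?_
    obtain ⟨i, hij, hi⟩ := h.exists_nontrivial_ext hj
    exact (Nat.cast_le (α := WithBot ℕ∞).2 hij).trans
      ((Nat.cast_add_one i).le.trans (add_le_add_left (le_fhtr hi) 1))
  · have key (i : ℕ) (hi : Nontrivial (Ext (bimod k S) (ModuleCat.of (Env k S) (Env k S)) i)) :
        (i : WithBot ℕ∞) + 1 ≤ fhtr k Q := by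
      rw [← Nat.cast_add_one]
      refine le_fhtr (not_subsingleton_iff_nontrivial.1 fun hs ↦ ?_)
      exact not_subsingleton_iff_nontrivial.2 hi (h.subsingleton_ext hs)
    by_cases hne : ∃ i, Nontrivial (Ext (bimod k S) (ModuleCat.of (Env k S) (Env k S)) i)
    · obtain ⟨i, hi⟩ := hne
      -- As fhtr Q ≥ 1 it has a predecessor, so that 1 can be cancelled under the supremum.
      obtain ⟨c, hc⟩ : ∃ c, fhtr k Q = c + 1 := by
        have := key i hi
        generalize fhtr k Q = b at this
        induction b with
        | bot => exact absurd (le_bot_iff.1 this) (WithBot.coe_ne_bot (a := (i : ℕ∞) + 1))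
        | coe b =>
          induction b with
          | top => exact ⟨⊤, rfl⟩
          | coe b =>
            have h1 : i + 1 ≤ b := by exact_mod_cast this
            exact ⟨((b - 1 : ℕ) : ℕ∞), by
              have : b = (b - 1) + 1 := by omega
              conv_lhs => rw [this]
              rfl⟩
      rw [hc, add_one_le_add_one_iff]
      refine iSup₂_le fun j hj ↦ ?_
      rw [← add_one_le_add_one_iff, ← hc]
      exact key j hj
    · push Not at hne
      have : fhtr k S = ⊥ := by
        rw [eq_bot_iff]
        exact iSup₂_le fun i hi ↦ (not_subsingleton_iff_nontrivial.2 hi (hne i)).elim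
      rw [this, WithBot.bot_add]
      exact bot_le

/-- If Q ⊗ U is noetherian then so is S ⊗ U, so each U counted for Q is counted for S. -/
theorem thtr_le [IsSemisimpleRing S] (h : IsSkewFractionRing σ ι t) :
    thtr k Q ≤ thtr k S + 1 := by
  refine iSup_le fun U ↦ iSup_le fun _ ↦ iSup_le fun _ ↦ iSup_le fun hU ↦ ?_
  have hS := h.isNoetherianBothSides_of_tensor U hU
  have := hS.1
  refine (h.injdim_tensor_le U).trans (add_le_add_left ?_ 1)
  exact le_iSup_of_le U (le_iSup_of_le _ (le_iSup_of_le _ (le_iSup_of_le hS le_rfl)))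

end IsSkewFractionRing

end

end HomTr

namespace HomTr

/-! ### Injective dimension of matrix rings -/

section Matrix

variable {R B : Type u} [Ring R] [Ring B] {m : Type} [Fintype m] [DecidableEq m]

theorem isNoetherianBothSides_of_matrix [Nonempty m] (e : Matrix m m R ≃+* B)
    (h : IsNoetherianBothSides B) : IsNoetherianBothSides R := by
  have i₀ : m := Classical.arbitrary m
  have hM := h.of_ringEquiv e.symm
  have := hM.1
  have := hM.2
  let r : Matrix m m R →+ R := Matrix.entryAddMonoidHom R i₀ i₀
  have hr (M : Matrix m m R) : r M = M i₀ i₀ := rfl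
  have h1 : r 1 = 1 := by rw [hr, Matrix.one_apply_eq]
  refine ⟨isNoetherianRing_of_retraction (Matrix.scalar m) r (fun M a ↦ ?_) h1,
    isNoetherianRing_of_retraction (RingHom.op (Matrix.scalar m)) (AddMonoidHom.mulOp r)
      (fun M a ↦ ?_) (congrArg MulOpposite.op h1)⟩
  · rw [hr, hr, Matrix.scalar_apply, Matrix.mul_diagonal]
  · refine congrArg MulOpposite.op ?_
    change r (Matrix.scalar m a.unop * M.unop) = a.unop * r M.unop
    rw [hr, hr, Matrix.scalar_apply, Matrix.diagonal_mul]

theorem isLeftProjective_scalar (e : Matrix m m R ≃+* B) :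
    IsLeftProjective ((e : Matrix m m R →+* B).comp (Matrix.scalar m)) := by
  let f := (e : Matrix m m R →+* B).comp (Matrix.scalar m)
  let P := (ModuleCat.restrictScalars.{u} f).obj (ModuleCat.of B B)
  let l : Matrix m m R ≃ₗ[R] P :=
    { e.toAddEquiv with
      map_smul' := fun a M ↦ by
        change e (a • M) = e (Matrix.scalar m a) * e M
        rw [← map_mul, Matrix.scalar_apply, Matrix.smul_eq_diagonal_mul] }
  exact Module.Projective.of_equiv l

/-- A matrix ring is separable over its scalars: with the matrix units xᵢ = E(i, i₀) and yᵢ = E(i₀,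
i), the map φ ↦ ∑ xᵢφ(yᵢ) is B-linear and splits the embedding of B in the module coinduced from R.
-/
theorem hasInjectiveDimensionLT_of_matrix [IsNoetherianRing R] [Nonempty m]
    (e : Matrix m m R ≃+* B) {n : ℕ} (hn : HasInjectiveDimensionLT (ModuleCat.of R R) n) :
    HasInjectiveDimensionLT (ModuleCat.of B B) n := by
  have i₀ : m := Classical.arbitrary m
  let f := (e : Matrix m m R →+* B).comp (Matrix.scalar m)
  have hf : IsLeftProjective f := isLeftProjective_scalar e
  let X := ModuleCat.of B B
  have := hf.preserves.1
  have := hf.preserves.2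
  have := hasInjectiveDimensionLT_of_projective hn _ hf
  have := hasInjectiveDimensionLT_obj (ModuleCat.coextendScalars.{u, u, u} f) n
    ((ModuleCat.restrictScalars.{u} f).obj X)
  let x (i : m) : B := e (Matrix.single i i₀ 1)
  let y (i : m) : B := e (Matrix.single i₀ i 1)
  have hx (M : Matrix m m R) (i : m) : e M * x i = ∑ j, x j * f (M j i) := by
    change e M * e _ = ∑ j, e _ * e _
    rw [← map_mul]
    simp only [← map_mul]
    rw [← map_sum]
    congr 1
    ext a b
    rw [Matrix.sum_apply]
    simp only [Matrix.scalar_apply, Matrix.mul_diagonal]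
    rw [Matrix.mul_apply]
    by_cases hb : i₀ = b <;> simp [Matrix.single_apply, hb]
  have hy (M : Matrix m m R) (j : m) : y j * e M = ∑ i, f (M j i) * y i := by
    change e _ * e M = ∑ i, e _ * e _
    rw [← map_mul]
    simp only [← map_mul]
    rw [← map_sum]
    congr 1
    ext a b
    rw [Matrix.sum_apply]
    simp only [Matrix.scalar_apply, Matrix.diagonal_mul]
    rw [Matrix.mul_apply]
    by_cases ha : i₀ = a <;> simp [Matrix.single_apply, ha]
  have hxy : ∑ i, x i * y i = 1 := by
    change ∑ i, e _ * e _ = 1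
    simp only [← map_mul]
    rw [← map_sum, ← map_one e]
    congr 1
    simp [Matrix.sum_single_one]
  let ρ : IsSkewExtension.coind f X ⟶ X := ModuleCat.ofHom
    { toFun := fun φ ↦ ∑ i, x i * IsSkewExtension.coindHom X φ (y i)
      map_add' := fun φ ψ ↦ by
        rw [← Finset.sum_add_distrib]
        exact Finset.sum_congr rfl fun i _ ↦ mul_add (x i) (IsSkewExtension.coindHom X φ (y i))
          (IsSkewExtension.coindHom X ψ (y i))
      map_smul' := fun c φ ↦ by
        obtain ⟨M, rfl⟩ := e.surjective c
        change ∑ j, x j * IsSkewExtension.coindHom X φ (y j * e M) =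
          e M * ∑ i, x i * IsSkewExtension.coindHom X φ (y i)
        have h1 (a : R) (b : B) : IsSkewExtension.coindHom X φ (f a * b) =
            f a * IsSkewExtension.coindHom X φ b := IsSkewExtension.coind_map_mul φ a b
        simp only [hy, map_sum, h1, Finset.mul_sum, ← mul_assoc, hx, Finset.sum_mul]
        rw [Finset.sum_comm] }
  let r : Retract X (IsSkewExtension.coind f X) :=
    { i := IsSkewExtension.toCoind f X
      r := ρ
      retract := ModuleCat.hom_ext (LinearMap.ext fun b ↦ by
        change ∑ i, x i * (y i * b) = b
        simp only [← mul_assoc]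
        rw [← Finset.sum_mul, hxy, one_mul]) }
  exact r.hasInjectiveDimensionLT n

theorem injdim_le_of_matrix [IsNoetherianRing R] [Nonempty m] (e : Matrix m m R ≃+* B) :
    injdim B ≤ injdim R := by
  generalize hd : injdim R = d
  induction d with
  | bot =>
    have h0 := ModuleCat.subsingleton_of_isZero ((injectiveDimension_eq_bot_iff _).1 hd)
    have : Subsingleton R := h0
    have : Subsingleton (ModuleCat.of B B) := e.symm.injective.subsingleton
    exact ((injectiveDimension_eq_bot_iff _).2 (ModuleCat.isZero_of_subsingleton _)).le
  | coe d =>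
    induction d with
    | top => exact le_top
    | coe d =>
      exact (injectiveDimension_le_iff _ d).2
        (hasInjectiveDimensionLT_of_matrix e ((injectiveDimension_le_iff _ d).1 hd.le))

end Matrix

/-- By Wedderburn Q° is a matrix ring over a division algebra D, so Qᵉ is a matrix ring over Q ⊗ D,
and D is one of the algebras in the supremum. -/
theorem htr_le_thtr {k : Type v} [Field k] {Q : Type u} [Ring Q] [Algebra k Q] [IsSimpleRing Q]
    [IsArtinianRing Q] (hQ : IsDoublyNoetherian k Q) : htr k Q ≤ thtr k Q := by
  have : IsSemisimpleRing Q := inferInstance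
  have : IsArtinianRing Qᵐᵒᵖ := inferInstance
  obtain ⟨n, _, D, _, _, ⟨e⟩⟩ := IsSimpleRing.exists_algEquiv_matrix_divisionRing k Qᵐᵒᵖ
  let e' : Env k Q ≃ₐ[k] Matrix (Unit × Fin n) (Unit × Fin n) (Q ⊗[k] D) :=
    (Algebra.TensorProduct.congr (Matrix.uniqueAlgEquiv (m := Unit)).symm e).trans
      (Matrix.kroneckerTMulAlgEquiv Unit (Fin n) k k Q D)
  have hD := isNoetherianBothSides_of_matrix e'.symm.toRingEquiv hQ
  have := hD.1
  refine (injdim_le_of_matrix e'.symm.toRingEquiv).trans ?_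
  exact le_iSup_of_le D (le_iSup_of_le _ (le_iSup_of_le _ (le_iSup_of_le hD le_rfl)))

end HomTr

namespace HomTr

/-! ### Homomorphisms out of bimodules -/

section LeftHom

variable (k : Type v) [Field k] (S U : Type u) [Ring S] [Algebra k S] [Ring U] [Algebra k U]
  (Y X : Type u) [AddCommGroup Y] [Module (Env k S) Y] [AddCommGroup X] [Module (S ⊗[k] U) X]

/-- The left `S`-linear maps from an `S`-bimodule to an `S ⊗ U`-module. -/
def leftHom : AddSubgroup (Y →+ X) where
  carrier := {φ | ∀ (s : S) (y : Y),
    φ ((s ⊗ₜ[k] (1 : Sᵐᵒᵖ)) • y) = (s ⊗ₜ[k] (1 : U)) • φ y}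
  add_mem' {φ ψ} hφ hψ s y := by
    rw [AddMonoidHom.add_apply, hφ, hψ, AddMonoidHom.add_apply, smul_add]
  zero_mem' s y := by simp
  neg_mem' {φ} hφ s y := by rw [AddMonoidHom.neg_apply, hφ, AddMonoidHom.neg_apply, smul_neg]

variable {k S U Y X}

/-- The action of a pure tensor. -/
noncomputable def leftHomAct (s : S) (u : U) : leftHom k S U Y X →+ leftHom k S U Y X where
  toFun φ :=
    ⟨{ toFun := fun y ↦ ((1 : S) ⊗ₜ[k] u) • φ.1 (((1 : S) ⊗ₜ[k] MulOpposite.op s) • y)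
       map_zero' := by rw [smul_zero, map_zero, smul_zero]
       map_add' := fun y z ↦ by rw [smul_add, map_add, smul_add] }, fun a y ↦ by
        change ((1 : S) ⊗ₜ[k] u) • φ.1 (((1 : S) ⊗ₜ[k] MulOpposite.op s) •
            ((a ⊗ₜ[k] (1 : Sᵐᵒᵖ)) • y)) =
          (a ⊗ₜ[k] (1 : U)) • ((1 : S) ⊗ₜ[k] u) • φ.1 (((1 : S) ⊗ₜ[k] MulOpposite.op s) • y)
        have h1 : ((1 : S) ⊗ₜ[k] MulOpposite.op s) * (a ⊗ₜ[k] (1 : Sᵐᵒᵖ)) =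
          (a ⊗ₜ[k] (1 : Sᵐᵒᵖ)) * ((1 : S) ⊗ₜ[k] MulOpposite.op s) := by simp
        have h2 : ((1 : S) ⊗ₜ[k] u) * (a ⊗ₜ[k] (1 : U)) =
          (a ⊗ₜ[k] (1 : U)) * ((1 : S) ⊗ₜ[k] u) := by simp
        rw [← mul_smul, h1, mul_smul, φ.2, ← mul_smul, h2, mul_smul]⟩
  map_zero' := Subtype.ext (by ext; exact smul_zero _)
  map_add' φ ψ := Subtype.ext (by ext; exact smul_add _ _ _)

theorem leftHomAct_apply (s : S) (u : U) (φ : leftHom k S U Y X) (y : Y) :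
    (leftHomAct s u φ).1 y =
      ((1 : S) ⊗ₜ[k] u) • φ.1 (((1 : S) ⊗ₜ[k] MulOpposite.op s) • y) := rfl

/-- The additive action of `S ⊗ U` on left `S`-linear maps. -/
noncomputable def leftHomSMul :
    S ⊗[k] U →+ leftHom k S U Y X →+ leftHom k S U Y X :=
  TensorProduct.liftAddHom
    { toFun := fun s ↦
        { toFun := fun u ↦ leftHomAct s u
          map_zero' := by
            ext φ y
            rw [leftHomAct_apply, tmul_zero]
            exact zero_smul (S ⊗[k] U) _
          map_add' := fun u u' ↦ by
            ext φ y
            rw [leftHomAct_apply, tmul_add, add_smul]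
            rfl }
      map_zero' := by
        ext u φ y
        change (leftHomAct 0 u φ).1 y = 0
        rw [leftHomAct_apply, MulOpposite.op_zero, tmul_zero]
        have : (0 : Env k S) • y = 0 := zero_smul (Env k S) y
        exact (congrArg (fun z ↦ ((1 : S) ⊗ₜ[k] u) • φ.1 z) this).trans
          (by rw [map_zero, smul_zero])
      map_add' := fun s s' ↦ by
        ext u φ y
        change (leftHomAct (s + s') u φ).1 y = (leftHomAct s u φ).1 y + (leftHomAct s' u φ).1 y
        rw [leftHomAct_apply, MulOpposite.op_add, tmul_add, add_smul, map_add, smul_add]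
        rfl } fun c s u ↦ by
    ext φ y
    change (leftHomAct (c • s) u φ).1 y = (leftHomAct s (c • u) φ).1 y
    rw [leftHomAct_apply, leftHomAct_apply]
    have e1 : (1 : S) ⊗ₜ[k] MulOpposite.op (c • s) =
        ((algebraMap k S c) ⊗ₜ[k] (1 : Sᵐᵒᵖ)) * ((1 : S) ⊗ₜ[k] MulOpposite.op s) := by
      rw [Algebra.TensorProduct.tmul_mul_tmul, one_mul, mul_one, MulOpposite.op_smul,
        Algebra.algebraMap_eq_smul_one, smul_tmul]
    have e2 : (1 : S) ⊗ₜ[k] (c • u) =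
        ((1 : S) ⊗ₜ[k] u) * ((algebraMap k S c) ⊗ₜ[k] (1 : U)) := by
      rw [Algebra.TensorProduct.tmul_mul_tmul, one_mul, mul_one,
        Algebra.algebraMap_eq_smul_one, smul_tmul]
    rw [e1, mul_smul, φ.2, e2, mul_smul]

noncomputable instance : SMul (S ⊗[k] U) (leftHom k S U Y X) where
  smul b φ := leftHomSMul b φ

theorem leftHom_tmul_smul (s : S) (u : U) (φ : leftHom k S U Y X) (y : Y) :
    ((s ⊗ₜ[k] u) • φ).1 y =
      ((1 : S) ⊗ₜ[k] u) • φ.1 (((1 : S) ⊗ₜ[k] MulOpposite.op s) • y) := rfl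

noncomputable instance : Module (S ⊗[k] U) (leftHom k S U Y X) where
  one_smul φ := by
    ext y
    change ((1 : S) ⊗ₜ[k] (1 : U)) • φ.1 (((1 : S) ⊗ₜ[k] (1 : Sᵐᵒᵖ)) • y) = φ.1 y
    rw [← Algebra.TensorProduct.one_def, ← Algebra.TensorProduct.one_def, one_smul, one_smul]
  mul_smul b c φ := by
    change leftHomSMul (b * c) φ = leftHomSMul b (leftHomSMul c φ)
    induction b using TensorProduct.induction_on with
    | zero => rw [zero_mul, map_zero]; rfl
    | add x y hx hy => rw [add_mul, map_add, map_add, AddMonoidHom.add_apply, hx, hy]; rfl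
    | tmul s u =>
      induction c using TensorProduct.induction_on with
      | zero => rw [mul_zero, map_zero, AddMonoidHom.zero_apply, map_zero]
      | add x y hx hy =>
        rw [mul_add, map_add, map_add, AddMonoidHom.add_apply, AddMonoidHom.add_apply, hx, hy,
          map_add]
      | tmul s' u' =>
        rw [Algebra.TensorProduct.tmul_mul_tmul]
        ext y
        change ((1 : S) ⊗ₜ[k] (u * u')) • φ.1 (((1 : S) ⊗ₜ[k] MulOpposite.op (s * s')) • y) =
          ((1 : S) ⊗ₜ[k] u) • ((1 : S) ⊗ₜ[k] u') • φ.1 (((1 : S) ⊗ₜ[k] MulOpposite.op s') •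
            ((1 : S) ⊗ₜ[k] MulOpposite.op s) • y)
        rw [← mul_smul, ← mul_smul, Algebra.TensorProduct.tmul_mul_tmul,
          Algebra.TensorProduct.tmul_mul_tmul, one_mul, MulOpposite.op_mul]
  smul_zero b := map_zero (leftHomSMul b)
  smul_add b φ ψ := map_add (leftHomSMul b) φ ψ
  add_smul b c φ := DFunLike.congr_fun (map_add leftHomSMul b c) φ
  zero_smul φ := DFunLike.congr_fun (map_zero leftHomSMul) φ

/-- An additive map compatible with pure tensors is linear. -/
def linearOfTmul {M N : Type*} [AddCommGroup M] [Module (S ⊗[k] U) M] [AddCommGroup N]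
    [Module (S ⊗[k] U) N] (g : M →+ N) 
    (hg : ∀ (s : S) (u : U) (m : M), g ((s ⊗ₜ[k] u) • m) = (s ⊗ₜ[k] u) • g m) :
    M →ₗ[S ⊗[k] U] N where
  toFun := g
  map_add' := map_add g
  map_smul' b m := by
    rw [RingHom.id_apply]
    induction b using TensorProduct.induction_on with
    | zero =>
      have h1 : (0 : S ⊗[k] U) • m = 0 := zero_smul (S ⊗[k] U) m
      have h2 : (0 : S ⊗[k] U) • g m = 0 := zero_smul (S ⊗[k] U) (g m)
      exact (congrArg g h1).trans ((map_zero g).trans h2.symm)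
    | add x y hx hy => rw [add_smul, map_add, hx, hy, add_smul]
    | tmul s u => exact hg s u m

variable [IsSemisimpleRing S]

/-- X is injective over the semisimple ring S, so left S-linear maps into X form an exact functor of
the bimodule. -/
theorem hasInjectiveDimensionLT_leftHom_of_exact {K P Y : Type u} [AddCommGroup K]
    [Module (Env k S) K] [AddCommGroup P]
    [Module (Env k S) P] [AddCommGroup Y] [Module (Env k S) Y] {i : K →ₗ[Env k S] P}
    {p : P →ₗ[Env k S] Y} (hi : Function.Injective i) (hp : Function.Surjective p)
    (hex : Function.Exact i p)
    (n : ℕ) (hK : HasInjectiveDimensionLT (ModuleCat.of (S ⊗[k] U) (leftHom k S U K X)) n)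
    (hP : HasInjectiveDimensionLT (ModuleCat.of (S ⊗[k] U) (leftHom k S U P X)) (n + 1)) :
    HasInjectiveDimensionLT (ModuleCat.of (S ⊗[k] U) (leftHom k S U Y X)) (n + 1) := by
  let f : leftHom k S U Y X →ₗ[S ⊗[k] U] leftHom k S U P X := linearOfTmul
    { toFun := fun φ ↦ ⟨φ.1.comp p.toAddMonoidHom, fun s y ↦ by
        change φ.1 (p _) = _ • φ.1 (p _)
        rw [map_smul, φ.2]⟩
      map_zero' := rfl
      map_add' := fun _ _ ↦ rfl } fun s u φ ↦ by
        ext y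
        change ((1 : S) ⊗ₜ[k] u) • φ.1 (((1 : S) ⊗ₜ[k] MulOpposite.op s) • p y) =
          ((1 : S) ⊗ₜ[k] u) • φ.1 (p (((1 : S) ⊗ₜ[k] MulOpposite.op s) • y))
        rw [map_smul p]
  let g : leftHom k S U P X →ₗ[S ⊗[k] U] leftHom k S U K X := linearOfTmul
    { toFun := fun φ ↦ ⟨φ.1.comp i.toAddMonoidHom, fun s y ↦ by
        change φ.1 (i _) = _ • φ.1 (i _)
        rw [map_smul, φ.2]⟩
      map_zero' := rfl
      map_add' := fun _ _ ↦ rfl } fun s u φ ↦ by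
        ext y
        change ((1 : S) ⊗ₜ[k] u) • φ.1 (((1 : S) ⊗ₜ[k] MulOpposite.op s) • i y) =
          ((1 : S) ⊗ₜ[k] u) • φ.1 (i (((1 : S) ⊗ₜ[k] MulOpposite.op s) • y))
        rw [map_smul i]
  have hfg : g ∘ₗ f = 0 := by
    refine LinearMap.ext fun φ ↦ Subtype.ext (AddMonoidHom.ext fun y ↦ ?_)
    change φ.1 (p (i y)) = 0
    rw [hex.apply_apply_eq_zero, map_zero]
  let T := ShortComplex.mk (ModuleCat.ofHom f) (ModuleCat.ofHom g)
    (by rw [← ModuleCat.ofHom_comp, hfg]; rfl)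
  suffices hT : T.ShortExact from hT.hasInjectiveDimensionLT_X₁ n hK hP
  refine ModuleCat.shortComplex_shortExact _ (fun φ ↦ ⟨fun hφ ↦ ?_, ?_⟩) (fun φ ψ h ↦ ?_)
    fun ψ ↦ ?_
  · have hφ' (x : K) : φ.1 (i x) = 0 := DFunLike.congr_fun (congrArg Subtype.val hφ) x
    have key (x x' : P) (h : p x = p x') : φ.1 x = φ.1 x' := by
      rw [← sub_eq_zero, ← map_sub] at h
      obtain ⟨z, hz⟩ := (hex _).1 h
      rw [← sub_eq_zero, ← map_sub, ← hz, hφ']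
    let q := Function.surjInv hp
    have hq (y : Y) : p (q y) = y := Function.surjInv_eq hp y
    refine ⟨⟨{ toFun := fun y ↦ φ.1 (q y)
               map_zero' := (key _ 0 (by rw [hq, map_zero])).trans (map_zero φ.1)
               map_add' := fun y z ↦
                (key _ (q y + q z) (by rw [hq, map_add, hq, hq])).trans (map_add φ.1 _ _) },
      fun s y ↦ (key _ _ (by rw [hq, map_smul, hq])).trans (φ.2 s (q y))⟩,
      Subtype.ext (AddMonoidHom.ext fun x ↦ key _ _ (hq _))⟩
  · rintro ⟨φ, rfl⟩
    exact DFunLike.congr_fun hfg φ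
  · refine Subtype.ext (AddMonoidHom.ext fun y ↦ ?_)
    obtain ⟨x, rfl⟩ := hp y
    exact DFunLike.congr_fun (congrArg Subtype.val h) x
  · let jE : S →+* Env k S := Algebra.TensorProduct.includeLeftRingHom
    let jU : S →+* S ⊗[k] U := Algebra.TensorProduct.includeLeftRingHom
    let _ : Module S K := Module.compHom K jE
    let _ : Module S P := Module.compHom P jE
    let _ : Module S X := Module.compHom X jU
    let i' : K →ₗ[S] P := { i.toAddMonoidHom with map_smul' := fun s x ↦ i.map_smul (jE s) x }
    let ψ' : K →ₗ[S] X := { ψ.1 with map_smul' := fun s x ↦ ψ.2 s x }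
    have : Module.Injective S X := Module.injective_of_isSemisimpleRing S X
    obtain ⟨φ, hφ⟩ := Module.Injective.out i' hi ψ'
    exact ⟨⟨φ.toAddMonoidHom, fun s y ↦ φ.map_smul s y⟩,
      Subtype.ext (AddMonoidHom.ext hφ)⟩

-- For the free bimodule Sᵉ, left S-linear maps Sᵉ → X are k-linear maps S → X, that is U-linear
-- maps S ⊗ U → X. This module is coinduced from the semisimple ring U, hence injective, and
-- projective bimodules give retracts of products of such modules.
omit [IsSemisimpleRing S] in
theorem injective_leftHom [IsSemisimpleRing U] [hY : Module.Projective (Env k S) Y] :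
    HasInjectiveDimensionLT (ModuleCat.of (S ⊗[k] U) (leftHom k S U Y X)) 1 := by
  let f : U →+* S ⊗[k] U := (Algebra.TensorProduct.includeRight : U →ₐ[k] S ⊗[k] U)
  have f_apply (u : U) : f u = 1 ⊗ₜ u := rfl
  let _ : Module U X := Module.compHom X f
  have smul_def (u : U) (x : X) : u • x = ((1 : S) ⊗ₜ[k] u) • x := rfl
  let Z := ModuleCat.of U (Y → X)
  have : Module.Injective U (Y → X) := Module.injective_of_isSemisimpleRing U (Y → X)
  have hZ : Injective Z := Module.injective_object_of_injective_module U (Y → X)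
  let F := (ModuleCat.coextendScalars.{u, u, u} f).obj Z
  have hF : Injective F := Functor.PreservesInjectiveObjects.injective_obj hZ
  have : HasInjectiveDimensionLT F 1 := injective_iff_hasInjectiveDimensionLT_one.1 hF
  let ev (ψ : F) (y : Y) : S ⊗[k] U →+ X :=
    { toFun := fun b ↦ (ψ b : Y → X) y
      map_zero' := congrFun (map_zero (ModuleCat.CoextendScalars.equiv f Z ψ)) y
      map_add' := fun b c ↦ congrFun (IsSkewExtension.coind_map_add ψ b c) y }
  have ev_mul (ψ : F) (y : Y) (u : U) (b : S ⊗[k] U) :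
      ev ψ y ((1 ⊗ₜ u) * b) = ((1 : S) ⊗ₜ[k] u) • ev ψ y b :=
    congrFun (IsSkewExtension.coind_map_mul ψ u b) y
  have ev_smul (ψ : F) (y : Y) (c b : S ⊗[k] U) : ev (c • ψ) y b = ev ψ y (b * c) := rfl
  have ev_add (ψ χ : F) (y : Y) (b : S ⊗[k] U) : ev (ψ + χ) y b = ev ψ y b + ev χ y b := rfl
  -- The left S-linear map on the free bimodule attached to the y-coordinate of ψ, namely a ⊗ b ↦ a
  -- ψ(b ⊗ 1).
  let Λ (ψ : F) (y : Y) : Env k S →+ X := TensorProduct.liftAddHom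
    { toFun := fun a ↦
        { toFun := fun b ↦ (a ⊗ₜ[k] (1 : U)) • ev ψ y (b.unop ⊗ₜ 1)
          map_zero' := by rw [MulOpposite.unop_zero, zero_tmul, map_zero, smul_zero]
          map_add' := fun b c ↦ by
            rw [MulOpposite.unop_add, add_tmul, map_add, smul_add] }
      map_zero' := AddMonoidHom.ext fun b ↦ by
        change ((0 : S) ⊗ₜ[k] (1 : U)) • ev ψ y (b.unop ⊗ₜ 1) = 0
        rw [zero_tmul]
        exact zero_smul (S ⊗[k] U) (ev ψ y (b.unop ⊗ₜ 1))
      map_add' := fun a c ↦ AddMonoidHom.ext fun b ↦ by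
        change ((a + c) ⊗ₜ[k] (1 : U)) • ev ψ y (b.unop ⊗ₜ 1) =
          (a ⊗ₜ[k] (1 : U)) • ev ψ y (b.unop ⊗ₜ 1) + (c ⊗ₜ[k] (1 : U)) • ev ψ y (b.unop ⊗ₜ 1)
        rw [add_tmul, add_smul] } fun c a b ↦ by
    change ((c • a) ⊗ₜ[k] (1 : U)) • ev ψ y (b.unop ⊗ₜ 1) =
      (a ⊗ₜ[k] (1 : U)) • ev ψ y ((c • b.unop) ⊗ₜ 1)
    have e1 : (c • b.unop) ⊗ₜ[k] (1 : U) = ((1 : S) ⊗ₜ (c • (1 : U))) * (b.unop ⊗ₜ 1) := by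
      rw [Algebra.TensorProduct.tmul_mul_tmul, one_mul, mul_one, smul_tmul]
    have e2 : (c • a) ⊗ₜ[k] (1 : U) = (a ⊗ₜ (1 : U)) * ((1 : S) ⊗ₜ (c • (1 : U))) := by
      rw [Algebra.TensorProduct.tmul_mul_tmul, one_mul, mul_one, smul_tmul]
    rw [e1, ev_mul, e2, mul_smul]
  have Λ_tmul (ψ : F) (y : Y) (a b : S) :
      Λ ψ y (a ⊗ₜ MulOpposite.op b) = (a ⊗ₜ[k] (1 : U)) • ev ψ y (b ⊗ₜ 1) := rfl
  have Λ_left (ψ : F) (y : Y) (s : S) (e : Env k S) :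
      Λ ψ y ((s ⊗ₜ 1) * e) = (s ⊗ₜ[k] (1 : U)) • Λ ψ y e := by
    induction e using TensorProduct.induction_on with
    | zero => rw [mul_zero, map_zero, smul_zero]
    | add x y hx hy => rw [mul_add, map_add, hx, hy, map_add, smul_add]
    | tmul a b =>
      obtain ⟨b, rfl⟩ := MulOpposite.op_surjective b
      rw [Algebra.TensorProduct.tmul_mul_tmul, one_mul, Λ_tmul, Λ_tmul, ← mul_smul,
        Algebra.TensorProduct.tmul_mul_tmul, one_mul]
  have Λ_add (ψ χ : F) (y : Y) (e : Env k S) : Λ (ψ + χ) y e = Λ ψ y e + Λ χ y e := by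
    induction e using TensorProduct.induction_on with
    | zero => rw [map_zero, map_zero, map_zero, add_zero]
    | add x y hx hy =>
      rw [map_add, hx, hy, map_add, map_add]
      abel
    | tmul a b =>
      obtain ⟨b, rfl⟩ := MulOpposite.op_surjective b
      rw [Λ_tmul, Λ_tmul, Λ_tmul, ev_add, smul_add]
  have Λ_smul (ψ : F) (y : Y) (s : S) (u : U) (e : Env k S) :
      Λ ((s ⊗ₜ[k] u) • ψ) y e =
        ((1 : S) ⊗ₜ[k] u) • Λ ψ y (((1 : S) ⊗ₜ[k] MulOpposite.op s) * e) := by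
    induction e using TensorProduct.induction_on with
    | zero => rw [mul_zero, map_zero, map_zero, smul_zero]
    | add x y hx hy => rw [mul_add, map_add, hx, hy, map_add, smul_add]
    | tmul a b =>
      obtain ⟨b, rfl⟩ := MulOpposite.op_surjective b
      have e1 : (b ⊗ₜ[k] (1 : U)) * (s ⊗ₜ u) = (1 ⊗ₜ u) * ((b * s) ⊗ₜ 1) := by simp
      rw [Algebra.TensorProduct.tmul_mul_tmul, one_mul, ← MulOpposite.op_mul, Λ_tmul, Λ_tmul,
        ev_smul, e1, ev_mul, ← mul_smul, ← mul_smul]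
      simp
  obtain ⟨s, hs⟩ := hY.out
  let ρ₀ (ψ : F) : leftHom k S U Y X :=
    ⟨{ toFun := fun y ↦ (s y).sum fun j e ↦ Λ ψ j e
       map_zero' := by rw [map_zero, Finsupp.sum_zero_index]
       map_add' := fun y z ↦ by
        rw [map_add, Finsupp.sum_add_index' (fun j ↦ map_zero (Λ ψ j)) fun j ↦ map_add (Λ ψ j)] },
      fun a y ↦ by
        change (s _).sum (fun j e ↦ Λ ψ j e) = _ • (s y).sum fun j e ↦ Λ ψ j e
        rw [map_smul, Finsupp.sum_smul_index' (fun j ↦ map_zero (Λ ψ j)), Finsupp.smul_sum]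
        exact Finsupp.sum_congr fun j _ ↦ Λ_left ψ j a _⟩
  let ρ : F →ₗ[S ⊗[k] U] leftHom k S U Y X := linearOfTmul
    (AddMonoidHom.mk' ρ₀ fun ψ χ ↦ by
      ext y
      change (s y).sum (fun j e ↦ Λ (ψ + χ) j e) =
        (s y).sum (fun j e ↦ Λ ψ j e) + (s y).sum (fun j e ↦ Λ χ j e)
      rw [← Finsupp.sum_add]
      exact Finsupp.sum_congr fun j _ ↦ Λ_add ψ χ j _) fun a u ψ ↦ by
    ext y
    change (s y).sum (fun j e ↦ Λ ((a ⊗ₜ[k] u) • ψ) j e) =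
      ((1 : S) ⊗ₜ[k] u) • (s (((1 : S) ⊗ₜ[k] MulOpposite.op a) • y)).sum fun j e ↦ Λ ψ j e
    rw [map_smul, Finsupp.sum_smul_index' (fun j ↦ map_zero (Λ ψ j)), Finsupp.smul_sum]
    exact Finsupp.sum_congr fun j _ ↦ Λ_smul ψ j a u _
  have one_tmul_smul (u : U) (φ : leftHom k S U Y X) (y : Y) :
      (((1 : S) ⊗ₜ[k] u) • φ).1 y = ((1 : S) ⊗ₜ[k] u) • φ.1 y := by
    rw [leftHom_tmul_smul, MulOpposite.op_one, ← Algebra.TensorProduct.one_def, one_smul]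
  let i : leftHom k S U Y X →ₗ[S ⊗[k] U] F :=
    { toFun := fun φ ↦ (ModuleCat.CoextendScalars.equiv f Z).symm
        { toFun := fun (b : S ⊗[k] U) ↦ fun y ↦ (b • φ).1 y
          map_add' := fun (b c : S ⊗[k] U) ↦ funext fun y ↦
            DFunLike.congr_fun (congrArg Subtype.val (add_smul b c φ)) y
          map_smul' := fun u (b : S ⊗[k] U) ↦ funext fun y ↦
            (DFunLike.congr_fun (congrArg Subtype.val (mul_smul (f u) b φ)) y).trans
              (one_tmul_smul u (b • φ) y) }
      map_add' := fun φ ψ ↦ IsSkewExtension.coind_ext fun b ↦ funext fun y ↦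
        DFunLike.congr_fun (congrArg Subtype.val (smul_add b φ ψ)) y
      map_smul' := fun c φ ↦ IsSkewExtension.coind_ext fun b ↦ funext fun y ↦
        (DFunLike.congr_fun (congrArg Subtype.val (mul_smul b c φ)) y).symm }
  let r : Retract (ModuleCat.of (S ⊗[k] U) (leftHom k S U Y X)) F :=
    { i := ModuleCat.ofHom i
      r := ModuleCat.ofHom ρ
      retract := by
        refine ModuleCat.hom_ext (LinearMap.ext fun φ ↦ Subtype.ext (AddMonoidHom.ext fun y ↦ ?_))
        change (s y).sum (fun j e ↦ Λ (i φ) j e) = φ.1 y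
        have hΛ (j : Y) (e : Env k S) : Λ (i φ) j e = φ.1 (e • j) := by
          induction e using TensorProduct.induction_on with
          | zero =>
            have : (0 : Env k S) • j = 0 := zero_smul (Env k S) j
            exact (map_zero _).trans ((map_zero φ.1).symm.trans (congrArg φ.1 this.symm))
          | add x y hx hy => rw [map_add, hx, hy, add_smul, map_add]
          | tmul a b =>
            obtain ⟨b, rfl⟩ := MulOpposite.op_surjective b
            rw [Λ_tmul]
            change (a ⊗ₜ[k] (1 : U)) • ((b ⊗ₜ[k] (1 : U)) • φ).1 j = _
            rw [leftHom_tmul_smul, ← Algebra.TensorProduct.one_def, one_smul, ← φ.2, ← mul_smul,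
              Algebra.TensorProduct.tmul_mul_tmul, one_mul, mul_one]
        simp only [hΛ]
        conv_rhs => rw [← hs y]
        rw [Finsupp.linearCombination_apply, Finsupp.sum, Finsupp.sum, map_sum]
        rfl }
  exact r.hasInjectiveDimensionLT 1

end LeftHom

end HomTr

namespace HomTr

open Abelian Limits

/-! ### Smooth algebras -/

section FreeCover

variable {R : Type u} [Ring R] (Y : ModuleCat.{u} R)

/-- The canonical presentation of a module by a free module. -/
noncomputable def freeCover : ShortComplex (ModuleCat.{u} R) :=
  LinearMap.shortComplexKer (Finsupp.linearCombination R (id : Y → Y))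

theorem freeCover_shortExact : (freeCover Y).ShortExact :=
  LinearMap.shortExact_shortComplexKer (Finsupp.linearCombination_id_surjective R Y)

theorem projective_freeCover : Module.Projective R (freeCover Y).X₂ :=
  inferInstanceAs (Module.Projective R (Y →₀ R))

end FreeCover

section Smooth

variable {k : Type v} [Field k] {S U : Type u} [Ring S] [Algebra k S] [Ring U] [Algebra k U]
  [IsSemisimpleRing S] [IsSemisimpleRing U]

/-- Induction on the projective dimension of Y along free covers. -/
theorem hasInjectiveDimensionLT_leftHom (X : Type u) [AddCommGroup X] [Module (S ⊗[k] U) X]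
    (n : ℕ) (Y : ModuleCat.{u} (Env k S)) (hY : HasProjectiveDimensionLT Y (n + 1)) :
    HasInjectiveDimensionLT (ModuleCat.of (S ⊗[k] U) (leftHom k S U Y X)) (n + 1) := by
  induction n generalizing Y with
  | zero =>
    have : Projective Y := projective_iff_hasProjectiveDimensionLT_one.2 hY
    have : Module.Projective (Env k S) Y := (IsProjective.iff_projective Y).2 this
    exact injective_leftHom
  | succ n ih =>
    have hT := freeCover_shortExact Y
    have hP := projective_freeCover Y
    have : Projective (freeCover Y).X₂ := (IsProjective.iff_projective (freeCover Y).X₂).1 hP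
    have hK := ih _ ((hT.hasProjectiveDimensionLT_X₃_iff n this).1 hY)
    exact hasInjectiveDimensionLT_leftHom_of_exact (i := (freeCover Y).f.hom)
      (p := (freeCover Y).g.hom) hT.moduleCat_injective_f hT.moduleCat_surjective_g
      ((ShortComplex.ShortExact.moduleCat_exact_iff_function_exact _).1 hT.exact) (n + 1) hK
      (@hasInjectiveDimensionLT_of_ge _ _ _ _ 1 _ (by omega) injective_leftHom)

/-- The left `S`-linear map `y ↦ y x`. -/
noncomputable def leftHomMul {X : Type u} [AddCommGroup X] [Module (S ⊗[k] U) X] (x : X) :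
    leftHom k S U (bimod k S) X :=
  ⟨{ toFun := fun y ↦ ((toBimod k S).symm y ⊗ₜ[k] (1 : U)) • x
     map_zero' := by
      rw [map_zero, zero_tmul]
      exact zero_smul (S ⊗[k] U) x
     map_add' := fun y z ↦ by rw [map_add, add_tmul, add_smul] }, fun s y ↦ by
    obtain ⟨y, rfl⟩ := (toBimod k S).surjective y
    change ((toBimod k S).symm ((s ⊗ₜ[k] MulOpposite.op (1 : S)) • toBimod k S y)
      ⊗ₜ[k] (1 : U)) • x = (s ⊗ₜ[k] (1 : U)) • (y ⊗ₜ[k] (1 : U)) • x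
    rw [tmul_smul_toBimod, mul_one, AddEquiv.symm_apply_apply, ← mul_smul,
      Algebra.TensorProduct.tmul_mul_tmul, mul_one]⟩

omit [IsSemisimpleRing S] [IsSemisimpleRing U] in
theorem leftHomMul_apply {X : Type u} [AddCommGroup X] [Module (S ⊗[k] U) X] (x : X) (y : S) :
    (leftHomMul (U := U) x).1 (toBimod k S y) = (y ⊗ₜ[k] (1 : U)) • x := rfl

/-- X is a direct summand of Hom_S(S, X), through x ↦ (y ↦ yx) and evaluation at 1. -/
theorem hasInjectiveDimensionLT_of_hasProjectiveDimensionLT_bimod {n : ℕ}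
    (hn : HasProjectiveDimensionLT (bimod k S) (n + 1)) (X : ModuleCat.{u} (S ⊗[k] U)) :
    HasInjectiveDimensionLT X (n + 1) := by
  have := hasInjectiveDimensionLT_leftHom (U := U) X n _ hn
  let i : X →ₗ[S ⊗[k] U] leftHom k S U (bimod k S) X := linearOfTmul
    (AddMonoidHom.mk' leftHomMul fun x x' ↦ by
      refine Subtype.ext (AddMonoidHom.ext fun y ↦ ?_)
      obtain ⟨y, rfl⟩ := (toBimod k S).surjective y
      exact smul_add (y ⊗ₜ[k] (1 : U)) x x') fun s u x ↦ by
    refine Subtype.ext (AddMonoidHom.ext fun y ↦ ?_)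
    obtain ⟨y, rfl⟩ := (toBimod k S).surjective y
    rw [leftHom_tmul_smul]
    change (leftHomMul ((s ⊗ₜ[k] u) • x)).1 (toBimod k S y) =
      ((1 : S) ⊗ₜ[k] u) • (leftHomMul x).1 (((1 : S) ⊗ₜ[k] MulOpposite.op s) • toBimod k S y)
    rw [tmul_smul_toBimod, one_mul, leftHomMul_apply, leftHomMul_apply, ← mul_smul, ← mul_smul,
      Algebra.TensorProduct.tmul_mul_tmul, Algebra.TensorProduct.tmul_mul_tmul, one_mul, one_mul,
      mul_one]
  let ρ : leftHom k S U (bimod k S) X →ₗ[S ⊗[k] U] X := linearOfTmul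
    { toFun := fun φ ↦ φ.1 (toBimod k S 1)
      map_zero' := rfl
      map_add' := fun _ _ ↦ rfl } fun s u φ ↦ by
    change ((1 : S) ⊗ₜ[k] u) • φ.1 (((1 : S) ⊗ₜ[k] MulOpposite.op s) • toBimod k S 1) =
      (s ⊗ₜ[k] u) • φ.1 (toBimod k S 1)
    have h1 : ((1 : S) ⊗ₜ[k] MulOpposite.op s) • toBimod k S 1 =
        (s ⊗ₜ[k] (1 : Sᵐᵒᵖ)) • toBimod k S 1 := by
      refine (tmul_smul_toBimod _ _ _).trans (Eq.trans ?_ (tmul_smul_toBimod s 1 1).symm)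
      simp
    rw [h1, φ.2, ← mul_smul, Algebra.TensorProduct.tmul_mul_tmul, one_mul, mul_one]
  let r : Retract X (ModuleCat.of (S ⊗[k] U) (leftHom k S U (bimod k S) X)) :=
    { i := ModuleCat.ofHom i
      r := ModuleCat.ofHom ρ
      retract := ModuleCat.hom_ext (LinearMap.ext fun x ↦ one_smul (S ⊗[k] U) x) }
  exact r.hasInjectiveDimensionLT (n + 1)

-- In the top degree n, Extⁿ(S, Y) is a quotient of Extⁿ(S, F) for a free cover F of Y. Were Extⁿ(S,
-- Sᵉ) zero, both would vanish and the projective dimension would drop.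
omit [IsSemisimpleRing S] in
theorem nontrivial_ext_of_projectiveDimension [IsNoetherianRing (Env k S)] {n : ℕ}
    (hn : HasProjectiveDimensionLT (bimod k S) (n + 1))
    (hn' : ¬ HasProjectiveDimensionLT (bimod k S) n) :
    Nontrivial (Ext (bimod k S) (ModuleCat.of (Env k S) (Env k S)) n) := by
  by_contra hs
  rw [not_nontrivial_iff_subsingleton] at hs
  have : Module.Finite (Env k S) (bimod k S) := finite_bimod
  refine hn' (HasProjectiveDimensionLT.mk fun i hi Y e ↦ ?_)
  rcases Nat.lt_or_ge n i with hlt | hge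
  · exact e.eq_zero_of_hasProjectiveDimensionLT (n + 1) hlt
  · obtain rfl : i = n := le_antisymm hge hi
    obtain ⟨e, rfl⟩ := Ext.covariant_sequence_exact₃ (bimod k S) (freeCover_shortExact Y) e rfl
      (Ext.eq_zero_of_hasProjectiveDimensionLT _ (i + 1) le_rfl)
    have := subsingleton_ext_of_projective hs (freeCover Y).X₂ (projective_freeCover Y)
    rw [this.elim e 0, Ext.zero_comp]
    rfl

theorem hasProjectiveDimensionLT_restrictScalars {A B : Type u} [Ring A] [Ring B] {f : A →+* B}
    (hf : IsLeftProjective f) (n : ℕ) (Y : ModuleCat.{u} B) (hY : HasProjectiveDimensionLT Y n) :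
    HasProjectiveDimensionLT ((ModuleCat.restrictScalars.{u} f).obj Y) n := by
  let R := ModuleCat.restrictScalars.{u} f
  have hproj (P : ModuleCat.{u} B) (hP : Projective P) : Projective (R.obj P) := by
    have hP' : Module.Projective B P := (IsProjective.iff_projective P).2 hP
    obtain ⟨s, hs⟩ := hP'.out
    let _ : Module A B := Module.compHom B f
    have : Module.Projective A B := hf
    classical
    have : Module.Projective A (P →₀ B) :=
      .of_equiv (finsuppLequivDFinsupp A (ι := P) (M := B)).symm
    let F : ModuleCat.{u} A := R.obj (ModuleCat.of B (P →₀ B))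
    have hF : Module.Projective A F := this
    have : Projective F := (IsProjective.iff_projective F).1 hF
    let r : Retract (R.obj P) F := Retract.map
      { i := ModuleCat.ofHom s
        r := ModuleCat.ofHom (Finsupp.linearCombination B id)
        retract := ModuleCat.hom_ext (LinearMap.ext hs) } R
    exact r.projective
  have key : ∀ (n : ℕ) (Y : ModuleCat.{u} B), HasProjectiveDimensionLT Y (n + 1) →
      HasProjectiveDimensionLT (R.obj Y) (n + 1) := by
    intro n
    induction n with
    | zero =>
      intro Y hY
      exact projective_iff_hasProjectiveDimensionLT_one.1
        (hproj Y (projective_iff_hasProjectiveDimensionLT_one.2 hY))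
    | succ n ih =>
      intro Y hY
      let P : ProjectivePresentation Y := Classical.arbitrary _
      let T := ShortComplex.mk _ _ (kernel.condition P.f)
      have hT : T.ShortExact := { exact := ShortComplex.exact_kernel P.f }
      have hP : Projective T.X₂ := P.projective
      have h1 := (hT.hasProjectiveDimensionLT_X₃_iff n hP).1 hY
      exact ((hT.map_of_exact R).hasProjectiveDimensionLT_X₃_iff n (hproj _ hP)).2 (ih _ h1)
  cases n with
  | zero =>
    have := isZero_of_hasProjectiveDimensionLT_zero Y
    exact (R.map_isZero this).hasProjectiveDimensionLT_zero
  | succ n => exact key n Y hY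

end Smooth

/-! ### Descent of projective dimension from Q to S. -/

section

variable {k : Type v} [Field k] {S Q : Type u} [Ring S] [Algebra k S] [Ring Q] [Algebra k Q]
variable {σ : S ≃ₐ[k] S} {ι : S →ₐ[k] Q} {t : Q}

/-- The constant coefficient is S-bilinear, so S is a retract of Q over Sᵉ; restriction to Sᵉ
preserves projectives as Qᵉ is projective over it. -/
theorem IsSkewFractionRing.hasProjectiveDimensionLT_bimod [IsSemisimpleRing S]
    (h : IsSkewFractionRing σ ι t) {n : ℕ} (hn : HasProjectiveDimensionLT (bimod k Q) n) :
    HasProjectiveDimensionLT (bimod k S) n := by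
  have := hasProjectiveDimensionLT_restrictScalars (isLeftProjective_envHom ι) n _ hn
  let R := ModuleCat.restrictScalars.{u} (envHom ι)
  let ρ : R.obj (bimod k Q) ⟶ bimod k S :=
    ModuleCat.ofHom (X := R.obj (bimod k Q)) (Y := bimod k S) (linearOfTmul
      (AddMonoidHom.mk' (fun x : bimod k Q ↦ toBimod k S (h.coeffZero ((toBimod k Q).symm x)))
        fun (x y : bimod k Q) ↦ (congrArg (fun q ↦ toBimod k S (h.coeffZero q))
          (map_add (toBimod k Q).symm x y)).trans
            (by rw [h.coeffZero_add, map_add])) fun a b (x : bimod k Q) ↦ by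
        obtain ⟨b, rfl⟩ := MulOpposite.op_surjective b
        obtain ⟨x, rfl⟩ := (toBimod k Q).surjective x
        change toBimod k S (h.coeffZero ((toBimod k Q).symm
          ((ι a ⊗ₜ[k] MulOpposite.op (ι b)) • toBimod k Q x))) =
            (a ⊗ₜ[k] MulOpposite.op b) • toBimod k S (h.coeffZero x)
        rw [tmul_smul_toBimod, tmul_smul_toBimod, AddEquiv.symm_apply_apply, h.coeffZero_mul_map,
          h.coeffZero_map_mul])
  let r : Retract (bimod k S) (R.obj (bimod k Q)) :=
    { i := bimodMap ι
      r := ρ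
      retract := ModuleCat.hom_ext (LinearMap.ext fun x ↦ h.coeffZero_map x) }
  exact r.hasProjectiveDimensionLT n

end

end HomTr

namespace HomTr

open Limits

/-! ### Modules over a ring with a regular central element -/

section Rees

variable {A B : Type u} [Ring A] [Ring B] {f : A →+* B}

/-- Dual bases modulo `N` from the coefficients of polynomials in a unit. -/
theorem hasLocalDualBasis_of_coeff {N : Ideal B} (T : Bˣ) (c : B →+ A)
    (hc : ∀ b a, c (b * f a) = c b * a) (hcN : ∀ b ∈ N, c b = 0)
    (hT : ∀ n : ℤ, c (↑(T ^ n) : B) = if n = 0 then 1 else 0)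
    (hs : ∀ s : Finset B, ∃ (M : Bˣ) (D : ℕ), ∀ b ∈ s, ∃ a : ℕ → A,
      ↑M * b - ∑ l ∈ Finset.range D, (T : B) ^ l * f (a l) ∈ N) : HasLocalDualBasis f N := by
  intro s
  obtain ⟨M, D, hM⟩ := hs s
  refine ⟨Fin D, inferInstance, fun j ↦ ↑M⁻¹ * (T : B) ^ (j : ℕ), fun j ↦
    c.comp (AddMonoidHom.mulLeft ((↑(T ^ (-(j : ℤ))) : B) * M)), fun j b a ↦ ?_, fun j b hb ↦ ?_,
    fun b hb ↦ ?_⟩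
  · change c (_ * (b * f a)) = _
    rw [← mul_assoc]
    exact hc _ a
  · exact hcN _ (N.mul_mem_left _ hb)
  · obtain ⟨a, ha⟩ := hM b hb
    -- Modulo the left ideal N, killed by c, the element M b is ∑ Tˡf(aₗ). Multiplying by T⁻ʲ and
    -- applying c isolates aⱼ.
    have key (j : ℕ) (hj : j < D) : c ((↑(T ^ (-(j : ℤ))) : B) * M * b) = a j := by
      have h1 := hcN _ (N.mul_mem_left (↑(T ^ (-(j : ℤ))) : B) ha)
      rw [mul_sub, map_sub, sub_eq_zero, ← mul_assoc] at h1
      rw [h1, Finset.mul_sum, map_sum, Finset.sum_eq_single j]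
      · rw [← mul_assoc, hc, ← Units.val_pow_eq_pow_val, ← Units.val_mul, ← zpow_natCast,
          ← zpow_add, neg_add_cancel, hT, if_pos rfl, one_mul]
      · intro l _ hl
        rw [← mul_assoc, hc, ← Units.val_pow_eq_pow_val, ← Units.val_mul, ← zpow_natCast,
          ← zpow_add, hT, if_neg (by omega), zero_mul]
      · intro hj'
        exact absurd (Finset.mem_range.2 hj) hj'
    have h2 := N.mul_mem_left (↑M⁻¹ : B) ha
    rw [mul_sub, Units.inv_mul_cancel_left, Finset.mul_sum, Finset.sum_range] at h2
    convert h2 using 2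
    refine Finset.sum_congr rfl fun j _ ↦ ?_
    rw [mul_assoc]
    exact congrArg (fun x ↦ (↑M⁻¹ : B) * ((T : B) ^ (j : ℕ) * f x)) (key j j.2)

variable {z : B}

/-- The elements killed by a central element. -/
def centralKer (hz : ∀ b, z * b = b * z) (Y : Type u) [AddCommGroup Y] [Module B Y] :
    Submodule B Y where
  carrier := {y | z • y = 0}
  add_mem' {x y} hx hy := by
    change z • (x + y) = 0
    rw [smul_add, Set.mem_ofPred.1 hx, Set.mem_ofPred.1 hy, add_zero]
  zero_mem' := smul_zero z
  smul_mem' b y hy := by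
    change z • b • y = 0
    rw [← mul_smul, hz, mul_smul, Set.mem_ofPred.1 hy, smul_zero]

/-- Multiplication by `z` is surjective. -/
def IsDivisibleBy (z : B) (Y : Type u) [AddCommGroup Y] [Module B Y] : Prop :=
  ∀ y : Y, ∃ x : Y, z • x = y

/-- As z is regular, bz ↦ by is well defined on Bz; the value at 1 of an extension to B divides y by
z. -/
theorem isDivisibleBy_of_injective (hzr : ∀ b, b * z = 0 → b = 0)
    (I : Type u) [AddCommGroup I] [Module B I] [hI : Module.Injective B I] :
    IsDivisibleBy z I := by
  intro y
  obtain ⟨g, hg⟩ := hI.out (LinearMap.toSpanSingleton B B z) (fun a b hab ↦ by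
    rw [← sub_eq_zero]
    refine hzr _ ?_
    rw [sub_mul, sub_eq_zero]
    exact hab) (LinearMap.toSpanSingleton B I y)
  refine ⟨g 1, ?_⟩
  have := hg 1
  rw [LinearMap.toSpanSingleton_apply, LinearMap.toSpanSingleton_apply, one_smul, one_smul] at this
  rw [← this, ← map_smul, smul_eq_mul, mul_one]

variable (f) in
/-- The elements killed by a central element, as a module over the subring. -/
noncomputable def kerRestrict (hz : ∀ b, z * b = b * z) (Y : ModuleCat.{u} B) : ModuleCat.{u} A :=
  (ModuleCat.restrictScalars.{u} f).obj (ModuleCat.of B (centralKer hz Y))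

theorem injective_kerRestrict (hN : HasLocalDualBasis f (Ideal.span {z}))
    (hz : ∀ b, z * b = b * z) (I : ModuleCat.{u} B) [Injective I] :
    Injective (kerRestrict f hz I) := by
  have : Module.Injective B I := Module.injective_module_of_injective_object B I
  let _ : Module A (centralKer hz I) := Module.compHom _ f
  have : Module.Injective A (centralKer hz I) := hN.injective (fun _ _ ↦ rfl)
    (centralKer hz I).subtype Subtype.val_injective
    (fun y hy ↦ ⟨⟨y, hy z (Ideal.mem_span_singleton_self z)⟩, rfl⟩) fun b hb x ↦ by
      obtain ⟨b, rfl⟩ := Ideal.mem_span_singleton'.1 hb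
      exact Subtype.ext ((mul_smul b z x.1).trans ((congrArg (b • ·) x.2).trans (smul_zero b)))
  exact Module.injective_object_of_injective_module A (centralKer hz I)

/-- For z-divisible Z the snake lemma keeps the kernels of z in an injective presentation exact, the
cokernel is again divisible, and `injective_kerRestrict` starts the induction. -/
theorem hasInjectiveDimensionLT_kerRestrict (hN : HasLocalDualBasis f (Ideal.span {z}))
    (hz : ∀ b, z * b = b * z) (hzr : ∀ b, b * z = 0 → b = 0) (n : ℕ) (Z : ModuleCat.{u} B)
    (hZ : IsDivisibleBy z Z) (hn : HasInjectiveDimensionLT Z (n + 1)) :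
    HasInjectiveDimensionLT (kerRestrict f hz Z) (n + 1) := by
  induction n generalizing Z with
  | zero =>
    have : Injective Z := injective_iff_hasInjectiveDimensionLT_one.2 hn
    exact injective_iff_hasInjectiveDimensionLT_one.1 (injective_kerRestrict hN hz Z)
  | succ n ih =>
    let P : InjectivePresentation Z := Classical.arbitrary _
    let T := ShortComplex.mk _ _ (cokernel.condition P.f)
    have hT : T.ShortExact := { exact := ShortComplex.exact_cokernel P.f }
    have hI : Injective T.X₂ := P.injective
    have hI' : Module.Injective B T.X₂ := Module.injective_module_of_injective_object B _
    have hdiv := isDivisibleBy_of_injective hzr T.X₂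
    have hsurj : Function.Surjective T.g.hom := hT.moduleCat_surjective_g
    have hinj : Function.Injective T.f.hom := hT.moduleCat_injective_f
    have hex := (ShortComplex.ShortExact.moduleCat_exact_iff_function_exact _).1 hT.exact
    have h3 := ih T.X₃ (fun y ↦ by
      obtain ⟨y, rfl⟩ := hsurj y
      obtain ⟨x, rfl⟩ := hdiv y
      exact ⟨T.g.hom x, (map_smul T.g.hom z x).symm⟩)
      ((hT.hasInjectiveDimensionLT_X₃_iff n hI).2 hn)
    let F : centralKer hz T.X₁ →ₗ[B] centralKer hz T.X₂ := T.f.hom.restrict fun x hx ↦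
      (map_smul T.f.hom z x).symm.trans ((congrArg T.f.hom hx).trans (map_zero T.f.hom))
    let G : centralKer hz T.X₂ →ₗ[B] centralKer hz T.X₃ := T.g.hom.restrict fun x hx ↦
      (map_smul T.g.hom z x).symm.trans ((congrArg T.g.hom hx).trans (map_zero T.g.hom))
    have hFG : Function.Exact F G := by
      intro y
      constructor
      · intro hy
        obtain ⟨x, hx⟩ := (hex y.1).1 (congrArg Subtype.val hy)
        refine ⟨⟨x, hinj ?_⟩, Subtype.ext hx⟩
        exact (map_smul T.f.hom z x).trans
          ((congrArg (z • ·) hx).trans (y.2.trans (map_zero T.f.hom).symm))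
      · rintro ⟨x, rfl⟩
        exact Subtype.ext (hex.apply_apply_eq_zero x.1)
    have hG : Function.Surjective G := by
      rintro ⟨y, hy⟩
      obtain ⟨y, rfl⟩ := hsurj y
      obtain ⟨x, hx⟩ := (hex (z • y)).1 ((map_smul T.g.hom z y).trans hy)
      obtain ⟨x', rfl⟩ := hZ x
      refine ⟨⟨y - T.f.hom x', ?_⟩, Subtype.ext ?_⟩
      · exact (smul_sub z y _).trans (sub_eq_zero.2 (hx.symm.trans (map_smul T.f.hom z x')))
      · exact (map_sub T.g.hom _ _).trans
          ((congrArg (T.g.hom y - ·) (hex.apply_apply_eq_zero x')).trans (sub_zero _))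
    have hS := ModuleCat.shortComplex_shortExact
      (ShortComplex.mk (ModuleCat.ofHom F) (ModuleCat.ofHom G)
        (ModuleCat.hom_ext (LinearMap.ext fun x ↦ hFG.apply_apply_eq_zero x))) hFG
      (fun x y hxy ↦ Subtype.ext (hinj (congrArg Subtype.val hxy))) hG
    exact ((hS.map_of_exact (ModuleCat.restrictScalars.{u} f)).hasInjectiveDimensionLT_X₃_iff n
      (injective_kerRestrict hN hz T.X₂)).1 h3

/-- A change of rings for injective dimensions in the manner of Rees. -/
theorem hasInjectiveDimensionLT_of_regular (hN : HasLocalDualBasis f (Ideal.span {z}))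
    (hz : ∀ b, z * b = b * z) (hzr : ∀ b, b * z = 0 → b = 0) (c : B →+ A)
    (hc : ∀ a b, c (f a * b) = a * c b) (hcz : ∀ b, c (b * z) = 0) (hc1 : c 1 = 1) (n : ℕ)
    (hn : HasInjectiveDimensionLT (ModuleCat.of B B) (n + 1)) :
    HasInjectiveDimensionLT (ModuleCat.of A A) n := by
  cases n with
  | zero =>
    have : Injective (ModuleCat.of B B) := injective_iff_hasInjectiveDimensionLT_one.2 hn
    have : Module.Injective B B := Module.injective_module_of_injective_object B (ModuleCat.of B B)
    -- If B were self-injective, z would divide 1, and then 1 = c(1) = 0 in A.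
    obtain ⟨y, hy⟩ := isDivisibleBy_of_injective hzr B (1 : B)
    have h01 : (1 : A) = 0 := by
      rw [← hc1, ← hy, smul_eq_mul, hz, hcz]
    have : Subsingleton A := subsingleton_of_zero_eq_one h01.symm
    exact (ModuleCat.isZero_of_subsingleton (ModuleCat.of A A)).hasInjectiveDimensionLT_zero
  | succ n =>
    let P : InjectivePresentation (ModuleCat.of B B) := Classical.arbitrary _
    let T := ShortComplex.mk _ _ (cokernel.condition P.f)
    have hT : T.ShortExact := { exact := ShortComplex.exact_cokernel P.f }
    have hI : Injective T.X₂ := P.injective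
    have hI' : Module.Injective B T.X₂ := Module.injective_module_of_injective_object B _
    have hdiv := isDivisibleBy_of_injective hzr T.X₂
    have hsurj : Function.Surjective T.g.hom := hT.moduleCat_surjective_g
    have hinj : Function.Injective T.f.hom := hT.moduleCat_injective_f
    have hex := (ShortComplex.ShortExact.moduleCat_exact_iff_function_exact _).1 hT.exact
    have h3 := hasInjectiveDimensionLT_kerRestrict hN hz hzr n T.X₃ (fun y ↦ by
      obtain ⟨y, rfl⟩ := hsurj y
      obtain ⟨x, rfl⟩ := hdiv y
      exact ⟨T.g.hom x, (map_smul T.g.hom z x).symm⟩)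
      ((hT.hasInjectiveDimensionLT_X₃_iff n hI).2 hn)
    let φ : B →ₗ[B] T.X₂ := T.f.hom
    -- The connecting map of the snake lemma for multiplication by z, from the kernel on the
    -- cokernel of B in its injective hull-like cover to B / zB. Followed by c it is a map to A,
    -- split by an element x₁ that is sent to 1.
    have hrep (x : centralKer hz T.X₃) : ∃ (y : T.X₂) (b : B), T.g.hom y = x.1 ∧ φ b = z • y := by
      obtain ⟨y, hy⟩ := hsurj x.1
      obtain ⟨b, hb⟩ := (hex (z • y)).1
        ((map_smul T.g.hom z y).trans ((congrArg (z • ·) hy).trans x.2))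
      exact ⟨y, b, hy, hb⟩
    choose y β hy hβ using hrep
    have huniq (x : centralKer hz T.X₃) (y' : T.X₂) (b : B) (h1 : T.g.hom y' = x.1)
        (h2 : φ b = z • y') : c (β x) = c b := by
      obtain ⟨b', hb'⟩ := (hex (y x - y')).1
        ((map_sub T.g.hom _ _).trans (sub_eq_zero.2 ((hy x).trans h1.symm)))
      have h3 : β x - b = b' * z := by
        refine hinj ?_
        change φ _ = φ _
        rw [map_sub, hβ, h2, ← smul_sub, ← hz, ← smul_eq_mul, map_smul]
        exact congrArg (z • ·) hb'.symm
      rw [← sub_eq_zero, ← map_sub, h3, hcz]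
    let ρ : kerRestrict f hz T.X₃ ⟶ ModuleCat.of A A :=
      ModuleCat.ofHom (X := kerRestrict f hz T.X₃) (Y := ModuleCat.of A A)
        { toFun := fun x : centralKer hz T.X₃ ↦ c (β x)
          map_add' := fun (x x' : centralKer hz T.X₃) ↦
            (huniq (x + x') (y x + y x') (β x + β x')
              ((map_add T.g.hom _ _).trans (congrArg₂ (· + ·) (hy x) (hy x')))
              (by rw [map_add, hβ, hβ, smul_add])).trans (map_add c _ _)
          map_smul' := fun a (x : centralKer hz T.X₃) ↦
            (huniq (f a • x) (f a • y x) (f a * β x)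
              ((map_smul T.g.hom _ _).trans (congrArg (f a • ·) (hy x)))
              (by rw [← smul_eq_mul, map_smul, hβ, ← mul_smul, ← mul_smul, hz])).trans
              (hc a _) }
    obtain ⟨y₁, hy₁⟩ := hdiv (φ 1)
    let x₁ : centralKer hz T.X₃ := ⟨T.g.hom y₁, (map_smul T.g.hom z y₁).symm.trans
      ((congrArg T.g.hom hy₁).trans (hex.apply_apply_eq_zero (1 : B)))⟩
    let r : Retract (ModuleCat.of A A) (kerRestrict f hz T.X₃) :=
      { i := ModuleCat.ofHom (X := ModuleCat.of A A) (Y := kerRestrict f hz T.X₃)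
          (LinearMap.toSpanSingleton A (kerRestrict f hz T.X₃) x₁)
        r := ρ
        retract := ModuleCat.hom_ext (LinearMap.ext fun (a : A) ↦
          (ρ.hom.map_smul a _).trans (by
            change a * c (β x₁) = a
            rw [huniq x₁ y₁ 1 rfl hy₁.symm, hc1, mul_one])) }
    exact r.hasInjectiveDimensionLT (n + 1)

end Rees

end HomTr

namespace HomTr

/-! ### The central case -/

section Central

variable {k : Type v} [Field k] {S Q : Type u} [Ring S] [Algebra k S] [Ring Q] [Algebra k Q]
variable {ι : S →ₐ[k] Q} {t : Q}

namespace IsSkewFractionRing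

section

variable {σ : S ≃ₐ[k] S}

/-- Elements of the enveloping algebra are fractions of polynomials in two variables. -/
theorem exists_envCoeff_sum (h : IsSkewFractionRing σ ι t) (s : Finset (Env k Q)) :
    ∃ (M : (Env k Q)ˣ) (d d' : ℕ), ∀ b ∈ s, ↑M * b = ∑ i : Fin d, ∑ j : Fin d',
      ((t ^ (i : ℕ)) ⊗ₜ[k] (MulOpposite.op t ^ (j : ℕ))) * envHom ι (h.envCoeff
        ((((↑h.unit⁻¹ : Q) ^ (i : ℕ)) ⊗ₜ[k] (MulOpposite.op (↑h.unit⁻¹ : Q) ^ (j : ℕ))) *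
          (↑M * b))) := by
  obtain ⟨s₁, s₂, hs⟩ := exists_finset_tensor s
  obtain ⟨n, m, d, hm, hd⟩ := h.exists_common_den s₁
  obtain ⟨n', m', d', hm', hd'⟩ := h.op.exists_common_den s₂
  obtain ⟨m, rfl⟩ := h.isUnit_of_monic hm
  obtain ⟨m', rfl⟩ := h.op.isUnit_of_monic hm'
  let M : (Env k Q)ˣ :=
    { val := (m : Q) ⊗ₜ (m' : Qᵐᵒᵖ)
      inv := (↑m⁻¹ : Q) ⊗ₜ (↑m'⁻¹ : Qᵐᵒᵖ)
      val_inv := by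
        rw [Algebra.TensorProduct.tmul_mul_tmul, Units.mul_inv, Units.mul_inv]
        rfl
      inv_val := by
        rw [Algebra.TensorProduct.tmul_mul_tmul, Units.inv_mul, Units.inv_mul]
        rfl }
  refine ⟨M, d, d', fun b hb ↦ ?_⟩
  -- The asserted expansion divided by M, as an operator; it fixes pure tensors because each factor
  -- is a polynomial after clearing denominators.
  let L : Env k Q →ₗ[k] Env k Q := LinearMap.mulLeft k (↑M⁻¹ : Env k Q) ∘ₗ
    (∑ i : Fin d, ∑ j : Fin d',
      LinearMap.mulLeft k ((t ^ (i : ℕ)) ⊗ₜ[k] (MulOpposite.op t ^ (j : ℕ))) ∘ₗ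
        (Algebra.TensorProduct.map ι (opHom ι)).toLinearMap ∘ₗ h.envCoeff ∘ₗ LinearMap.mulLeft k
          (((↑h.unit⁻¹ : Q) ^ (i : ℕ)) ⊗ₜ[k] (MulOpposite.op (↑h.unit⁻¹ : Q) ^ (j : ℕ)))) ∘ₗ
    LinearMap.mulLeft k (M : Env k Q)
  have L_apply (b : Env k Q) : L b = ↑M⁻¹ * ∑ i : Fin d, ∑ j : Fin d',
      ((t ^ (i : ℕ)) ⊗ₜ[k] (MulOpposite.op t ^ (j : ℕ))) * envHom ι (h.envCoeff
        ((((↑h.unit⁻¹ : Q) ^ (i : ℕ)) ⊗ₜ[k] (MulOpposite.op (↑h.unit⁻¹ : Q) ^ (j : ℕ))) *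
          (↑M * b))) := by
    simp only [L, LinearMap.comp_apply, LinearMap.sum_apply, envHom_eq]
    rfl
  have hL := hs L (fun q hq q' hq' ↦ ?_) b hb
  · exact ((Units.inv_mul_eq_iff_eq_mul _).1 ((L_apply b).symm.trans hL)).symm
  · have h1 := h.sum_coeffZero h.unit_mul_inv h.inv_mul_unit (hd q hq)
    have h2 := h.op.sum_coeffZero (t' := MulOpposite.op (↑h.unit⁻¹ : Q))
      (by rw [← MulOpposite.op_mul, h.inv_mul_unit, MulOpposite.op_one])
      (by rw [← MulOpposite.op_mul, h.unit_mul_inv, MulOpposite.op_one]) (hd' q' hq')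
    have h3 : (M : Env k Q) * (q ⊗ₜ q') = (m * q) ⊗ₜ (m' * q') :=
      Algebra.TensorProduct.tmul_mul_tmul ..
    rw [L_apply, Units.inv_mul_eq_iff_eq_mul, h3]
    conv_rhs => rw [← h1, ← h2]
    rw [sum_tmul]
    refine Finset.sum_congr rfl fun i _ ↦ ?_
    rw [tmul_sum]
    refine Finset.sum_congr rfl fun j _ ↦ ?_
    rw [Algebra.TensorProduct.tmul_mul_tmul, envCoeff_tmul, envHom_eq]
    exact Algebra.TensorProduct.tmul_mul_tmul ..

theorem coeffZero_op_zpow (h : IsSkewFractionRing σ ι t) {j : ℤ} (hj : j ≠ 0) :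
    h.op.coeffZero (MulOpposite.op (↑(h.unit ^ j) : Q)) = 0 := by
  rw [← h.op.coeffZero_zpow hj]
  congr 1
  have e (n : ℕ) : MulOpposite.op (↑(h.unit ^ n) : Q) = (↑(h.op.unit ^ n) : Qᵐᵒᵖ) := by
    rw [Units.val_pow_eq_pow_val, Units.val_pow_eq_pow_val, MulOpposite.op_pow]
    rfl
  obtain ⟨n, rfl | rfl⟩ := j.eq_nat_or_neg
  · rw [zpow_natCast, zpow_natCast, e]
  · rw [zpow_neg, zpow_natCast, zpow_neg, zpow_natCast]
    refine (Units.inv_eq_of_mul_eq_one_right ?_).symm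
    rw [← e, ← MulOpposite.op_mul, Units.inv_mul, MulOpposite.op_one]

end

variable (h : IsSkewFractionRing AlgEquiv.refl ι t)

include h in
-- With trivial automorphism t commutes with polynomials, hence with inverses of monic ones.
theorem commute_variable (q : Q) : Commute t q := by
  have hp {d : ℕ} {p : Q} (hp : p ∈ polyLT ι t d) : Commute t p := by
    induction hp using Submodule.span_induction with
    | mem p hp =>
      obtain ⟨i, _, a, rfl⟩ := hp
      exact Commute.mul_right (h.comm a) ((Commute.refl t).pow_right i)
    | zero => exact Commute.zero_right t
    | add p q _ _ hp hq => exact hp.add_right hq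
    | smul c p _ hp => exact hp.smul_right c
  obtain ⟨n, m, d, hm, hd⟩ := h.left_den q
  obtain ⟨m', rfl⟩ := h.isUnit_of_monic hm
  have hm' : Commute t (m' : Q) := hp hm.mem
  have := hm'.units_inv_right.mul_right (hp hd)
  rwa [Units.inv_mul_cancel_left] at this

/-- The central element `t ⊗ 1 - 1 ⊗ t` of the enveloping algebra. -/
noncomputable def envDiff (_ : IsSkewFractionRing AlgEquiv.refl ι t) : Env k Q :=
  t ⊗ₜ 1 - 1 ⊗ₜ MulOpposite.op t

include h

theorem commute_left (b : Env k Q) : Commute (t ⊗ₜ[k] (1 : Qᵐᵒᵖ)) b := by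
  induction b using TensorProduct.induction_on with
  | zero => exact Commute.zero_right _
  | add x y hx hy => exact hx.add_right hy
  | tmul p q =>
    change _ * _ = _ * _
    rw [Algebra.TensorProduct.tmul_mul_tmul, Algebra.TensorProduct.tmul_mul_tmul, one_mul, mul_one,
      h.commute_variable p]

theorem commute_right (b : Env k Q) : Commute ((1 : Q) ⊗ₜ[k] MulOpposite.op t) b := by
  induction b using TensorProduct.induction_on with
  | zero => exact Commute.zero_right _
  | add x y hx hy => exact hx.add_right hy
  | tmul p q =>
    obtain ⟨q, rfl⟩ := MulOpposite.op_surjective q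
    change _ * _ = _ * _
    rw [Algebra.TensorProduct.tmul_mul_tmul, Algebra.TensorProduct.tmul_mul_tmul, one_mul, mul_one,
      ← MulOpposite.op_mul, ← MulOpposite.op_mul, h.commute_variable q]

theorem envDiff_mul_comm (b : Env k Q) : h.envDiff * b = b * h.envDiff :=
  (h.commute_left b).sub_left (h.commute_right b)

theorem envUnit_mul_right : ((1 : Q) ⊗ₜ[k] MulOpposite.op t) * (envUnit k h.unit : Env k Q) =
    t ⊗ₜ[k] (1 : Qᵐᵒᵖ) := by
  rw [coe_envUnit, Algebra.TensorProduct.tmul_mul_tmul, one_mul, ← MulOpposite.op_mul,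
    h.inv_mul_unit, coe_unit]
  rfl

/-- The central element factors as (1 ⊗ t)(w − 1) with w = t ⊗ t⁻¹. Anything invariant under right
multiplication by w therefore kills its multiples. -/
theorem mul_envDiff (b : Env k Q) : b * h.envDiff = b * ((1 : Q) ⊗ₜ[k] MulOpposite.op t) *
    (envUnit k h.unit : Env k Q) - b * ((1 : Q) ⊗ₜ[k] MulOpposite.op t) := by
  rw [mul_assoc, h.envUnit_mul_right, envDiff, mul_sub]

/-- After a denominator M is cleared, b is rebuilt from coefficients of its left multiples. -/
theorem eq_zero_of_envCoeff {b : Env k Q} (hb : ∀ c, h.envCoeff (c * b) = 0) : b = 0 := by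
  obtain ⟨M, d, d', hM⟩ := h.exists_envCoeff_sum {b}
  have := hM b (Finset.mem_singleton_self b)
  simp only [← mul_assoc, hb, map_zero, mul_zero, Finset.sum_const_zero] at this
  exact (Units.mul_right_eq_zero M).1 this

/-- If bz = 0 then bw = b, so all coefficients of cb along the powers of w are equal; almost all
vanish, hence all do. -/
theorem eq_zero_of_mul_envDiff {b : Env k Q} (hb : b * h.envDiff = 0) : b = 0 := by
  have h1 : b * (envUnit k h.unit : Env k Q) = b := by
    have hu : IsUnit ((1 : Q) ⊗ₜ[k] MulOpposite.op t) :=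
      h.isUnit_t.op.map (Algebra.TensorProduct.includeRight : Qᵐᵒᵖ →ₐ[k] Env k Q)
    rw [h.mul_envDiff, sub_eq_zero, ← (h.commute_right b).eq, mul_assoc] at hb
    exact hu.mul_left_cancel hb
  have h2 (n : ℤ) : b * (↑(envUnit k h.unit ^ n) : Env k Q) = b := by
    induction n using Int.induction_on with
    | zero => rw [zpow_zero, Units.val_one, mul_one]
    | succ n ih => rw [zpow_add_one, Units.val_mul, ← mul_assoc, ih, h1]
    | pred n ih =>
      rw [zpow_sub_one, Units.val_mul, ← mul_assoc, ih, Units.mul_inv_eq_iff_eq_mul, h1]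
  refine h.eq_zero_of_envCoeff fun c ↦ ?_
  obtain ⟨j, hj⟩ := (h.envCoeff_mul_zpow_eventually (c * b)).exists
  rwa [mul_assoc, h2] at hj

/-- The sum of the coefficients of the powers of `t ⊗ t⁻¹`. -/
noncomputable def envTrace : Env k Q →+ Env k S :=
  AddMonoidHom.mk' (fun b ↦ ∑ᶠ j : ℤ, h.envCoeff (b * (↑(envUnit k h.unit ^ (-j)) : Env k Q)))
    fun b c ↦ by
      rw [← finsum_add_distrib (h.envCoeff_mul_zpow_eventually b)
        (h.envCoeff_mul_zpow_eventually c)]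
      simp only [add_mul, map_add]

theorem envTrace_apply (b : Env k Q) : h.envTrace b =
    ∑ᶠ j : ℤ, h.envCoeff (b * (↑(envUnit k h.unit ^ (-j)) : Env k Q)) := rfl

theorem envTrace_map_mul (e : Env k S) (b : Env k Q) :
    h.envTrace (envHom ι e * b) = e * h.envTrace b := by
  rw [envTrace_apply, envTrace_apply, mul_finsum' _ _ (h.envCoeff_mul_zpow_eventually b)]
  simp only [mul_assoc, h.envCoeff_map_mul]

theorem envTrace_mul_unit (b : Env k Q) :
    h.envTrace (b * (envUnit k h.unit : Env k Q)) = h.envTrace b := by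
  rw [envTrace_apply, envTrace_apply, ← finsum_comp_equiv (Equiv.addRight (1 : ℤ))]
  refine finsum_congr fun j ↦ ?_
  rw [mul_assoc, ← Units.val_mul, ← zpow_one_add]
  simp

theorem envTrace_mul_map (b : Env k Q) (e : Env k S) :
    h.envTrace (b * envHom ι e) = h.envTrace b * e := by
  have hw (j : ℤ) : Commute (envHom ι e) (↑(envUnit k h.unit ^ j) : Env k Q) := by
    refine Commute.units_zpow_right ?_ j
    have := h.envUnit_mul_envHom e
    have e1 : envCongr k (AlgEquiv.refl : S ≃ₐ[k] S) e = e := by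
      induction e using TensorProduct.induction_on with
      | zero => exact map_zero _
      | add x y hx hy => rw [map_add, hx (h.envUnit_mul_envHom x), hy (h.envUnit_mul_envHom y)]
      | tmul => rfl
    rw [e1] at this
    exact this.symm
  rw [envTrace_apply, envTrace_apply, finsum_mul' _ _ (h.envCoeff_mul_zpow_eventually b)]
  refine finsum_congr fun j ↦ ?_
  rw [mul_assoc, (hw _).eq, ← mul_assoc, h.envCoeff_mul_map]

theorem envTrace_mul_envDiff (b : Env k Q) : h.envTrace (b * h.envDiff) = 0 := by
  rw [h.mul_envDiff, map_sub, h.envTrace_mul_unit, sub_self]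

/-- The product of (t ⊗ 1)ⁿ with w⁻ʲ is tⁿ⁻ʲ ⊗ tʲ, whose coefficient is nonzero only for n = j = 0.
-/
theorem envTrace_zpow (n : ℤ) :
    h.envTrace (↑(h.unitT Qᵐᵒᵖ ^ n) : Env k Q) = if n = 0 then 1 else 0 := by
  have key (j : ℤ) : (↑(h.unitT Qᵐᵒᵖ ^ n) : Env k Q) * (↑(envUnit k h.unit ^ (-j)) : Env k Q) =
      (↑(h.unit ^ (n - j)) : Q) ⊗ₜ[k] MulOpposite.op (↑(h.unit ^ j) : Q) := by
    have e1 : (↑(h.unitT Qᵐᵒᵖ ^ n) : Env k Q) = (↑(h.unit ^ n) : Q) ⊗ₜ[k] (1 : Qᵐᵒᵖ) := by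
      rw [unitT, ← map_zpow]
      rfl
    rw [e1, ← map_zpow, coe_envUnit, Algebra.TensorProduct.tmul_mul_tmul, one_mul,
      ← Units.val_mul, ← zpow_add, sub_eq_add_neg, zpow_neg, inv_inv]
  rw [envTrace_apply, finsum_eq_single _ 0]
  · rw [key, envCoeff_tmul, sub_zero, zpow_zero, Units.val_one, MulOpposite.op_one, coeffZero_one]
    split_ifs with hn
    · rw [hn, zpow_zero, Units.val_one, coeffZero_one]
      rfl
    · rw [h.coeffZero_zpow hn, zero_tmul]
  · intro j hj
    rw [key, envCoeff_tmul, h.coeffZero_op_zpow hj, tmul_zero]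

theorem pow_sub_pow_mem (i : ℕ) : ((1 : Q) ⊗ₜ[k] MulOpposite.op t) ^ i -
    (t ⊗ₜ[k] (1 : Qᵐᵒᵖ)) ^ i ∈ Ideal.span {h.envDiff} := by
  induction i with
  | zero => simp
  | succ i ih =>
    have e : ((1 : Q) ⊗ₜ[k] MulOpposite.op t) ^ (i + 1) - (t ⊗ₜ[k] (1 : Qᵐᵒᵖ)) ^ (i + 1) =
        ((1 : Q) ⊗ₜ[k] MulOpposite.op t) * (((1 : Q) ⊗ₜ[k] MulOpposite.op t) ^ i -
          (t ⊗ₜ[k] (1 : Qᵐᵒᵖ)) ^ i) - (t ⊗ₜ[k] (1 : Qᵐᵒᵖ)) ^ i * h.envDiff := by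
      rw [← h.envDiff_mul_comm, envDiff, pow_succ', pow_succ', mul_sub, sub_mul]
      abel
    rw [e]
    exact sub_mem (Ideal.mul_mem_left _ _ ih)
      (Ideal.mul_mem_left _ _ (Ideal.mem_span_singleton_self _))

/-- Modulo z the two variables t ⊗ 1 and 1 ⊗ t coincide, so fractions of two-variable polynomials
reduce to polynomials in t ⊗ 1 alone, whose coefficients `envTrace` recovers. -/
theorem hasLocalDualBasis_envDiff :
    HasLocalDualBasis (envHom ι) (Ideal.span {h.envDiff}) := by
  refine hasLocalDualBasis_of_coeff (h.unitT Qᵐᵒᵖ) h.envTrace h.envTrace_mul_map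
    (fun b hb ↦ ?_) h.envTrace_zpow fun s ↦ ?_
  · obtain ⟨b, rfl⟩ := Ideal.mem_span_singleton'.1 hb
    exact h.envTrace_mul_envDiff b
  · obtain ⟨M, d, d', hM⟩ := h.exists_envCoeff_sum s
    refine ⟨M, d + d', fun b hb ↦ ?_⟩
    let G : AddSubgroup (Env k Q) :=
      { carrier := {x | ∃ a : ℕ → Env k S, x - ∑ l ∈ Finset.range (d + d'),
          (h.unitT Qᵐᵒᵖ : Env k Q) ^ l * envHom ι (a l) ∈ Ideal.span {h.envDiff}}
        add_mem' := by
          rintro x y ⟨a, ha⟩ ⟨a', ha'⟩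
          refine ⟨a + a', ?_⟩
          convert add_mem ha ha' using 1
          simp only [Pi.add_apply, map_add, mul_add, Finset.sum_add_distrib]
          abel
        zero_mem' := ⟨0, by simp⟩
        neg_mem' := by
          rintro x ⟨a, ha⟩
          refine ⟨-a, ?_⟩
          convert neg_mem ha using 1
          simp only [Pi.neg_apply, map_neg, mul_neg, Finset.sum_neg_distrib]
          abel }
    suffices hG : ∀ (i : Fin d) (j : Fin d') (e : Env k S),
        (t ^ (i : ℕ)) ⊗ₜ[k] (MulOpposite.op t ^ (j : ℕ)) * envHom ι e ∈ G by
      change ↑M * b ∈ G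
      rw [hM b hb]
      exact sum_mem fun i _ ↦ sum_mem fun j _ ↦ hG i j _
    intro i j e
    -- Modulo z the monomial tⁱ ⊗ tʲ is (t ⊗ 1)ⁱ⁺ʲ, which explains the range d + d'.
    refine ⟨Pi.single ((i : ℕ) + j) e, ?_⟩
    rw [Finset.sum_eq_single ((i : ℕ) + j), Pi.single_eq_same, ← sub_mul, coe_unitT]
    · obtain ⟨b', hb'⟩ := Ideal.mem_span_singleton'.1 (h.pow_sub_pow_mem (j : ℕ))
      have e : (t ^ (i : ℕ)) ⊗ₜ[k] (MulOpposite.op t ^ (j : ℕ)) - (t ⊗ₜ[k] (1 : Qᵐᵒᵖ)) ^ ((i : ℕ) + j) =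
          (t ⊗ₜ[k] (1 : Qᵐᵒᵖ)) ^ (i : ℕ) * (b' * h.envDiff) := by
        simp only [hb', mul_sub, pow_add, Algebra.TensorProduct.tmul_pow, one_pow,
          Algebra.TensorProduct.tmul_mul_tmul, one_mul, mul_one]
      rw [e, mul_assoc, mul_assoc, h.envDiff_mul_comm, ← mul_assoc, ← mul_assoc]
      exact Ideal.mul_mem_left _ _ (Ideal.mem_span_singleton_self _)
    · intro l _ hl
      rw [Pi.single_eq_of_ne hl, map_zero, mul_zero]
    · intro hij
      exact absurd (Finset.mem_range.2 (by omega)) hij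

theorem hasInjectiveDimensionLT_env (n : ℕ)
    (hn : HasInjectiveDimensionLT (ModuleCat.of (Env k Q) (Env k Q)) (n + 1)) :
    HasInjectiveDimensionLT (ModuleCat.of (Env k S) (Env k S)) n :=
  hasInjectiveDimensionLT_of_regular h.hasLocalDualBasis_envDiff h.envDiff_mul_comm
    (fun _ ↦ h.eq_zero_of_mul_envDiff) h.envTrace h.envTrace_map_mul h.envTrace_mul_envDiff
    (by simpa using h.envTrace_zpow 0) n hn

/-- The drop by one is `hasInjectiveDimensionLT_env`; the bounds 0 and −∞ for Q both force −∞ for S,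
which absorbs the added 1. -/
theorem htr_add_one_le : htr k S + 1 ≤ htr k Q := by
  have key (n : ℕ) (hn : htr k Q ≤ n) : htr k S < n :=
    injectiveDimension_lt_iff.2
      (h.hasInjectiveDimensionLT_env n ((injectiveDimension_le_iff _ n).1 hn))
  generalize htr k Q = d at key
  have hbot (hlt : htr k S < (0 : ℕ)) : htr k S = ⊥ :=
    (injectiveDimension_eq_bot_iff _).2
      ((hasInjectiveDimensionLT_zero_iff_isZero _).1 (injectiveDimension_lt_iff.1 hlt))
  induction d with
  | bot => rw [hbot (key 0 bot_le), WithBot.bot_add]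
  | coe d =>
    induction d with
    | top => exact le_top
    | coe m =>
      have h1 := key m le_rfl
      cases m with
      | zero =>
        rw [hbot h1, WithBot.bot_add]
        exact bot_le
      | succ p =>
        have h2 : htr k S ≤ p :=
          (injectiveDimension_le_iff _ p).2 (injectiveDimension_lt_iff.1 h1)
        exact add_le_add_left h2 1

end IsSkewFractionRing

end Central

end HomTr

namespace HomTr

/-! ### The squeezes that prove the three statements. -/

section

variable {k : Type v} [Field k] {S Q : Type u} [Ring S] [Algebra k S] [Ring Q] [Algebra k Q]
variable {σ : S ≃ₐ[k] S} {ι : S →ₐ[k] Q} {t : Q}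

/-- n is the exact projective dimension, which is not −∞ because S ≠ 0; in that degree Ext into Sᵉ
survives. -/
theorem IsSmooth.exists_dimension [Nontrivial S] [IsNoetherianRing (Env k S)]
    (hs : IsSmooth k S) : ∃ n : ℕ, (n : WithBot ℕ∞) ≤ fhtr k S ∧
      HasProjectiveDimensionLT (bimod k S) (n + 1) := by
  classical
  have hex : ∃ n, HasProjectiveDimensionLT (bimod k S) n := by
    obtain ⟨n, hn⟩ := (projectiveDimension_ne_top_iff _).1 hs.ne
    exact ⟨n + 1, hn⟩
  have hmin (m : ℕ) (hm : m < Nat.find hex) := Nat.find_min hex hm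
  have hspec := Nat.find_spec hex
  generalize Nat.find hex = m at hmin hspec
  cases m with
  | zero =>
    have h0 := (hasProjectiveDimensionLT_zero_iff_isZero _).1 hspec
    have : Subsingleton (bimod k S) := ModuleCat.subsingleton_of_isZero h0
    have : Subsingleton S := (toBimod k S).toEquiv.subsingleton
    exact (not_subsingleton S this).elim
  | succ n =>
    exact ⟨n, le_fhtr (nontrivial_ext_of_projectiveDimension hspec (hmin n (Nat.lt_succ_self n))),
      hspec⟩

theorem injdim_le_of_hasProjectiveDimensionLT [IsSemisimpleRing S] (U : Type u) [Ring U]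
    [Algebra k U] [IsSemisimpleRing U] {n : ℕ}
    (hn : HasProjectiveDimensionLT (bimod k S) (n + 1)) : injdim (S ⊗[k] U) ≤ n :=
  (injectiveDimension_le_iff _ n).2
    (hasInjectiveDimensionLT_of_hasProjectiveDimensionLT_bimod hn _)

namespace IsSkewFractionRing

variable (h : IsSkewFractionRing σ ι t)

include h

theorem isSmooth [IsSemisimpleRing S] (hQ : IsSmooth k Q) : IsSmooth k S := by
  obtain ⟨n, hn⟩ := (projectiveDimension_ne_top_iff _).1 hQ.ne
  exact lt_top_iff_ne_top.2 ((projectiveDimension_ne_top_iff _).2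
    ⟨n, h.hasProjectiveDimensionLT_bimod (n := n + 1) hn⟩)

theorem isDoublyNoetherian (hS : IsDoublyNoetherian k S) : IsDoublyNoetherian k Q :=
  h.isNoetherianBothSides_tensor Qᵐᵒᵖ (h.isNoetherianBothSides_tensor_op S hS)

/-- With n the projective dimension of S, htr Q ≤ injdim(S ⊗ Q°) + 1 ≤ n + 1 ≤ htr S + 1 on one
side, and htr S + 1 ≤ n + 1 ≤ fhtr S + 1 = fhtr Q ≤ htr Q on the other. -/
theorem htr_eq_of_isSmooth [IsSimpleRing S] [IsArtinianRing S] (hS : IsDoublyNoetherian k S)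
    (hs : IsSmooth k S) : htr k Q = htr k S + 1 := by
  have := hS.1
  have := h.isSimpleRing
  have := h.isArtinianRing
  have : IsSemisimpleRing S := inferInstance
  have : IsSemisimpleRing Q := inferInstance
  have := (h.isNoetherianBothSides_tensor_op S hS).1
  obtain ⟨n, hn, hn'⟩ := hs.exists_dimension
  apply le_antisymm
  · refine (h.injdim_tensor_le Qᵐᵒᵖ).trans (add_le_add_left ?_ 1)
    exact (injdim_le_of_hasProjectiveDimensionLT Qᵐᵒᵖ hn').trans (hn.trans (fhtr_le_htr k S))
  · refine (add_le_add_left ((injdim_le_of_hasProjectiveDimensionLT Sᵐᵒᵖ hn').trans hn) 1).trans ?_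
    rw [← h.fhtr_eq]
    exact fhtr_le_htr k Q

/-- All terms agree in htr S + 1 = fhtr Q ≤ htr Q ≤ thtr Q ≤ thtr S + 1 = htr S + 1. -/
theorem isWeaklyUniform (hS : IsWeaklyUniform k S) :
    IsWeaklyUniform k Q ∧ htr k Q = htr k S + 1 := by
  have := hS.isSimpleRing
  have := hS.isArtinianRing
  have := hS.isDoublyNoetherian.1
  have := h.isSimpleRing
  have := h.isArtinianRing
  have : IsSemisimpleRing S := inferInstance
  have hQ := h.isDoublyNoetherian hS.isDoublyNoetherian
  have h1 : fhtr k Q = htr k S + 1 := by rw [h.fhtr_eq, hS.fhtr_eq_htr]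
  have h2 := fhtr_le_htr k Q
  have h3 := htr_le_thtr hQ
  have h4 : thtr k Q ≤ htr k S + 1 := hS.htr_eq_thtr ▸ h.thtr_le
  have h5 : htr k S + 1 < ⊤ := by
    have := hS.htr_eq_thtr ▸ hS.thtr_lt_top
    generalize htr k S = d at this
    induction d with
    | bot => exact WithBot.bot_lt_coe ⊤
    | coe d =>
      exact WithBot.coe_lt_coe.2
        (ENat.add_lt_top.2 ⟨WithBot.coe_lt_coe.1 this, ENat.one_lt_top⟩)
  have h6 : htr k Q = htr k S + 1 := le_antisymm (h3.trans h4) (h1 ▸ h2)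
  have h7 : thtr k Q = htr k S + 1 := le_antisymm h4 (h6 ▸ h3)
  exact ⟨⟨inferInstance, inferInstance, hQ, h1.trans h6.symm, h6.trans h7.symm, h7 ▸ h5⟩, h6⟩

end IsSkewFractionRing

/-- From htr S + 1 ≤ htr Q = fhtr Q = fhtr S + 1 one cancels 1, which is legitimate also at ±∞. -/
theorem IsSkewFractionRing.fhtr_eq_htr [IsSemisimpleRing S] [IsNoetherianRing (Env k S)]
    (h : IsSkewFractionRing AlgEquiv.refl ι t) (hQ : fhtr k Q = htr k Q) :
    fhtr k S = htr k S ∧ htr k S + 1 = htr k Q := by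
  have h1 : fhtr k S = htr k S := by
    refine le_antisymm (fhtr_le_htr k S) (add_one_le_add_one_iff.1 ?_)
    rw [← h.fhtr_eq, hQ]
    exact h.htr_add_one_le
  exact ⟨h1, by rw [← hQ, h.fhtr_eq, h1]⟩

end

end HomTr

theorem proposition2p7 {k : Type v} [Field k] {S : Type u} [Ring S] [Algebra k S]
    [IsSimpleRing S] [IsArtinianRing S] (hS : HomTr.IsDoublyNoetherian k S) (α : S ≃ₐ[k] S)
    {Q : Type u} [Ring Q] [Algebra k Q] (j : HomTr.SkewPolynomialRing α →ₐ[k] Q)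
    (hj : HomTr.IsGoldieQuotientRing (j : HomTr.SkewPolynomialRing α →+* Q)) :
    ((HomTr.IsSmooth k S ∨ HomTr.IsSmooth k Q) → HomTr.htr k Q = HomTr.htr k S + 1) ∧
    (HomTr.IsWeaklyUniform k S →
      HomTr.IsWeaklyUniform k Q ∧ HomTr.htr k Q = HomTr.htr k S + 1) ∧
    (α = AlgEquiv.refl → HomTr.fhtr k Q = HomTr.htr k Q →
      HomTr.fhtr k S = HomTr.htr k S ∧ HomTr.htr k S + 1 = HomTr.htr k Q) := by
  have : IsSemisimpleRing S := inferInstance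
  have := hS.1
  have h := hj.isSkewFractionRing
  refine ⟨fun hs ↦ ?_, fun hU ↦ h.isWeaklyUniform hU, ?_⟩
  · exact h.htr_eq_of_isSmooth hS (hs.elim id h.isSmooth)
  · rintro rfl
    exact h.fhtr_eq_htr
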